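/- Let $\varrho$ be a substitution on the binary alphabet $\{a,b\}$, and let $M=(M_{ij})$ be its substitution matrix, where $M_{ij}$ is the number of occurrences of the letter $i$ in $\varrho(j)$. Assume that $\varrho$ is primitive (some power of $M$ has only positive entries), unimodular ($\det M=\pm 1$) and Pisot (the Perron--Frobenius eigenvalue $\lambda$ of $M$ is a Pisot--Vijayaraghavan number, i.e. an algebraic integer $>1$ all of whose other conjugates have modulus $<1$). Choose natural tile lengths $\ell_a,\ell_b\in\mathbb{Q}(\lambda)$, i.e. $\ell_a,\ell_b>0$ with $(\ell_a,\ell_b)M=\lambda(\ell_a,\ell_b)$ (unique up to a common factor). Let $\star$ be the non-trivial Galois automorphism of $\mathbb{Q}(\lambda)\subset\mathbb{R}$, and let $T_{ij}\subset\mathbb{Q}(\lambda)$ be the set of relative positions of the tiles of type $i$ in $\varrho(j)$, that is, of the lengths $\ell_{u_1}+\dots+\ell_{u_n}$ of all words $u=u_1\cdots u_n$ such that $ui$ is a prefix of $\varrho(j)$. Let $W_a,W_b\subset\mathbb{R}$ be the attractors of the internal-space graph-directed iterated function system, i.e. the pair of non-empty compact sets with $$W_i=\bigcup_{j\in\{a,b\}}\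 \bigcup_{t\in T_{ij}}\bigl(\lambda^{\star}W_j+t^{\star}\bigr),\qquad i\in\{a,b\},$$ and let $W=W_a\cup W_b$, the window of the description as a regular model set of the left endpoints of the inflation tiling induced by $\varrho$. If the boundary $\partial W$ has positive Hausdorff dimension, then $W$ is an $M$-Cantorval: $W$ is compact, its interior is dense in $W$, no connected component of $W$ is isolated (relatively open in $W$), and $\partial W$ is a Cantor set (non-empty, compact, perfect and totally disconnected). For example, for $\widetilde\varrho:\ a\mapsto aab,\ b\mapsto ba$, the boundary of the window $W$ has Hausdorff dimension $\dfrac{\log(1+\sqrt2)}{2\log\tau}$ with $\tau=\frac{1+\sqrt5}{2}$, and $W$ is an $M$-Cantorval. -/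

import Mathlib

open Set
open scoped IntermediateField

noncomputable section

/-- A substitution on the binary alphabet `{a, b}`, where `0 : Fin 2` stands for `a` and
`1 : Fin 2` for `b`: it assigns to each letter a finite word. -/
def BinarySubstitution : Type := Fin 2 → List (Fin 2)

namespace BinarySubstitution

/-- The substitution matrix: `M i j` is the number of occurrences of letter `i` in `ϱ(j)`. -/
def substMatrix (ρ : BinarySubstitution) : Matrix (Fin 2) (Fin 2) ℤ :=
  Matrix.of fun i j => ((ρ j).count i : ℤ)

/-- Some power of the substitution matrix has only positive entries. -/
def IsPrimitive (ρ : BinarySubstitution) : Prop := ρ.substMatrix.IsPrimitive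

/-- The substitution matrix has determinant `1` or `-1`. -/
def IsUnimodular (ρ : BinarySubstitution) : Prop :=
  ρ.substMatrix.det = 1 ∨ ρ.substMatrix.det = -1

/-- The Perron--Frobenius eigenvalue (inflation factor) `λ`: the largest real eigenvalue of the
substitution matrix. -/
def pfEigenvalue (ρ : BinarySubstitution) : ℝ :=
  sSup (spectrum ℝ (ρ.substMatrix.map (Int.cast : ℤ → ℝ)))

end BinarySubstitution

/-- Pisot--Vijayaraghavan numbers: algebraic integers larger than `1` all of whose other algebraic
conjugates lie in the open unit disk. -/
def IsPVNumber (x : ℝ) : Prop :=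
  IsIntegral ℤ x ∧ 1 < x ∧
    ∀ z : ℂ, Polynomial.aeval z (minpoly ℚ x) = 0 → z ≠ (x : ℂ) → ‖z‖ < 1

namespace BinarySubstitution

/-- A Pisot substitution: the Perron--Frobenius eigenvalue is a PV number. -/
def IsPisot (ρ : BinarySubstitution) : Prop := IsPVNumber ρ.pfEigenvalue

/-- The number field `ℚ(λ)`, as a subfield of `ℝ`. -/
abbrev inflationField (ρ : BinarySubstitution) : IntermediateField ℚ ℝ :=
  ℚ⟮ρ.pfEigenvalue⟯

/-- The inflation factor `λ` as an element of `ℚ(λ)`. -/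
def inflationFactor (ρ : BinarySubstitution) : ρ.inflationField :=
  IntermediateField.AdjoinSimple.gen ℚ ρ.pfEigenvalue

/-- Natural tile lengths in `ℚ(λ)`: the entries of a positive left eigenvector of the substitution
matrix for the eigenvalue `λ`. They are unique up to a common positive factor. -/
def IsNaturalLength (ρ : BinarySubstitution) (len : Fin 2 → ρ.inflationField) : Prop :=
  (∀ i, 0 < (len i : ℝ)) ∧
    ∀ j, ∑ i, len i * (ρ.substMatrix i j : ρ.inflationField) = ρ.inflationFactor * len j

/-- The entry `T i j` of the displacement matrix: the relative positions of the (left endpoints of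
the) tiles of type `i` in the supertile `ϱ(j)`. -/
def displacement (ρ : BinarySubstitution) (len : Fin 2 → ρ.inflationField) (i j : Fin 2) :
    Set ρ.inflationField :=
  {t | ∃ u v : List (Fin 2), ρ j = u ++ i :: v ∧ t = (u.map len).sum}

/-- `W 0 = W_a` and `W 1 = W_b` are the attractors of the graph-directed iterated function system
`W i = ⋃ j, ⋃ t ∈ T i j, (λ⋆ W j + t⋆)` in internal space, that is, they form the fixed point
consisting of non-empty compact sets. -/
def IsAttractor (ρ : BinarySubstitution) (len : Fin 2 → ρ.inflationField)
    (star : ρ.inflationField ≃ₐ[ℚ] ρ.inflationField) (W : Fin 2 → Set ℝ) : Prop :=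
  (∀ i, IsCompact (W i)) ∧ (∀ i, (W i).Nonempty) ∧
    ∀ i, W i = ⋃ j, ⋃ t ∈ ρ.displacement len i j,
      (fun x : ℝ => (star ρ.inflationFactor : ℝ) * x + (star t : ℝ)) '' W j

/-- `W` is the window of the model set given by the left endpoints of the inflation tiling with
natural tile lengths: `W = W_a ∪ W_b` for the attractors `W_a`, `W_b` of the internal space system,
where the star map is the non-trivial Galois automorphism of `ℚ(λ)`. -/
def IsWindow (ρ : BinarySubstitution) (W : Set ℝ) : Prop :=
  ∃ (len : Fin 2 → ρ.inflationField) (star : ρ.inflationField ≃ₐ[ℚ] ρ.inflationField)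
    (V : Fin 2 → Set ℝ),
    ρ.IsNaturalLength len ∧ star ≠ AlgEquiv.refl ∧ ρ.IsAttractor len star V ∧ W = V 0 ∪ V 1

/-- The substitution `a ↦ aab`, `b ↦ ba`. -/
def scrambledFibonacci : BinarySubstitution := ![[0, 0, 1], [1, 0]]

end BinarySubstitution

/-- A Cantor set in the real line: non-empty, compact, perfect and totally disconnected. -/
def IsCantorSet (C : Set ℝ) : Prop :=
  C.Nonempty ∧ IsCompact C ∧ Perfect C ∧ IsTotallyDisconnected C

/-- A Cantorval: a compact subset of the line with dense interior, none of whose connected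
components is isolated (that is, relatively open). -/
def IsCantorval (W : Set ℝ) : Prop :=
  IsCompact W ∧ W ⊆ closure (interior W) ∧
    ∀ x ∈ W, ¬ ∃ U : Set ℝ, IsOpen U ∧ U ∩ W = connectedComponentIn W x

/-- An `M`-Cantorval: a Cantorval whose boundary is a Cantor set. -/
def IsMCantorval (W : Set ℝ) : Prop :=
  IsCantorval W ∧ IsCantorSet (frontier W)

end

noncomputable section

/-- The unit vector of `ℤ × ℤ` that belongs to a letter. -/
def unitVec (i : Fin 2) : ℤ × ℤ := if i = 0 then (1, 0) else (0, 1)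

/-- The abelianization of a word. -/
def abel (w : List (Fin 2)) : ℤ × ℤ := (w.map unitVec).sum

@[simp] lemma unitVec_zero : unitVec 0 = (1, 0) := rfl
@[simp] lemma unitVec_one : unitVec 1 = (0, 1) := rfl
@[simp] lemma abel_nil : abel [] = 0 := rfl
@[simp] lemma abel_cons (a : Fin 2) (w : List (Fin 2)) : abel (a :: w) = unitVec a + abel w := by
  simp [abel]

/-- The occurrences of letters in a word, each with the abelianization of the preceding prefix. -/
def occ (w : List (Fin 2)) : Set (Fin 2 × (ℤ × ℤ)) :=
  {q | ∃ u v : List (Fin 2), w = u ++ q.1 :: v ∧ q.2 = abel u}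

lemma occ_nil : occ [] = ∅ := by
  ext q; simp [occ]

lemma mem_occ_cons {a : Fin 2} {w : List (Fin 2)} {q : Fin 2 × (ℤ × ℤ)} :
    q ∈ occ (a :: w) ↔ q = (a, 0) ∨ (q.1, q.2 - unitVec a) ∈ occ w := by
  obtain ⟨i, x⟩ := q
  constructor
  · rintro ⟨u, v, h1, h2⟩
    cases u with
    | nil =>
      simp only [List.nil_append, List.cons.injEq] at h1
      left; simp at h2; simp [h1.1, h2]
    | cons b u =>
      simp only [List.cons_append, List.cons.injEq] at h1
      right; exact ⟨u, v, h1.2, by simp at h2; simp [h2, h1.1]⟩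
  · rintro (h | ⟨u, v, h1, h2⟩)
    · rw [Prod.mk.injEq] at h
      exact ⟨[], w, by simp [h.1], by simp [h.2]⟩
    · refine ⟨a :: u, v, by simp at h1 ⊢; exact h1, ?_⟩
      simp only [abel_cons] at h2 ⊢
      rw [← h2]; abel

lemma occ_finite (w : List (Fin 2)) : (occ w).Finite := by
  induction w with
  | nil => simp [occ_nil]
  | cons a w ih =>
    refine ((ih.image fun q => (q.1, q.2 + unitVec a)).insert (a, 0)).subset ?_
    intro q hq
    rcases mem_occ_cons.1 hq with h | h
    · exact Or.inl h
    · exact Or.inr ⟨_, h, by simp⟩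

lemma exists_occ_of_mem {w : List (Fin 2)} {i : Fin 2} (h : i ∈ w) : ∃ x, (i, x) ∈ occ w := by
  obtain ⟨u, v, rfl⟩ := List.append_of_mem h
  exact ⟨abel u, u, v, rfl, rfl⟩

lemma abel_nonneg (p : ℤ × ℤ →+ ℝ) (hp : ∀ i, 0 < p (unitVec i))
    (w : List (Fin 2)) : 0 ≤ p (abel w) := by
  induction w with
  | nil => simp
  | cons a w ih => simp only [abel_cons, map_add]; linarith [hp a]

lemma occ_range (p : ℤ × ℤ →+ ℝ) (hp : ∀ i, 0 < p (unitVec i))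
    {w : List (Fin 2)} {q : Fin 2 × (ℤ × ℤ)} (h : q ∈ occ w) :
    0 ≤ p q.2 ∧ p q.2 + p (unitVec q.1) ≤ p (abel w) := by
  obtain ⟨u, v, h1, h2⟩ := h
  have : abel w = abel u + (unitVec q.1 + abel v) := by simp [h1, abel]
  rw [h2, this, map_add, map_add]
  have := abel_nonneg p hp u
  have := abel_nonneg p hp v
  constructor <;> linarith

lemma exists_occ_over (p : ℤ × ℤ →+ ℝ) (w : List (Fin 2)) {t : ℝ} (h0 : 0 ≤ t) (h1 : t < p (abel w)) :
    ∃ q ∈ occ w, p q.2 ≤ t ∧ t < p q.2 + p (unitVec q.1) := by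
  induction w generalizing t with
  | nil => simp at h1; linarith
  | cons a w ih =>
    by_cases h : t < p (unitVec a)
    · exact ⟨(a, 0), mem_occ_cons.2 (Or.inl rfl), by simpa using h0, by simpa using h⟩
    · simp only [abel_cons, map_add] at h1
      obtain ⟨q, hq, h2, h3⟩ := ih (t := t - p (unitVec a)) (by linarith) (by linarith)
      refine ⟨(q.1, q.2 + unitVec a), mem_occ_cons.2 (Or.inr (by simpa using hq)), ?_, ?_⟩
      · simp only [map_add]; linarith
      · simp only [map_add]; linarith

/-- The data of an inflation tiling with two prototiles and its internal space: the words `ϱ(j)`,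
the substitution matrix `M` acting on `ℤ × ℤ`, the length functional `p`, its star image `s`, the
inflation factor `lam`, its conjugate `kap` and the attractors `W`. -/
structure WindowSystem where
  word : Fin 2 → List (Fin 2)
  M : (ℤ × ℤ) ≃+ (ℤ × ℤ)
  M_unitVec : ∀ j, M (unitVec j) = abel (word j)
  p : ℤ × ℤ →+ ℝ
  s : ℤ × ℤ →+ ℝ
  lam : ℝ
  kap : ℝ
  one_lt_lam : 1 < lam
  abs_kap : |kap| = lam⁻¹
  p_M : ∀ v, p (M v) = lam * p v
  s_M : ∀ v, s (M v) = kap * s v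
  p_pos : ∀ i, 0 < p (unitVec i)
  p_inj : ∀ v, p v = 0 → v = 0
  s_inj : ∀ v, s v = 0 → v = 0
  conn : ∀ i j, Relation.ReflTransGen (fun k l => l ∈ word k) j i
  W : Fin 2 → Set ℝ
  compact : ∀ i, IsCompact (W i)
  nonempty : ∀ i, (W i).Nonempty
  gifs : ∀ i x, x ∈ W i ↔ ∃ j w, (i, w) ∈ occ (word j) ∧ ∃ y ∈ W j, x = kap * y + s w

/-- A tile: a letter together with the position of its left endpoint. -/
abbrev Tile : Type := Fin 2 × (ℤ × ℤ)

namespace WindowSystem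

variable (S : WindowSystem)

lemma lam_pos : 0 < S.lam := one_pos.trans S.one_lt_lam

lemma kap_ne : S.kap ≠ 0 := by
  intro h
  have := S.abs_kap
  rw [h, abs_zero] at this
  exact (inv_pos.2 S.lam_pos).ne this

lemma abs_kap_lt : |S.kap| < 1 := by
  rw [S.abs_kap]; exact inv_lt_one_of_one_lt₀ S.one_lt_lam

/-- The tiles of the (possibly multiply covering) pattern that belongs to a point `y` of internal
space. -/
def fiber (y : ℝ) : Set Tile := {τ | y + S.s τ.2 ∈ S.W τ.1}

/-- The tile `τ` occurs in the inflated tile `π`. -/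
def Child (π τ : Tile) : Prop := (τ.1, τ.2 - S.M π.2) ∈ occ (S.word π.1)

/-- The tile `τ` occurs in the `n`-fold inflated tile `π`. -/
def Desc : ℕ → Tile → Tile → Prop
  | 0, π, τ => π = τ
  | n + 1, π, τ => ∃ μ, Desc n π μ ∧ S.Child μ τ

/-- The tile `τ` covers the point `t` of physical space. -/
def Over (t : ℝ) (τ : Tile) : Prop := S.p τ.2 ≤ t ∧ t < S.p τ.2 + S.p (unitVec τ.1)

lemma mem_fiber {y : ℝ} {τ : Tile} : τ ∈ S.fiber y ↔ y + S.s τ.2 ∈ S.W τ.1 := Iff.rfl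

lemma mem_fiber_add {y : ℝ} {v : ℤ × ℤ} {τ : Tile} :
    τ ∈ S.fiber (y + S.s v) ↔ (τ.1, τ.2 + v) ∈ S.fiber y := by
  simp only [mem_fiber, map_add]
  rw [add_assoc, add_comm (S.s v)]

lemma mem_fiber_kap {y : ℝ} {τ : Tile} :
    τ ∈ S.fiber (S.kap * y) ↔ ∃ π ∈ S.fiber y, S.Child π τ := by
  rw [mem_fiber, S.gifs]
  constructor
  · rintro ⟨j, w, hw, x, hx, h⟩
    refine ⟨(j, S.M.symm (τ.2 - w)), ?_, ?_⟩
    · rw [mem_fiber]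
      have h2 := S.s_M (S.M.symm (τ.2 - w))
      rw [AddEquiv.apply_symm_apply, map_sub] at h2
      have : S.kap * (y + S.s (S.M.symm (τ.2 - w))) = S.kap * x := by
        rw [mul_add, ← h2]; linarith
      rw [mul_left_cancel₀ S.kap_ne this]
      exact hx
    · simpa [Child] using hw
  · rintro ⟨π, hπ, hc⟩
    refine ⟨π.1, _, hc, _, hπ, ?_⟩
    rw [mul_add, ← S.s_M, add_assoc, ← map_add]
    congr 2; abel

lemma mem_fiber_kap_pow {n : ℕ} {y : ℝ} {τ : Tile} :
    τ ∈ S.fiber (S.kap ^ n * y) ↔ ∃ π ∈ S.fiber y, S.Desc n π τ := by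
  induction n generalizing τ with
  | zero => simp [Desc]
  | succ n ih =>
    rw [pow_succ', mul_assoc, mem_fiber_kap]
    constructor
    · rintro ⟨μ, hμ, hc⟩
      obtain ⟨π, hπ, hd⟩ := ih.1 hμ
      exact ⟨π, hπ, μ, hd, hc⟩
    · rintro ⟨π, hπ, μ, hd, hc⟩
      exact ⟨μ, ih.2 ⟨π, hπ, hd⟩, hc⟩

/-- The `n`-th power of the substitution matrix. -/
def Mpow (n : ℕ) (v : ℤ × ℤ) : ℤ × ℤ := S.M^[n] v

lemma Mpow_succ (n : ℕ) (v : ℤ × ℤ) : S.Mpow (n + 1) v = S.M (S.Mpow n v) :=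
  Function.iterate_succ_apply' _ _ _

@[simp] lemma Mpow_zero (v : ℤ × ℤ) : S.Mpow 0 v = v := rfl

lemma s_Mpow (n : ℕ) (v : ℤ × ℤ) : S.s (S.Mpow n v) = S.kap ^ n * S.s v := by
  induction n with
  | zero => simp
  | succ n ih => rw [Mpow_succ, S.s_M, ih]; ring

lemma p_Mpow (n : ℕ) (v : ℤ × ℤ) : S.p (S.Mpow n v) = S.lam ^ n * S.p v := by
  induction n with
  | zero => simp
  | succ n ih => rw [Mpow_succ, S.p_M, ih]; ring

lemma child_shift {π τ : Tile} (v : ℤ × ℤ) :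
    S.Child (π.1, π.2 + v) (τ.1, τ.2 + S.M v) ↔ S.Child π τ := by
  simp [Child]

lemma desc_shift {n : ℕ} {π τ : Tile} (v : ℤ × ℤ) (h : S.Desc n π τ) :
    S.Desc n (π.1, π.2 + v) (τ.1, τ.2 + S.Mpow n v) := by
  induction n generalizing τ with
  | zero => cases h; rfl
  | succ n ih =>
    obtain ⟨μ, h1, h2⟩ := h
    refine ⟨_, ih h1, ?_⟩
    rw [Mpow_succ]
    exact (S.child_shift (π := μ) _).2 h2

lemma p_abel_word (j : Fin 2) : S.p (abel (S.word j)) = S.lam * S.p (unitVec j) := by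
  rw [← S.M_unitVec, S.p_M]

lemma exists_child_over {π : Tile} {t : ℝ} (h : S.Over t π) :
    ∃ τ, S.Child π τ ∧ S.Over (S.lam * t) τ := by
  have h1 := mul_le_mul_of_nonneg_left h.1 S.lam_pos.le
  have h2 := mul_lt_mul_of_pos_left h.2 S.lam_pos
  obtain ⟨q, hq, h3, h4⟩ := exists_occ_over S.p (S.word π.1)
    (t := S.lam * t - S.lam * S.p π.2) (by linarith) (by rw [S.p_abel_word]; linarith)
  refine ⟨(q.1, q.2 + S.M π.2), by simpa [Child] using hq, ?_, ?_⟩ <;>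
  · simp only [map_add, S.p_M]; linarith

lemma exists_desc_over (n : ℕ) {π : Tile} {t : ℝ} (h : S.Over t π) :
    ∃ τ, S.Desc n π τ ∧ S.Over (S.lam ^ n * t) τ := by
  induction n with
  | zero => exact ⟨π, rfl, by simpa using h⟩
  | succ n ih =>
    obtain ⟨μ, h1, h2⟩ := ih
    obtain ⟨τ, h3, h4⟩ := S.exists_child_over h2
    refine ⟨τ, ⟨μ, h1, h3⟩, ?_⟩
    rwa [pow_succ', mul_assoc]

lemma exists_desc_letter (i j : Fin 2) : ∃ n w, S.Desc n (j, 0) (i, w) := by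
  induction S.conn i j with
  | refl => exact ⟨0, 0, rfl⟩
  | tail _ h ih =>
    obtain ⟨n, w, hd⟩ := ih
    obtain ⟨x, hx⟩ := exists_occ_of_mem h
    exact ⟨n + 1, x + S.M w, _, hd, by simpa [Child] using hx⟩

/-! ### Bounds and finiteness -/

lemma exists_bound : ∃ R : ℝ, 0 < R ∧ ∀ i, ∀ x ∈ S.W i, |x| ≤ R := by
  obtain ⟨R0, h0⟩ := (S.compact 0).isBounded.exists_norm_le
  obtain ⟨R1, h1⟩ := (S.compact 1).isBounded.exists_norm_le
  refine ⟨max 1 (max R0 R1), by positivity, fun i x hx => ?_⟩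
  fin_cases i
  · exact (h0 x hx).trans (by simp)
  · exact (h1 x hx).trans (by simp)

/-- A bound for the absolute value of the points of the attractors. -/
def bd : ℝ := S.exists_bound.choose

lemma bd_pos : 0 < S.bd := S.exists_bound.choose_spec.1

lemma abs_le_bd {i : Fin 2} {x : ℝ} (h : x ∈ S.W i) : |x| ≤ S.bd :=
  S.exists_bound.choose_spec.2 i x h

/-- The lattice spanned by length and star image is discrete. -/
lemma finite_lattice (A B : ℝ) : {v : ℤ × ℤ | |S.p v| ≤ A ∧ |S.s v| ≤ B}.Finite := by
  set a := S.p (1, 0)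
  set b := S.p (0, 1)
  set c := S.s (1, 0)
  set d := S.s (0, 1)
  have hp : ∀ v : ℤ × ℤ, S.p v = v.1 * a + v.2 * b := fun v => by
    have : v = v.1 • ((1, 0) : ℤ × ℤ) + v.2 • ((0, 1) : ℤ × ℤ) := by ext <;> simp
    conv_lhs => rw [this]
    rw [map_add, map_zsmul, map_zsmul]; simp [a, b]
  have hs : ∀ v : ℤ × ℤ, S.s v = v.1 * c + v.2 * d := fun v => by
    have : v = v.1 • ((1, 0) : ℤ × ℤ) + v.2 • ((0, 1) : ℤ × ℤ) := by ext <;> simp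
    conv_lhs => rw [this]
    rw [map_add, map_zsmul, map_zsmul]; simp [c, d]
  have ha : 0 < a := S.p_pos 0
  -- the determinant does not vanish
  have hD : a * d - b * c ≠ 0 := by
    intro h0
    have key : ∀ v, a * S.s v = c * S.p v := fun v => by
      rw [hs, hp]; linear_combination (v.2 : ℝ) * h0
    have h1 := key (S.M (1, 0))
    rw [S.s_M, S.p_M] at h1
    have hc : c ≠ 0 := fun h => by
      have := S.s_inj (1, 0) h; simp at this
    have h2 : S.kap = S.lam := by
      have : (a * c) * S.kap = (a * c) * S.lam := by linear_combination h1
      exact mul_left_cancel₀ (mul_ne_zero ha.ne' hc) this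
    have h3 := S.abs_kap_lt
    rw [h2, abs_of_pos S.lam_pos] at h3
    linarith [S.one_lt_lam]
  set D := |a * d - b * c|
  have hD' : 0 < D := abs_pos.2 hD
  set C := (A * |d| + B * |b| + (A * |c| + B * |a|)) / D
  obtain ⟨N, hN⟩ := exists_nat_ge C
  refine (Set.finite_Icc ((-(N : ℤ), -(N : ℤ)) : ℤ × ℤ) (N, N)).subset ?_
  rintro v ⟨h1, h2⟩
  have hA : 0 ≤ A := (abs_nonneg _).trans h1
  have hB : 0 ≤ B := (abs_nonneg _).trans h2
  have e1 : |(v.1 : ℝ)| ≤ N := by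
    refine le_trans ?_ hN
    rw [le_div_iff₀ hD', ← abs_mul]
    have : (v.1 : ℝ) * (a * d - b * c) = S.p v * d - S.s v * b := by rw [hp, hs]; ring
    rw [this]
    have := abs_sub (S.p v * d) (S.s v * b)
    rw [abs_mul, abs_mul] at this
    have := mul_le_mul_of_nonneg_right h1 (abs_nonneg d)
    have := mul_le_mul_of_nonneg_right h2 (abs_nonneg b)
    have : 0 ≤ A * |c| + B * |a| := by positivity
    linarith
  have e2 : |(v.2 : ℝ)| ≤ N := by
    refine le_trans ?_ hN
    rw [le_div_iff₀ hD', ← abs_mul]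
    have : (v.2 : ℝ) * (a * d - b * c) = S.s v * a - S.p v * c := by rw [hp, hs]; ring
    rw [this]
    have := abs_sub (S.s v * a) (S.p v * c)
    rw [abs_mul, abs_mul] at this
    have := mul_le_mul_of_nonneg_right h1 (abs_nonneg c)
    have := mul_le_mul_of_nonneg_right h2 (abs_nonneg a)
    have : 0 ≤ A * |d| + B * |b| := by positivity
    linarith
  rw [abs_le] at e1 e2
  simp only [Set.mem_Icc, Prod.le_def]
  exact ⟨⟨by exact_mod_cast e1.1, by exact_mod_cast e2.1⟩,
    ⟨by exact_mod_cast e1.2, by exact_mod_cast e2.2⟩⟩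

/-- The largest tile length. -/
def len : ℝ := S.p (unitVec 0) + S.p (unitVec 1)

lemma p_unitVec_le (i : Fin 2) : S.p (unitVec i) ≤ S.len := by
  have h0 := S.p_pos 0
  have h1 := S.p_pos 1
  fin_cases i <;> simp only [len] <;> simp <;> simp at h0 h1 <;> linarith

lemma finite_tiles (A B : ℝ) : {τ : Tile | |S.p τ.2| ≤ A ∧ |S.s τ.2| ≤ B}.Finite := by
  refine ((Set.finite_univ (α := Fin 2)).prod (S.finite_lattice A B)).subset ?_
  rintro τ h
  exact ⟨trivial, h⟩

lemma finite_over (t B : ℝ) : {τ : Tile | S.Over t τ ∧ |S.s τ.2| ≤ B}.Finite := by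
  refine (S.finite_tiles (|t| + S.len) B).subset ?_
  rintro τ ⟨⟨h1, h2⟩, h3⟩
  refine ⟨?_, h3⟩
  have := S.p_unitVec_le τ.1
  have := le_abs_self t
  have := neg_abs_le t
  have := S.p_pos τ.1
  rw [abs_le]; constructor <;> linarith

lemma abs_s_le_of_mem_fiber {y : ℝ} {τ : Tile} (h : τ ∈ S.fiber y) : |S.s τ.2| ≤ S.bd + |y| := by
  have h1 := S.abs_le_bd h
  have : S.s τ.2 = (y + S.s τ.2) - y := by ring
  rw [this]
  exact (abs_sub _ _).trans (by linarith)

/-- The tiles of the pattern of `y` that cover the point `t`. -/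
def cover (t y : ℝ) : Set Tile := {τ | τ ∈ S.fiber y ∧ S.Over t τ}

lemma cover_finite (t y : ℝ) : (S.cover t y).Finite :=
  (S.finite_over t (S.bd + |y|)).subset fun _ h => ⟨h.2, S.abs_s_le_of_mem_fiber h.1⟩

lemma mem_cover_add {t y : ℝ} {v : ℤ × ℤ} {τ : Tile} :
    τ ∈ S.cover t (y + S.s v) ↔ (τ.1, τ.2 + v) ∈ S.cover (t + S.p v) y := by
  simp only [cover, mem_ofPred_eq, mem_fiber_add, Over, map_add]
  refine and_congr_right fun _ => and_congr ?_ ?_ <;> constructor <;> intro h <;> linarith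

end WindowSystem

namespace WindowSystem
open MeasureTheory
open scoped Pointwise

variable (S : WindowSystem)

/-- A piece of an attractor in the graph-directed iterated function system. -/
def piece (j : Fin 2) (w : ℤ × ℤ) : Set ℝ := (fun y => S.kap * y + S.s w) '' S.W j

lemma isCompact_piece (j : Fin 2) (w : ℤ × ℤ) : IsCompact (S.piece j w) :=
  (S.compact j).image (by fun_prop)

lemma volume_piece (j : Fin 2) (w : ℤ × ℤ) :
    volume.real (S.piece j w) = |S.kap| * volume.real (S.W j) := by
  have : S.piece j w = (fun x => x + S.s w) '' ((fun y => S.kap * y) '' S.W j) := by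
    rw [image_image]; rfl
  rw [this, Measure.real, image_add_right, measure_preimage_add_right]
  have h2 : (fun y => S.kap * y) '' S.W j = S.kap • S.W j := rfl
  rw [h2, Measure.addHaar_smul]
  simp [Measure.real]

/-- The index set of the pieces of the attractor `W i`. -/
def pieces (i : Fin 2) : Finset (Fin 2 × (ℤ × ℤ)) :=
  Finset.univ.biUnion fun j =>
    (((occ_finite (S.word j)).toFinset.filter fun q => q.1 = i).image fun q => (j, q.2))

lemma mem_pieces {i : Fin 2} {q : Fin 2 × (ℤ × ℤ)} :
    q ∈ S.pieces i ↔ (i, q.2) ∈ occ (S.word q.1) := by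
  simp only [pieces, Finset.mem_biUnion, Finset.mem_univ, true_and, Finset.mem_image,
    Finset.mem_filter, Set.Finite.mem_toFinset]
  constructor
  · rintro ⟨j, ⟨i', w⟩, ⟨h1, h2⟩, rfl⟩
    simp only at h2; subst h2; exact h1
  · intro h
    exact ⟨q.1, (i, q.2), ⟨h, rfl⟩, rfl⟩

lemma W_eq_iUnion (i : Fin 2) : S.W i = ⋃ q ∈ S.pieces i, S.piece q.1 q.2 := by
  ext x
  rw [S.gifs]
  simp only [mem_iUnion, mem_pieces, piece, mem_image, exists_prop]
  constructor
  · rintro ⟨j, w, h, y, hy, e⟩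
    exact ⟨(j, w), h, y, hy, e.symm⟩
  · rintro ⟨q, h, y, hy, e⟩
    exact ⟨q.1, q.2, h, y, hy, e.symm⟩

lemma sum_occ (w : List (Fin 2)) :
    ∑ q ∈ (occ_finite w).toFinset, S.p (unitVec q.1) ≤ S.p (abel w) := by
  induction w with
  | nil => simp [occ_nil]
  | cons a w ih =>
    classical
    have : (occ_finite (a :: w)).toFinset ⊆ insert (a, 0)
        ((occ_finite w).toFinset.image fun q => (q.1, q.2 + unitVec a)) := by
      intro q hq
      rw [Set.Finite.mem_toFinset] at hq
      rcases mem_occ_cons.1 hq with h | h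
      · simp [h]
      · refine Finset.mem_insert_of_mem (Finset.mem_image.2 ⟨(q.1, q.2 - unitVec a), ?_, ?_⟩)
        · simpa using h
        · simp
    refine (Finset.sum_le_sum_of_subset_of_nonneg this fun q _ _ => (S.p_pos _).le).trans ?_
    have hn : ((a, 0) : Fin 2 × (ℤ × ℤ)) ∉
        (occ_finite w).toFinset.image fun q => (q.1, q.2 + unitVec a) := by
      simp only [Finset.mem_image, Set.Finite.mem_toFinset, not_exists, not_and]
      rintro q hq h
      have h1 := (occ_range S.p S.p_pos hq).1
      have h2 : q.2 + unitVec a = 0 := congrArg Prod.snd h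
      have h3 := congrArg S.p h2
      rw [map_add, map_zero] at h3
      linarith [S.p_pos a]
    rw [Finset.sum_insert hn, abel_cons, map_add, Finset.sum_image]
    · exact add_le_add le_rfl ih
    · rintro ⟨q1, q2⟩ _ ⟨q1', q2'⟩ _ h
      simpa using h

lemma sum_pieces_le :
    ∑ i, S.p (unitVec i) * ∑ q ∈ S.pieces i, |S.kap| * volume.real (S.W q.1) ≤
      ∑ i, S.p (unitVec i) * volume.real (S.W i) := by
  classical
  have h1 : ∀ i, S.p (unitVec i) * ∑ q ∈ S.pieces i, |S.kap| * volume.real (S.W q.1) =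
      ∑ j, ∑ q ∈ (occ_finite (S.word j)).toFinset.filter (fun q => q.1 = i),
        S.p (unitVec q.1) * (|S.kap| * volume.real (S.W j)) := by
    intro i
    rw [pieces, Finset.sum_biUnion, Finset.mul_sum]
    · refine Finset.sum_congr rfl fun j _ => ?_
      rw [Finset.sum_image, Finset.mul_sum]
      · refine Finset.sum_congr rfl fun q hq => ?_
        rw [(Finset.mem_filter.1 hq).2]
      · rintro ⟨a, b⟩ h ⟨a', b'⟩ h' e
        simp only [Finset.coe_filter, mem_ofPred_eq] at h h'
        rw [Prod.mk.injEq] at e ⊢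
        exact ⟨h.2.trans h'.2.symm, e.2⟩
    · intro j _ j' _ hj
      simp only [Function.onFun, Finset.disjoint_left, Finset.mem_image, not_exists, not_and]
      rintro _ ⟨q, _, rfl⟩ q' _ h
      exact hj (congrArg Prod.fst h).symm
  simp_rw [h1]
  rw [Finset.sum_comm]
  refine Finset.sum_le_sum fun j _ => ?_
  have h2 : ∑ i, ∑ q ∈ (occ_finite (S.word j)).toFinset.filter (fun q => q.1 = i),
        S.p (unitVec q.1) * (|S.kap| * volume.real (S.W j)) =
      ∑ q ∈ (occ_finite (S.word j)).toFinset,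
        S.p (unitVec q.1) * (|S.kap| * volume.real (S.W j)) :=
    Finset.sum_fiberwise _ _ _
  rw [h2, ← Finset.sum_mul]
  have h3 := S.sum_occ (S.word j)
  rw [S.p_abel_word] at h3
  have h4 : 0 ≤ |S.kap| * volume.real (S.W j) := by positivity
  refine (mul_le_mul_of_nonneg_right h3 h4).trans (le_of_eq ?_)
  rw [S.abs_kap]
  have := S.lam_pos.ne'
  field_simp

lemma volume_W_le (i : Fin 2) :
    volume.real (S.W i) ≤ ∑ q ∈ S.pieces i, |S.kap| * volume.real (S.W q.1) := by
  have h : ∀ q : Fin 2 × (ℤ × ℤ), |S.kap| * volume.real (S.W q.1) =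
    volume.real (S.piece q.1 q.2) := fun q => (S.volume_piece _ _).symm
  simp_rw [h]
  conv_lhs => rw [S.W_eq_iUnion]
  exact measureReal_biUnion_finset_le _ _

lemma volume_piece_inter {i : Fin 2} {q q' : Fin 2 × (ℤ × ℤ)} (hq : q ∈ S.pieces i)
    (hq' : q' ∈ S.pieces i) (hne : q ≠ q') :
    volume (S.piece q.1 q.2 ∩ S.piece q'.1 q'.2) = 0 := by
  classical
  set v := volume.real (S.piece q.1 q.2 ∩ S.piece q'.1 q'.2) with hv
  have h : ∀ q : Fin 2 × (ℤ × ℤ), |S.kap| * volume.real (S.W q.1) =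
    volume.real (S.piece q.1 q.2) := fun q => (S.volume_piece _ _).symm
  have fin : ∀ q : Fin 2 × (ℤ × ℤ), volume (S.piece q.1 q.2) ≠ ⊤ := fun q =>
    (S.isCompact_piece _ _).measure_lt_top.ne
  have key : volume.real (S.W i) + v ≤
      ∑ q ∈ S.pieces i, |S.kap| * volume.real (S.W q.1) := by
    simp_rw [h]
    have hq2 : q' ∈ (S.pieces i).erase q := Finset.mem_erase.2 ⟨hne.symm, hq'⟩
    rw [← Finset.add_sum_erase _ _ hq, ← Finset.add_sum_erase _ _ hq2]
    have e : S.W i = (S.piece q.1 q.2 ∪ S.piece q'.1 q'.2) ∪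
        ⋃ r ∈ ((S.pieces i).erase q).erase q', S.piece r.1 r.2 := by
      conv_lhs => rw [S.W_eq_iUnion]
      ext x
      simp only [mem_iUnion, mem_union, Finset.mem_erase, exists_prop]
      constructor
      · rintro ⟨r, hr, hx⟩
        by_cases h1 : r = q
        · subst h1; exact Or.inl (Or.inl hx)
        by_cases h2 : r = q'
        · subst h2; exact Or.inl (Or.inr hx)
        exact Or.inr ⟨r, ⟨h2, h1, hr⟩, hx⟩
      · rintro ((hx | hx) | ⟨r, ⟨_, _, hr⟩, hx⟩)
        · exact ⟨q, hq, hx⟩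
        · exact ⟨q', hq', hx⟩
        · exact ⟨r, hr, hx⟩
    have h1 := measureReal_union_add_inter (μ := volume) (s := S.piece q.1 q.2)
      (S.isCompact_piece q'.1 q'.2).measurableSet (fin q) (fin q')
    have h2 := measureReal_union_le (μ := volume) (S.piece q.1 q.2 ∪ S.piece q'.1 q'.2)
      (⋃ r ∈ ((S.pieces i).erase q).erase q', S.piece r.1 r.2)
    rw [← e] at h2
    have h3 := measureReal_biUnion_finset_le (μ := volume)
      (((S.pieces i).erase q).erase q') fun r => S.piece r.1 r.2
    linarith
  have h5 : ∑ i', S.p (unitVec i') * volume.real (S.W i') + S.p (unitVec i) * v ≤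
      ∑ i', S.p (unitVec i') * volume.real (S.W i') := by
    refine le_trans ?_ S.sum_pieces_le
    rw [← Finset.add_sum_erase _ _ (Finset.mem_univ i),
      ← Finset.add_sum_erase _ _ (Finset.mem_univ i)]
    have h6 := mul_le_mul_of_nonneg_left key (S.p_pos i).le
    have h7 : ∑ i' ∈ Finset.univ.erase i, S.p (unitVec i') * volume.real (S.W i') ≤
        ∑ i' ∈ Finset.univ.erase i,
          S.p (unitVec i') * ∑ q ∈ S.pieces i', |S.kap| * volume.real (S.W q.1) :=
      Finset.sum_le_sum fun i' _ => mul_le_mul_of_nonneg_left (S.volume_W_le i') (S.p_pos i').le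
    rw [mul_add] at h6
    linarith
  have h8 : v ≤ 0 := by
    have := S.p_pos i
    by_contra hc
    have := mul_pos this (not_le.1 hc)
    linarith
  have h9 : v = 0 := le_antisymm h8 measureReal_nonneg
  rw [hv, measureReal_eq_zero_iff (((measure_mono inter_subset_left).trans_lt
      (S.isCompact_piece _ _).measure_lt_top).ne)] at h9
  exact h9

/-- The set of points that lie in two different pieces of the same attractor. -/
def overlap : Set ℝ :=
  ⋃ i, ⋃ q ∈ S.pieces i, ⋃ q' ∈ (S.pieces i).filter (fun q' => q ≠ q'),
    S.piece q.1 q.2 ∩ S.piece q'.1 q'.2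

lemma volume_overlap : volume S.overlap = 0 := by
  unfold overlap
  refine measure_iUnion_null fun i => ?_
  refine (measure_biUnion_null_iff (S.pieces i).countable_toSet).2 fun q hq => ?_
  refine (measure_biUnion_null_iff (Finset.countable_toSet _)).2 fun q' hq' => ?_
  have := Finset.mem_filter.1 (Finset.mem_coe.1 hq')
  exact S.volume_piece_inter hq this.1 this.2

/-- Points of internal space none of whose translates and rescalings is in an overlap. -/
def Generic (y : ℝ) : Prop :=
  (∀ (n : ℤ) (v : ℤ × ℤ), S.kap ^ n * y + S.s v ∉ S.overlap) ∧ ∀ v, y + S.s v ≠ 0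

lemma ae_generic : ∀ᵐ y : ℝ, S.Generic y := by
  unfold Generic
  refine Filter.Eventually.and ?_ ?_
  · rw [ae_all_iff]; intro n
    rw [ae_all_iff]; intro v
    have h : volume ((fun y => S.kap ^ n * y) ⁻¹' ((fun x => x + S.s v) ⁻¹' S.overlap)) = 0 := by
      rw [Real.volume_preimage_mul_left (zpow_ne_zero _ S.kap_ne), measure_preimage_add_right,
        S.volume_overlap, mul_zero]
    rw [ae_iff]
    simpa [preimage] using h
  · rw [ae_all_iff]; intro v
    rw [ae_iff]
    have : {a | ¬a + S.s v ≠ 0} ⊆ {- S.s v} := by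
      intro a ha
      simp only [mem_ofPred_eq, not_not] at ha
      simp only [mem_singleton_iff]; linarith
    exact measure_mono_null this (by simp)

lemma dense_generic : Dense {y | S.Generic y} :=
  Measure.dense_of_ae S.ae_generic

lemma exists_s_zpow (n : ℤ) (v : ℤ × ℤ) : ∃ v', S.s v' = S.kap ^ n * S.s v := by
  induction n using Int.induction_on with
  | zero => exact ⟨v, by simp⟩
  | succ n ih =>
    obtain ⟨v', h⟩ := ih
    exact ⟨S.M v', by rw [S.s_M, h, zpow_add_one₀ S.kap_ne]; ring⟩
  | pred n ih =>
    obtain ⟨v', h⟩ := ih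
    refine ⟨S.M.symm v', ?_⟩
    have := S.s_M (S.M.symm v')
    rw [AddEquiv.apply_symm_apply, h] at this
    have h2 := S.kap_ne
    rw [zpow_sub_one₀ S.kap_ne]
    field_simp
    linarith

variable {S}

lemma Generic.add {y : ℝ} (h : S.Generic y) (v : ℤ × ℤ) : S.Generic (y + S.s v) := by
  refine ⟨fun n w => ?_, fun w => ?_⟩
  · obtain ⟨v', hv⟩ := S.exists_s_zpow n v
    have := h.1 n (v' + w)
    rwa [map_add, hv, ← add_assoc, ← mul_add] at this
  · have := h.2 (v + w)
    rwa [map_add, ← add_assoc] at this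

lemma Generic.zpow {y : ℝ} (h : S.Generic y) (m : ℤ) : S.Generic (S.kap ^ m * y) := by
  refine ⟨fun n w => ?_, fun w h0 => ?_⟩
  · have := h.1 (n + m) w
    rwa [zpow_add₀ S.kap_ne, mul_assoc] at this
  · obtain ⟨v', hv⟩ := S.exists_s_zpow (-m) w
    apply h.2 v'
    have h3 := zpow_ne_zero m S.kap_ne
    rw [hv, zpow_neg]
    field_simp
    linarith

lemma Generic.kap {y : ℝ} (h : S.Generic y) : S.Generic (S.kap * y) := by
  simpa using h.zpow 1

lemma Generic.kap_pow {y : ℝ} (h : S.Generic y) (n : ℕ) : S.Generic (S.kap ^ n * y) := by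
  simpa using h.zpow n

/-- A tile of a generic pattern has only one parent. -/
lemma Generic.child_unique {y : ℝ} (h : S.Generic y) {π π' τ : Tile} (hπ : π ∈ S.fiber y)
    (hπ' : π' ∈ S.fiber y) (hc : S.Child π τ) (hc' : S.Child π' τ) : π = π' := by
  by_contra hne
  have hh := h.1 1 τ.2
  apply hh
  have key : ∀ μ ∈ S.fiber y, S.kap ^ (1 : ℤ) * y + S.s τ.2 ∈ S.piece μ.1 (τ.2 - S.M μ.2) := by
    intro μ hμ
    refine ⟨_, hμ, ?_⟩
    simp only [map_sub, S.s_M, zpow_one]; ring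
  simp only [overlap, mem_iUnion, exists_prop]
  refine ⟨τ.1, (π.1, τ.2 - S.M π.2), S.mem_pieces.2 hc, (π'.1, τ.2 - S.M π'.2), ?_,
    key π hπ, key π' hπ'⟩
  refine Finset.mem_filter.2 ⟨S.mem_pieces.2 hc', fun he => hne ?_⟩
  simp only [Prod.mk.injEq, sub_right_inj, EmbeddingLike.apply_eq_iff_eq] at he
  exact Prod.ext he.1 he.2

lemma Generic.desc_unique {n : ℕ} {y : ℝ} (h : S.Generic y) {π π' τ : Tile} (hπ : π ∈ S.fiber y)
    (hπ' : π' ∈ S.fiber y) (hc : S.Desc n π τ) (hc' : S.Desc n π' τ) : π = π' := by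
  induction n generalizing τ with
  | zero => exact hc.trans hc'.symm
  | succ n ih =>
    obtain ⟨μ, h1, h2⟩ := hc
    obtain ⟨μ', h1', h2'⟩ := hc'
    have : μ = μ' := (h.kap_pow n).child_unique (S.mem_fiber_kap_pow.2 ⟨π, hπ, h1⟩)
      (S.mem_fiber_kap_pow.2 ⟨π', hπ', h1'⟩) h2 h2'
    subst this
    exact ih h1 h1'

end WindowSystem

namespace WindowSystem

variable (S : WindowSystem)

open Classical in
lemma occ_flip (p : ℤ × ℤ →+ ℝ) (hp : ∀ i, 0 < p (unitVec i)) (w : List (Fin 2)) (x : ℤ × ℤ) :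
    ∑ i, (if (i, x) ∈ occ w then (1 : ℤ) else 0) -
      ∑ i, (if (i, x - unitVec i) ∈ occ w then (1 : ℤ) else 0) =
    (if x = 0 then 1 else 0) - (if x = abel w then 1 else 0) := by
  induction w generalizing x with
  | nil => by_cases h : x = 0 <;> simp [occ_nil, h]
  | cons a w ih =>
    have key : ∀ (i : Fin 2) (z : ℤ × ℤ), (if (i, z) ∈ occ (a :: w) then (1 : ℤ) else 0) =
        (if (i, z) = (a, 0) then 1 else 0) + (if (i, z - unitVec a) ∈ occ w then 1 else 0) := by
      intro i z
      rw [mem_occ_cons]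
      by_cases h : (i, z) = (a, 0)
      · have : (i, z - unitVec a) ∉ occ w := fun hc => by
          rw [Prod.mk.injEq] at h
          have h1 := (occ_range p hp hc).1
          simp only [h.2, map_sub, map_zero] at h1
          linarith [hp a]
        simp [h, this]
      · simp [h]
    simp_rw [key, Finset.sum_add_distrib]
    have e1 : ∑ i : Fin 2, (if (i, x) = (a, (0 : ℤ × ℤ)) then (1 : ℤ) else 0) =
        if x = 0 then 1 else 0 := by
      by_cases h : x = 0 <;> simp [h, Prod.mk.injEq]
    have e2 : ∑ i : Fin 2, (if (i, x - unitVec i) = (a, (0 : ℤ × ℤ)) then (1 : ℤ) else 0) =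
        if x - unitVec a = 0 then 1 else 0 := by
      rw [Finset.sum_eq_single a]
      · simp
      · intro b _ hb; simp [hb]
      · simp
    have e3 := ih (x - unitVec a)
    have e4 : ∀ i, x - unitVec i - unitVec a = x - unitVec a - unitVec i := fun i => by abel
    simp_rw [e4]
    rw [e1, e2]
    have e5 : (x - unitVec a = abel w) ↔ (x = abel (a :: w)) := by
      rw [abel_cons, sub_eq_iff_eq_add']
    simp only [e5] at e3
    linarith

open Classical in
/-- The number of tiles that start at the origin minus the number of those that end there. -/
def excess (y : ℝ) : ℤ :=
  ∑ i, (if (i, 0) ∈ S.fiber y then (1 : ℤ) else 0) -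
    ∑ i, (if (i, - unitVec i) ∈ S.fiber y then (1 : ℤ) else 0)

variable {S} in
lemma Generic.excess_kap {y : ℝ} (h : S.Generic y) : S.excess (S.kap * y) = S.excess y := by
  classical
  have hfin : (S.fiber y ∩ {π | |S.p π.2| ≤ 2 * S.len ∧ |S.s π.2| ≤ S.bd + |y|}).Finite :=
    (S.finite_tiles _ _).subset inter_subset_right
  set P := hfin.toFinset with hP
  have hlen : ∀ i, S.p (unitVec i) ≤ S.len := S.p_unitVec_le
  have hl0 : 0 < S.len := (S.p_pos 0).trans_le (hlen 0)
  have hPmem : ∀ π ∈ S.fiber y, |S.p π.2| ≤ 2 * S.len → π ∈ P := fun π h1 h2 => by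
    rw [hP, Set.Finite.mem_toFinset]
    exact ⟨h1, h2, S.abs_s_le_of_mem_fiber h1⟩
  have hPf : ∀ π ∈ P, π ∈ S.fiber y := fun π hπ => by
    rw [hP, Set.Finite.mem_toFinset] at hπ; exact hπ.1
  have key : ∀ τ : Tile, |S.p τ.2| ≤ S.len → (if τ ∈ S.fiber (S.kap * y) then (1 : ℤ) else 0) =
      ∑ π ∈ P, if S.Child π τ then (1 : ℤ) else 0 := by
    intro τ hτ
    by_cases hm : τ ∈ S.fiber (S.kap * y)
    · obtain ⟨π, hπ, hc⟩ := S.mem_fiber_kap.1 hm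
      have hr := occ_range S.p S.p_pos hc
      simp only [S.p_abel_word, map_sub, S.p_M] at hr
      rw [abs_le] at hτ
      have hl := S.one_lt_lam
      have h1 := S.p_pos τ.1
      have h2 := mul_le_mul_of_nonneg_left (hlen π.1) S.lam_pos.le
      have hπP : π ∈ P := by
        refine hPmem π hπ (abs_le.2 ⟨?_, ?_⟩)
        · by_contra hcon
          push Not at hcon
          have := mul_lt_mul_of_pos_left hcon S.lam_pos
          nlinarith
        · by_contra hcon
          push Not at hcon
          have := mul_lt_mul_of_pos_left hcon S.lam_pos
          nlinarith
      rw [Finset.sum_eq_single π]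
      · simp [hm, hc]
      · intro π' hπ' hne
        rw [if_neg]
        exact fun hc' => hne (h.child_unique (hPf _ hπ') hπ hc' hc)
      · exact fun hn => absurd hπP hn
    · rw [if_neg hm, Finset.sum_eq_zero]
      intro π hπ
      rw [if_neg]
      exact fun hc => hm (S.mem_fiber_kap.2 ⟨π, hPf _ hπ, hc⟩)
  have key2 : ∀ f : Fin 2 → ℤ × ℤ, (∀ i, |S.p (f i)| ≤ 2 * S.len) →
      ∑ i, (if (i, f i) ∈ S.fiber y then (1 : ℤ) else 0) =
        ∑ π ∈ P, if π.2 = f π.1 then 1 else 0 := by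
    intro f hf
    have : ∀ i, (if (i, f i) ∈ S.fiber y then (1 : ℤ) else 0) =
        ∑ π ∈ P, if π = (i, f i) then (1 : ℤ) else 0 := by
      intro i
      rw [Finset.sum_ite_eq']
      refine if_congr ⟨fun hm => hPmem _ hm (hf i), fun hm => hPf _ hm⟩ rfl rfl
    simp_rw [this]
    rw [Finset.sum_comm]
    refine Finset.sum_congr rfl fun π _ => ?_
    rw [Finset.sum_eq_single π.1]
    · refine if_congr ?_ rfl rfl
      constructor
      · intro e; exact congrArg Prod.snd e
      · intro e; exact Prod.ext rfl e
    · intro b _ hb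
      rw [if_neg]
      intro e; exact hb (congrArg Prod.fst e).symm
    · simp
  unfold excess
  rw [key2 (fun _ => 0) (fun _ => by simpa using hl0.le),
    key2 (fun i => - unitVec i) (fun i => by
      rw [map_neg, abs_neg, abs_of_pos (S.p_pos i)]; linarith [hlen i])]
  have : ∀ i, (if (i, - unitVec i) ∈ S.fiber (S.kap * y) then (1 : ℤ) else 0) =
      ∑ π ∈ P, if S.Child π (i, - unitVec i) then (1 : ℤ) else 0 := fun i =>
    key _ (by rw [map_neg, abs_neg, abs_of_pos (S.p_pos i)]; exact hlen i)
  have key0 : ∀ i, (if (i, 0) ∈ S.fiber (S.kap * y) then (1 : ℤ) else 0) =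
      ∑ π ∈ P, if S.Child π (i, 0) then (1 : ℤ) else 0 := fun i =>
    key _ (by simpa using hl0.le)
  simp_rw [this, key0]
  rw [Finset.sum_comm, Finset.sum_comm (s := Finset.univ), ← Finset.sum_sub_distrib,
    ← Finset.sum_sub_distrib]
  refine Finset.sum_congr rfl fun π _ => ?_
  have h3 := occ_flip S.p S.p_pos (S.word π.1) (- S.M π.2)
  have e1 : ∀ i, S.Child π (i, 0) ↔ (i, - S.M π.2) ∈ occ (S.word π.1) := fun i => by
    simp [Child]
  have e2 : ∀ i, S.Child π (i, - unitVec i) ↔ (i, - S.M π.2 - unitVec i) ∈ occ (S.word π.1) :=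
    fun i => by simp only [Child]; rw [show - unitVec i - S.M π.2 = - S.M π.2 - unitVec i by abel]
  simp_rw [e1, e2]
  rw [h3]
  have e3 : - S.M π.2 = 0 ↔ π.2 = 0 := by simp
  have e4 : - S.M π.2 = abel (S.word π.1) ↔ π.2 = - unitVec π.1 := by
    rw [← S.M_unitVec, neg_eq_iff_eq_neg, ← map_neg, EmbeddingLike.apply_eq_iff_eq]
  simp only [e3, e4]

lemma excess_eq_zero_of_large {y : ℝ} (hy : S.bd + (|S.s (unitVec 0)| + |S.s (unitVec 1)|) < |y|) :
    S.excess y = 0 := by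
  have h0 : ∀ i, (i, (0 : ℤ × ℤ)) ∉ S.fiber y := fun i h => by
    have := S.abs_le_bd h
    simp only [map_zero, add_zero] at this
    linarith [abs_nonneg (S.s (unitVec 0)), abs_nonneg (S.s (unitVec 1))]
  have h1 : ∀ i, (i, - unitVec i) ∉ S.fiber y := fun i h => by
    have h2 := S.abs_le_bd h
    simp only [map_neg] at h2
    have h3 : |S.s (unitVec i)| ≤ |S.s (unitVec 0)| + |S.s (unitVec 1)| := by
      fin_cases i <;> simp
    have h4 : |y| ≤ |y + -S.s (unitVec i)| + |S.s (unitVec i)| := by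
      have := abs_add_le (y + -S.s (unitVec i)) (S.s (unitVec i))
      simpa using this
    linarith
  simp [excess, h0, h1]

variable {S} in
lemma Generic.excess_eq_zero {y : ℝ} (h : S.Generic y) : S.excess y = 0 := by
  have hy : y ≠ 0 := by simpa using h.2 0
  have key : ∀ n : ℕ, S.excess (S.kap ^ (-(n : ℤ)) * y) = S.excess y := by
    intro n
    induction n with
    | zero => simp
    | succ n ih =>
      rw [← ih, ← (h.zpow _).excess_kap]
      congr 1
      have := S.kap_ne
      push_cast
      rw [neg_add, zpow_add₀ this]
      field_simp
  obtain ⟨n, hn⟩ := pow_unbounded_of_one_lt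
    ((S.bd + (|S.s (unitVec 0)| + |S.s (unitVec 1)|)) / |y|) S.one_lt_lam
  rw [← key n]
  apply S.excess_eq_zero_of_large
  rw [div_lt_iff₀ (abs_pos.2 hy)] at hn
  rw [abs_mul, abs_zpow, S.abs_kap]
  simpa using hn

open Classical in
variable {S} in
/-- At every vertex as many tiles start as end. -/
lemma Generic.flip {y : ℝ} (h : S.Generic y) (v : ℤ × ℤ) :
    ∑ i, (if (i, v) ∈ S.fiber y then 1 else 0) =
      ∑ i, (if (i, v - unitVec i) ∈ S.fiber y then 1 else 0) := by
  have h1 := (h.add v).excess_eq_zero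
  unfold excess at h1
  simp only [S.mem_fiber_add, zero_add, neg_add_eq_sub] at h1
  have h2 := sub_eq_zero.1 h1
  exact_mod_cast h2

variable {S} in
lemma Generic.exists_start_iff {y : ℝ} (h : S.Generic y) (v : ℤ × ℤ) :
    (∃ i, (i, v) ∈ S.fiber y) ↔ ∃ i, (i, v - unitVec i) ∈ S.fiber y := by
  classical
  have h1 := h.flip v
  have e : ∀ f : Fin 2 → Prop, (∃ i, f i) ↔ ∑ i, (if f i then 1 else 0) ≠ 0 := by
    intro f
    simp only [Fin.exists_fin_two, Fin.sum_univ_two]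
    by_cases h0 : f 0 <;> by_cases h1 : f 1 <;> simp [h0, h1]
  rw [e, e, h1]

end WindowSystem

namespace WindowSystem
open Filter Topology

variable (S : WindowSystem)

lemma isClosed_W (i : Fin 2) : IsClosed (S.W i) := (S.compact i).isClosed

lemma exists_pow_lt (C : ℝ) {ε : ℝ} (hε : 0 < ε) : ∀ᶠ n : ℕ in atTop, |S.kap| ^ n * C < ε := by
  have h : Tendsto (fun n : ℕ => |S.kap| ^ n * C) atTop (𝓝 (0 * C)) :=
    (tendsto_pow_atTop_nhds_zero_of_lt_one (abs_nonneg _) S.abs_kap_lt).mul_const C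
  rw [zero_mul] at h
  exact h.eventually_lt_const hε

lemma exists_lt_lam_pow (C : ℝ) {δ : ℝ} (hδ : 0 < δ) : ∀ᶠ n : ℕ in atTop, C < S.lam ^ n * δ :=
  ((tendsto_pow_atTop_atTop_of_one_lt S.one_lt_lam).atTop_mul_const hδ).eventually_gt_atTop C

/-- Lattice points in a half plane have a dense star image. -/
lemma exists_approx (y : ℝ) {ε : ℝ} (hε : 0 < ε) : ∃ z, 0 ≤ S.p z ∧ |S.s z - y| < ε := by
  obtain ⟨n, hn⟩ := (S.exists_pow_lt |S.s (unitVec 0)| (half_pos hε)).exists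
  set d := S.s (S.Mpow n (unitVec 0)) with hd
  have hd' : |d| < ε / 2 := by rw [hd, s_Mpow, abs_mul, abs_pow]; exact hn
  have hd0 : d ≠ 0 := by
    intro h
    rw [hd, s_Mpow] at h
    rcases mul_eq_zero.1 h with h | h
    · exact pow_ne_zero _ S.kap_ne h
    · have := S.s_inj _ h; simp at this
  set k := round (y / d)
  have hk : |(k : ℝ) * d - y| ≤ |d| := by
    have h1 := abs_sub_round (y / d)
    have : (k : ℝ) * d - y = - ((y / d - k) * d) := by field_simp; ring
    rw [this, abs_neg, abs_mul]
    have := mul_le_mul_of_nonneg_right h1 (abs_nonneg d)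
    linarith [abs_nonneg d]
  obtain ⟨N, hN1, hN2⟩ := ((S.exists_pow_lt |S.s (unitVec 0)| (half_pos hε)).and
    (S.exists_lt_lam_pow (- S.p (k • S.Mpow n (unitVec 0))) (S.p_pos 0))).exists
  refine ⟨k • S.Mpow n (unitVec 0) + S.Mpow N (unitVec 0), ?_, ?_⟩
  · rw [map_add, S.p_Mpow N]; linarith
  · rw [map_add, map_zsmul, ← hd, zsmul_eq_mul]
    have h2 : |S.s (S.Mpow N (unitVec 0))| < ε / 2 := by
      rw [s_Mpow, abs_mul, abs_pow]; exact hN1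
    have : (k : ℝ) * d + S.s (S.Mpow N (unitVec 0)) - y =
      ((k : ℝ) * d - y) + S.s (S.Mpow N (unitVec 0)) := by ring
    rw [this]
    exact (abs_add_le _ _).trans_lt (by linarith)

/-- Two tiles without a common descendant. -/
def NeverCoincide (τ τ' : Tile) : Prop := ∀ n μ, S.Desc n τ μ → ¬ S.Desc n τ' μ

variable {S} in
lemma NeverCoincide.symm {τ τ' : Tile} (h : S.NeverCoincide τ τ') : S.NeverCoincide τ' τ :=
  fun n μ h1 h2 => h n μ h2 h1

variable {S} in
lemma NeverCoincide.shift {τ τ' : Tile} (v : ℤ × ℤ)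
    (h : S.NeverCoincide (τ.1, τ.2 + v) (τ'.1, τ'.2 + v)) : S.NeverCoincide τ τ' :=
  fun n _ h1 h2 => h n _ (S.desc_shift v h1) (S.desc_shift v h2)

variable {S} in
lemma Generic.neverCoincide {y : ℝ} (h : S.Generic y) {τ τ' : Tile} (hτ : τ ∈ S.fiber y)
    (hτ' : τ' ∈ S.fiber y) (hne : τ ≠ τ') : S.NeverCoincide τ τ' :=
  fun _ _ h1 h2 => hne (h.desc_unique hτ hτ' h1 h2)

/-- Tiles over the origin that are almost in the pattern of `y` are in it. -/
lemma exists_pos_mem_fiber (y : ℝ) : ∃ ε > 0, ∀ τ, S.Over 0 τ →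
    (∃ x ∈ S.W τ.1, |y + S.s τ.2 - x| < ε) → τ ∈ S.fiber y := by
  have hC := S.finite_over 0 (S.bd + |y| + 1)
  have h1 : ∀ τ ∈ {τ : Tile | S.Over 0 τ ∧ |S.s τ.2| ≤ S.bd + |y| + 1},
      ∀ᶠ ε in 𝓝[>] (0 : ℝ), (∃ x ∈ S.W τ.1, |y + S.s τ.2 - x| < ε) → τ ∈ S.fiber y := by
    intro τ _
    by_cases hm : τ ∈ S.fiber y
    · exact Eventually.of_forall fun _ _ => hm
    · have : (S.W τ.1)ᶜ ∈ 𝓝 (y + S.s τ.2) := (S.isClosed_W _).isOpen_compl.mem_nhds hm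
      obtain ⟨e, he, hsub⟩ := Metric.mem_nhds_iff.1 this
      filter_upwards [Ioo_mem_nhdsGT he] with ε hε
      rintro ⟨x, hx, hlt⟩
      refine absurd hx (hsub ?_)
      rw [Metric.mem_ball, Real.dist_eq, abs_sub_comm]
      exact hlt.trans hε.2
  have h2 := (hC.eventually_all).2 h1
  obtain ⟨ε, h3, h4⟩ := (h2.and (Ioo_mem_nhdsGT (zero_lt_one' ℝ))).exists
  refine ⟨ε, h4.1, fun τ hτ hx => h3 τ ⟨hτ, ?_⟩ hx⟩
  obtain ⟨x, hxW, hlt⟩ := hx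
  have e : S.s τ.2 = (y + S.s τ.2 - x) + x - y := by ring
  rw [e]
  have := S.abs_le_bd hxW
  have := h4.2
  calc |y + S.s τ.2 - x + x - y| ≤ |y + S.s τ.2 - x| + |x| + |y| :=
        (abs_sub _ _).trans (by gcongr; exact abs_add_le _ _)
    _ ≤ _ := by linarith

/-- The number of tiles over the origin in the pattern of `y`. -/
def mult (y : ℝ) : ℕ := (S.cover 0 y).ncard

lemma exists_cover_subset (y : ℝ) : ∃ ε > 0, ∀ y', |y' - y| < ε → S.cover 0 y' ⊆ S.cover 0 y := by
  obtain ⟨ε, hε, h⟩ := S.exists_pos_mem_fiber y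
  refine ⟨ε, hε, fun y' hy τ hτ => ⟨h τ hτ.2 ⟨_, hτ.1, ?_⟩, hτ.2⟩⟩
  rw [abs_sub_comm]
  convert hy using 2; ring

/-- A family of tiles over the origin without coincidences bounds the multiplicity from below. -/
lemma card_le_mult (C : Finset Tile) {δ : ℝ} (hδ : 0 < δ)
    (hC : ∀ τ ∈ C, S.p τ.2 ≤ 0 ∧ δ ≤ S.p τ.2 + S.p (unitVec τ.1))
    (hN : ∀ τ ∈ C, ∀ τ' ∈ C, τ ≠ τ' → S.NeverCoincide τ τ') (y : ℝ) : C.card ≤ S.mult y := by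
  obtain ⟨ε, hε, hmem⟩ := S.exists_pos_mem_fiber y
  obtain ⟨z, hz0, hz⟩ := S.exists_approx y (half_pos hε)
  choose x hx using S.nonempty
  have hev : ∀ᶠ n : ℕ in atTop, S.p z < S.lam ^ n * δ ∧
      ∀ τ ∈ C, |S.kap| ^ n * |x τ.1 - S.s τ.2| < ε / 2 := by
    refine (S.exists_lt_lam_pow _ hδ).and ?_
    rw [Filter.eventually_all_finset]
    exact fun τ _ => S.exists_pow_lt _ (half_pos hε)
  obtain ⟨n, hn1, hn2⟩ := hev.exists
  have hln : 0 < S.lam ^ n := pow_pos S.lam_pos n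
  have hd : ∀ τ : Tile, ∃ μ, τ ∈ C → S.Desc n τ μ ∧ S.Over (S.p z) μ := by
    intro τ
    by_cases hτ : τ ∈ C
    · have h1 := hC τ hτ
      have : S.Over (S.p z / S.lam ^ n) τ := by
        refine ⟨h1.1.trans (div_nonneg hz0 hln.le), lt_of_lt_of_le ?_ h1.2⟩
        rw [div_lt_iff₀ hln]; linarith
      obtain ⟨μ, h2, h3⟩ := S.exists_desc_over n this
      rw [mul_div_cancel₀ _ hln.ne'] at h3
      exact ⟨μ, fun _ => ⟨h2, h3⟩⟩
    · exact ⟨τ, fun h => absurd h hτ⟩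
  choose μ hμ using hd
  rw [mult, ← Set.ncard_coe_finset]
  refine Set.ncard_le_ncard_of_injOn (fun τ => ((μ τ).1, (μ τ).2 - z)) ?_ ?_ (S.cover_finite _ _)
  · intro τ hτ
    obtain ⟨h1, h2⟩ := hμ τ hτ
    have hov : S.Over 0 ((μ τ).1, (μ τ).2 - z) := by
      simp only [Over, map_sub] at h2 ⊢
      exact ⟨by linarith [h2.1], by linarith [h2.2]⟩
    refine ⟨hmem _ hov ?_, hov⟩
    have h3 : τ ∈ S.fiber (x τ.1 - S.s τ.2) := by rw [mem_fiber]; simpa using hx τ.1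
    have h4 : μ τ ∈ S.fiber _ := S.mem_fiber_kap_pow.2 ⟨τ, h3, h1⟩
    refine ⟨_, h4, ?_⟩
    have h5 := hn2 τ hτ
    rw [← abs_pow, ← abs_mul] at h5
    have : y + S.s ((μ τ).2 - z) - (S.kap ^ n * (x τ.1 - S.s τ.2) + S.s (μ τ).2) =
      - (S.s z - y) - S.kap ^ n * (x τ.1 - S.s τ.2) := by rw [map_sub]; ring
    rw [this]
    refine (abs_sub _ _).trans_lt ?_
    rw [abs_neg]; linarith
  · intro τ hτ τ' hτ' he
    by_contra hne
    have : μ τ = μ τ' := by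
      simp only [Prod.mk.injEq, sub_left_inj] at he
      exact Prod.ext he.1 he.2
    exact hN τ hτ τ' hτ' hne n _ (hμ τ hτ).1 (this ▸ (hμ τ' hτ').1)

/-- The tiles over the origin cover internal space. -/
lemma cover_nonempty (y : ℝ) : (S.cover 0 y).Nonempty := by
  have := S.card_le_mult {(0, 0)} (S.p_pos 0) (by simp) (by simp) y
  rw [Finset.card_singleton] at this
  exact (Set.ncard_pos (S.cover_finite _ _)).1 this

open Classical in
lemma card_filter_eq {y : ℝ} (f : Fin 2 → ℤ × ℤ) (g : ℤ × ℤ → Prop) (P : Finset Tile)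
    (hP : ∀ τ ∈ P, τ ∈ S.fiber y) (VV : Finset (ℤ × ℤ))
    (h1 : ∀ i v, g v → (i, v - f i) ∈ S.fiber y → (i, v - f i) ∈ P)
    (h2 : ∀ τ ∈ P, g (τ.2 + f τ.1) → τ.2 + f τ.1 ∈ VV) :
    ∑ v ∈ VV.filter g, ∑ i, (if (i, v - f i) ∈ S.fiber y then 1 else 0) =
      (P.filter fun τ => g (τ.2 + f τ.1)).card := by
  rw [← Finset.sum_product', Finset.sum_boole]
  simp only [Nat.cast_id]
  refine Finset.card_nbij' (fun x => (x.2, x.1 - f x.2)) (fun τ => (τ.2 + f τ.1, τ.1)) ?_ ?_ ?_ ?_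
  · rintro ⟨v, i⟩ h
    simp only [Finset.coe_filter, Finset.mem_product, Finset.mem_filter, Finset.mem_univ, and_true,
      mem_ofPred_eq] at h ⊢
    exact ⟨h1 i v h.1.2 h.2, by simpa using h.1.2⟩
  · rintro τ h
    simp only [Finset.coe_filter, Finset.mem_product, Finset.mem_filter, Finset.mem_univ, and_true,
      mem_ofPred_eq] at h ⊢
    refine ⟨⟨h2 τ h.1 h.2, h.2⟩, ?_⟩
    simpa using hP τ h.1
  · rintro ⟨v, i⟩ _; simp
  · rintro τ _; simp

variable {S} in
/-- In a generic pattern all points of physical space are covered equally often. -/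
lemma Generic.ncard_cover {y : ℝ} (h : S.Generic y) {t t' : ℝ} (htt : t ≤ t') :
    (S.cover t y).ncard = (S.cover t' y).ncard := by
  classical
  have hlen : ∀ i, S.p (unitVec i) ≤ S.len := S.p_unitVec_le
  have hl0 : 0 < S.len := (S.p_pos 0).trans_le (hlen 0)
  set A := |t| + |t'| + S.len
  set B := S.bd + |y|
  have hfin : (S.fiber y ∩ {π | |S.p π.2| ≤ A ∧ |S.s π.2| ≤ B}).Finite :=
    (S.finite_tiles _ _).subset inter_subset_right
  set P := hfin.toFinset with hP
  have hPmem : ∀ π ∈ S.fiber y, |S.p π.2| ≤ A → π ∈ P := fun π h1 h2 => by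
    rw [hP, Set.Finite.mem_toFinset]
    exact ⟨h1, h2, S.abs_s_le_of_mem_fiber h1⟩
  have hPf : ∀ π ∈ P, π ∈ S.fiber y := fun π hπ => by
    rw [hP, Set.Finite.mem_toFinset] at hπ; exact hπ.1
  set C := |S.s (unitVec 0)| + |S.s (unitVec 1)|
  have hCi : ∀ i, |S.s (unitVec i)| ≤ C := by
    intro i; fin_cases i <;> simp [C]
  set VV := (S.finite_lattice A (B + C)).toFinset with hVV
  have a1 := le_abs_self t
  have a2 := neg_abs_le t
  have a3 := le_abs_self t'
  have a4 := neg_abs_le t'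
  have a5 := abs_nonneg t
  have a6 := abs_nonneg t'
  have hcov : ∀ r, (r = t ∨ r = t') → (S.cover r y).ncard = (P.filter fun τ => S.Over r τ).card := by
    intro r hr
    rw [← Set.ncard_coe_finset]
    congr 1
    ext τ
    simp only [cover, Finset.coe_filter, mem_ofPred_eq]
    refine and_congr_left fun hov => ⟨fun hm => hPmem τ hm ?_, fun hm => hPf τ hm⟩
    have := hlen τ.1
    obtain ⟨h1, h2⟩ := hov
    rw [abs_le]
    rcases hr with rfl | rfl <;> constructor <;> simp only [A] <;> linarith
  set g : ℤ × ℤ → Prop := fun v => t < S.p v ∧ S.p v ≤ t'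
  have hgA : ∀ v, g v → |S.p v| ≤ |t| + |t'| := fun v hv => by
    rw [abs_le]; constructor <;> linarith [hv.1, hv.2]
  have e1 := S.card_filter_eq (y := y) (fun _ => 0) g P hPf VV
    (fun i v hg hm => hPmem _ hm (by simpa using (hgA v hg).trans (by simp only [A]; linarith)))
    (fun τ hτ hg => by
      rw [hVV, Set.Finite.mem_toFinset]
      refine ⟨(hgA _ hg).trans (by simp only [A]; linarith), ?_⟩
      rw [hP, Set.Finite.mem_toFinset] at hτ
      have hC0 : 0 ≤ C := by positivity
      simpa using hτ.2.2.trans (le_add_of_nonneg_right hC0))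
  have e2 := S.card_filter_eq (y := y) unitVec g P hPf VV
    (fun i v hg hm => hPmem _ hm (by
      rw [map_sub]
      refine (abs_sub _ _).trans ?_
      rw [abs_of_pos (S.p_pos i)]
      exact add_le_add (hgA v hg) (hlen i)))
    (fun τ hτ hg => by
      rw [hVV, Set.Finite.mem_toFinset]
      refine ⟨(hgA _ hg).trans (by simp only [A]; linarith), ?_⟩
      rw [hP, Set.Finite.mem_toFinset] at hτ
      rw [map_add]
      exact (abs_add_le _ _).trans (add_le_add hτ.2.2 (hCi _)))
  have e3 : (P.filter fun τ => g (τ.2 + 0)).card = (P.filter fun τ => g (τ.2 + unitVec τ.1)).card := by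
    have e : ∑ v ∈ VV.filter g, ∑ i, (if (i, v - 0) ∈ S.fiber y then 1 else 0) =
        ∑ v ∈ VV.filter g, ∑ i, (if (i, v - unitVec i) ∈ S.fiber y then 1 else 0) :=
      Finset.sum_congr rfl fun v _ => by simpa using h.flip v
    convert e1.symm.trans (Eq.trans (by convert e) e2)
  rw [hcov t (Or.inl rfl), hcov t' (Or.inr rfl)]
  have e4 : ((P.filter fun τ => S.Over t' τ).card : ℤ) - (P.filter fun τ => S.Over t τ).card =
      (P.filter fun τ => g (τ.2 + 0)).card - (P.filter fun τ => g (τ.2 + unitVec τ.1)).card := by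
    simp only [Finset.card_filter]
    push_cast
    rw [← Finset.sum_sub_distrib, ← Finset.sum_sub_distrib]
    refine Finset.sum_congr rfl fun τ _ => ?_
    have hp := S.p_pos τ.1
    simp only [Over, g, map_add, add_zero]
    rcases le_or_gt (S.p τ.2) t with c1 | c1 <;> rcases le_or_gt (S.p τ.2) t' with c2 | c2 <;>
      rcases le_or_gt (S.p τ.2 + S.p (unitVec τ.1)) t with c3 | c3 <;>
      rcases le_or_gt (S.p τ.2 + S.p (unitVec τ.1)) t' with c4 | c4 <;>
      first
        | (exfalso; linarith)
        | simp [c1, c2, c3, c4, not_le.2, not_lt.2]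
  rw [e3, sub_self] at e4
  omega

end WindowSystem

namespace WindowSystem
open Filter Topology

variable (S : WindowSystem)

lemma isOpen_affine_image {c : ℝ} (hc : c ≠ 0) (d : ℝ) {U : Set ℝ} (hU : IsOpen U) :
    IsOpen ((fun x => c * x + d) '' U) := by
  have : (fun x => c * x + d) '' U =
      (Homeomorph.addRight d) '' ((Homeomorph.mulLeft₀ c hc) '' U) := by
    rw [image_image]; rfl
  rw [this]
  exact (Homeomorph.isOpenMap _) _ ((Homeomorph.isOpenMap _) _ hU)

lemma desc_mem {n : ℕ} {π τ : Tile} (h : S.Desc n π τ) {x : ℝ} (hx : x ∈ S.W π.1) :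
    S.kap ^ n * x + (S.s τ.2 - S.kap ^ n * S.s π.2) ∈ S.W τ.1 := by
  have h1 : π ∈ S.fiber (x - S.s π.2) := by rw [mem_fiber]; simpa using hx
  have h2 := S.mem_fiber_kap_pow.2 ⟨π, h1, h⟩
  rw [mem_fiber] at h2
  convert h2 using 1; ring

lemma exists_ancestor (n : ℕ) {i : Fin 2} {x : ℝ} (hx : x ∈ S.W i) :
    ∃ π, S.Desc n π (i, 0) ∧ ∃ z ∈ S.W π.1, x = S.kap ^ n * (z - S.s π.2) := by
  have hk := pow_ne_zero n S.kap_ne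
  have h1 : (i, (0 : ℤ × ℤ)) ∈ S.fiber (S.kap ^ n * (x / S.kap ^ n)) := by
    rw [mul_div_cancel₀ _ hk, mem_fiber]; simpa using hx
  obtain ⟨π, h2, h3⟩ := S.mem_fiber_kap_pow.1 h1
  refine ⟨π, h3, _, h2, ?_⟩
  rw [add_sub_cancel_right, mul_div_cancel₀ _ hk]

lemma interior_nonempty (i : Fin 2) : (interior (S.W i)).Nonempty := by
  have hcl : ∀ τ : {τ : Tile // S.Over 0 τ}, IsClosed ((fun y => y + S.s τ.1.2) ⁻¹' S.W τ.1.1) :=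
    fun τ => (S.isClosed_W _).preimage (by fun_prop)
  have hun : ⋃ τ : {τ : Tile // S.Over 0 τ}, (fun y => y + S.s τ.1.2) ⁻¹' S.W τ.1.1 = univ := by
    refine eq_univ_of_forall fun y => ?_
    obtain ⟨τ, h1, h2⟩ := S.cover_nonempty y
    exact mem_iUnion.2 ⟨⟨τ, h2⟩, h1⟩
  obtain ⟨⟨τ, _⟩, x, hx⟩ := nonempty_interior_of_iUnion_of_closed hcl hun
  obtain ⟨n, w, hd⟩ := S.exists_desc_letter i τ.1
  change x ∈ interior (Homeomorph.addRight (S.s τ.2) ⁻¹' S.W τ.1) at hx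
  rw [← Homeomorph.preimage_interior] at hx
  have hop := isOpen_affine_image (pow_ne_zero n S.kap_ne)
    (S.s w - S.kap ^ n * S.s 0) (isOpen_interior (s := S.W τ.1))
  refine ⟨_, interior_maximal ?_ hop ⟨_, hx, rfl⟩⟩
  rintro _ ⟨x, hx, rfl⟩
  exact S.desc_mem hd (interior_subset hx)

lemma dist_le {i : Fin 2} {x y : ℝ} (hx : x ∈ S.W i) (hy : y ∈ S.W i) : |x - y| ≤ 2 * S.bd := by
  have := S.abs_le_bd hx
  have := S.abs_le_bd hy
  exact (abs_sub _ _).trans (by linarith)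

lemma subset_closure_interior (i : Fin 2) : S.W i ⊆ closure (interior (S.W i)) := by
  intro x hx
  rw [Metric.mem_closure_iff]
  intro ε hε
  obtain ⟨n, hn⟩ := (S.exists_pow_lt (2 * S.bd) hε).exists
  obtain ⟨π, hd, z, hz, rfl⟩ := S.exists_ancestor n hx
  obtain ⟨z', hz'⟩ := S.interior_nonempty π.1
  have hop := isOpen_affine_image (pow_ne_zero n S.kap_ne)
    (S.s 0 - S.kap ^ n * S.s π.2) (isOpen_interior (s := S.W π.1))
  refine ⟨_, interior_maximal ?_ hop ⟨_, hz', rfl⟩, ?_⟩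
  · rintro _ ⟨x, hx, rfl⟩
    exact S.desc_mem hd (interior_subset hx)
  · rw [Real.dist_eq, map_zero]
    have : S.kap ^ n * (z - S.s π.2) - (S.kap ^ n * z' + (0 - S.kap ^ n * S.s π.2)) =
      S.kap ^ n * (z - z') := by ring
    simp only [this, abs_mul, abs_pow]
    refine lt_of_le_of_lt ?_ hn
    exact mul_le_mul_of_nonneg_left (S.dist_le hz (interior_subset hz')) (by positivity)

lemma subset_of_generic {U C : Set ℝ} (hU : U ⊆ closure (interior U)) (hC : IsClosed C)
    (h : ∀ y ∈ interior U, S.Generic y → y ∈ C) : U ⊆ C := by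
  refine hU.trans (closure_minimal ?_ hC)
  refine (S.dense_generic.open_subset_closure_inter isOpen_interior).trans
    (closure_minimal ?_ hC)
  rintro y ⟨h1, h2⟩
  exact h y h1 h2

lemma exists_generic {U : Set ℝ} (hU : IsOpen U) (hne : U.Nonempty) : ∃ y ∈ U, S.Generic y := by
  obtain ⟨y, h1, h2⟩ := S.dense_generic.inter_open_nonempty U hU hne
  exact ⟨y, h1, h2⟩

/-! ### The multiplicity -/

lemma ncard_cover_add (t y : ℝ) (v : ℤ × ℤ) :
    (S.cover t (y + S.s v)).ncard = (S.cover (t + S.p v) y).ncard := by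
  have : S.cover (t + S.p v) y = (fun τ : Tile => (τ.1, τ.2 + v)) '' S.cover t (y + S.s v) := by
    ext τ
    simp only [mem_image, S.mem_cover_add]
    constructor
    · intro h; exact ⟨(τ.1, τ.2 - v), by simpa using h, by simp⟩
    · rintro ⟨τ, h, rfl⟩; exact h
  rw [this, Set.ncard_image_of_injective]
  rintro ⟨i, u⟩ ⟨j, w⟩ h
  simpa using h

/-- The generic multiplicity of the pattern. -/
def deg : ℕ := sInf (range S.mult)

lemma deg_le_mult (y : ℝ) : S.deg ≤ S.mult y := Nat.sInf_le ⟨y, rfl⟩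

variable {S} in
lemma Generic.ncard_cover_eq {y : ℝ} (h : S.Generic y) (t : ℝ) : (S.cover t y).ncard = S.deg := by
  obtain ⟨y₀, h0⟩ : ∃ y₀, S.mult y₀ = S.deg := Nat.sInf_mem (range_nonempty S.mult)
  obtain ⟨ε, hε, hsub⟩ := S.exists_cover_subset y₀
  obtain ⟨v, hv0, hv⟩ := S.exists_approx (y₀ - y) hε
  have h1 := Set.ncard_le_ncard (hsub (y + S.s v) (by convert hv using 2; ring)) (S.cover_finite _ _)
  have h2 := S.deg_le_mult (y + S.s v)
  unfold mult at h0 h2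
  have h3 := S.ncard_cover_add 0 y v
  have h4 : (S.cover t y).ncard = (S.cover (0 + S.p v) y).ncard := by
    rcases le_total t (0 + S.p v) with h' | h'
    · exact h.ncard_cover h'
    · exact (h.ncard_cover h').symm
  omega

lemma card_le_deg (C : Finset Tile) (hC : ∀ τ ∈ C, S.Over 0 τ)
    (hN : ∀ τ ∈ C, ∀ τ' ∈ C, τ ≠ τ' → S.NeverCoincide τ τ') : C.card ≤ S.deg := by
  obtain ⟨y₀, h0⟩ : ∃ y₀, S.mult y₀ = S.deg := Nat.sInf_mem (range_nonempty S.mult)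
  rw [← h0]
  have : ∀ᶠ δ in 𝓝[>] (0 : ℝ), ∀ τ ∈ C, δ ≤ S.p τ.2 + S.p (unitVec τ.1) := by
    rw [Filter.eventually_all_finset]
    intro τ hτ
    filter_upwards [Ioo_mem_nhdsGT (hC τ hτ).2] with δ hδ using hδ.2.le
  obtain ⟨δ, h1, h2⟩ := (this.and self_mem_nhdsWithin).exists
  exact S.card_le_mult C h2 (fun τ hτ => ⟨(hC τ hτ).1, h1 τ hτ⟩) hN y₀

/-! ### Coincidence -/

/-- `w` is the first vertex at which a tile of `C` ends. -/
def IsNext (C : Set Tile) (w : ℤ × ℤ) : Prop :=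
  (∃ τ ∈ C, w = τ.2 + unitVec τ.1) ∧ ∀ τ ∈ C, S.p w ≤ S.p τ.2 + S.p (unitVec τ.1)

lemma exists_isNext (y : ℝ) : ∃ w, S.IsNext (S.cover 0 y) w := by
  obtain ⟨τ, h1, h2⟩ := (S.cover_finite 0 y).exists_minimalFor
    (fun τ : Tile => S.p (τ.2 + unitVec τ.1)) _ (S.cover_nonempty y)
  refine ⟨_, ⟨τ, h1, rfl⟩, fun τ' h => ?_⟩
  have := h2 h
  rw [← map_add]
  by_contra hc
  push Not at hc
  exact absurd (this hc.le) hc.not_ge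

variable {S} in
lemma IsNext.pos {y : ℝ} {w : ℤ × ℤ} (h : S.IsNext (S.cover 0 y) w) : 0 < S.p w := by
  obtain ⟨⟨τ, h1, rfl⟩, -⟩ := h
  rw [map_add]; exact h1.2.2

variable {S} in
lemma Generic.of_mem_cover_next {y : ℝ} (h : S.Generic y) {w : ℤ × ℤ}
    (hw : S.IsNext (S.cover 0 y) w) {τ : Tile} (hτ : τ ∈ S.cover 0 (y + S.s w)) :
    τ.2 = 0 ∨ (τ.1, τ.2 + w) ∈ S.cover 0 y := by
  rw [S.mem_cover_add, zero_add] at hτ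
  obtain ⟨h1, h2, h3⟩ := hτ
  simp only at h1 h2 h3
  have hw0 := hw.pos
  by_cases h4 : S.p (τ.2 + w) ≤ 0
  · exact Or.inr ⟨h1, h4, hw0.trans h3⟩
  push Not at h4
  rcases h2.lt_or_eq with h5 | h5
  · exfalso
    have hsub : S.cover 0 y ⊆ S.cover (S.p (τ.2 + w)) y := fun μ hμ =>
      ⟨hμ.1, hμ.2.1.trans h4.le, h5.trans_le (hw.2 μ hμ)⟩
    have heq := Set.eq_of_subset_of_ncard_le hsub
      (by rw [h.ncard_cover_eq, h.ncard_cover_eq]) (S.cover_finite _ _)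
    have : (τ.1, τ.2 + w) ∈ S.cover (S.p (τ.2 + w)) y := ⟨h1, le_rfl, by
      simp only; linarith [S.p_pos τ.1]⟩
    rw [← heq] at this
    exact h4.not_ge this.2.1
  · left
    apply S.p_inj
    rw [map_add] at h5; linarith

lemma cover_next_subset (hNC : S.NeverCoincide (0, 0) (1, 0)) {y y' : ℝ} (h : S.Generic y)
    (h' : S.Generic y') (heq : S.cover 0 y = S.cover 0 y') {w : ℤ × ℤ}
    (hw : S.IsNext (S.cover 0 y) w) : S.cover 0 (y + S.s w) ⊆ S.cover 0 (y' + S.s w) := by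
  classical
  intro τ hτ
  rcases h.of_mem_cover_next hw hτ with h1 | h1
  swap
  · rw [heq] at h1
    exact ⟨S.mem_fiber_add.2 h1.1, hτ.2⟩
  obtain ⟨i, u⟩ := τ
  simp only at h1; subst h1
  by_contra hc
  have hC := S.cover_finite 0 (y' + S.s w)
  have hnm : (i, (0 : ℤ × ℤ)) ∉ hC.toFinset := by simpa using hc
  have key : ∀ μ ∈ S.cover 0 (y' + S.s w), S.NeverCoincide (i, 0) μ := by
    intro μ hμ
    have hne : (i, (0 : ℤ × ℤ)) ≠ μ := by rintro rfl; exact hc hμ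
    rcases h'.of_mem_cover_next (heq ▸ hw) hμ with h2 | h2
    · obtain ⟨j, u⟩ := μ
      simp only at h2; subst h2
      have hij : i ≠ j := fun e => hne (by rw [e])
      fin_cases i <;> fin_cases j
      · exact absurd rfl hij
      · exact hNC
      · exact hNC.symm
      · exact absurd rfl hij
    · rw [← heq] at h2
      exact (h.add w).neverCoincide hτ.1 (S.mem_fiber_add.2 h2.1) hne
  have := S.card_le_deg (insert (i, 0) hC.toFinset) (by
    intro μ hμ
    rcases Finset.mem_insert.1 hμ with rfl | hμ
    · exact hτ.2
    · exact (hC.mem_toFinset.1 hμ).2) (by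
    intro μ hμ μ' hμ' hne
    rcases Finset.mem_insert.1 hμ with rfl | hμ <;> rcases Finset.mem_insert.1 hμ' with rfl | hμ'
    · exact absurd rfl hne
    · exact key _ (hC.mem_toFinset.1 hμ')
    · exact (key _ (hC.mem_toFinset.1 hμ)).symm
    · exact (h'.add w).neverCoincide (hC.mem_toFinset.1 hμ).1 (hC.mem_toFinset.1 hμ').1 hne)
  rw [Finset.card_insert_of_notMem hnm, ← Set.ncard_eq_toFinset_card _ hC,
    (h'.add w).ncard_cover_eq] at this
  omega

lemma exists_coincidence : ¬ S.NeverCoincide (0, 0) (1, 0) := by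
  intro hNC
  obtain ⟨y, -, hy⟩ := S.exists_generic isOpen_univ univ_nonempty
  have hnx : ∃ f : Set Tile → ℤ × ℤ, ∀ y, S.IsNext (S.cover 0 y) (f (S.cover 0 y)) := by
    classical
    refine ⟨fun C => if h : ∃ w, S.IsNext C w then h.choose else 0, fun y => ?_⟩
    beta_reduce
    rw [dif_pos (S.exists_isNext y)]
    exact (S.exists_isNext y).choose_spec
  obtain ⟨f, hf⟩ := hnx
  let v : ℕ → ℤ × ℤ := fun n => Nat.rec 0 (fun _ w => w + f (S.cover 0 (y + S.s w))) n
  have v_succ : ∀ n, v (n + 1) = v n + f (S.cover 0 (y + S.s (v n))) := fun n => rfl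
  set St : ℕ → Set Tile := fun n => S.cover 0 (y + S.s (v n)) with hSt
  have hgen : ∀ n, S.Generic (y + S.s (v n)) := fun n => hy.add _
  have hy_succ : ∀ n, y + S.s (v (n + 1)) = (y + S.s (v n)) + S.s (f (St n)) := fun n => by
    rw [v_succ, map_add, add_assoc]
  have hbd : ∀ n, |y + S.s (v (n + 1))| ≤ S.bd := by
    intro n
    obtain ⟨⟨τ, hτ, e⟩, -⟩ := hf (y + S.s (v n))
    obtain ⟨i, hi⟩ := ((hgen n).exists_start_iff (f (St n))).2 ⟨τ.1, by
      simp only [hSt]; rw [e, add_sub_cancel_right]; exact hτ.1⟩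
    rw [hy_succ]
    exact S.abs_le_bd hi
  have hmono : StrictMono fun n => S.p (v n) := by
    refine strictMono_nat_of_lt_succ fun n => ?_
    rw [v_succ, map_add]
    have := (hf (y + S.s (v n))).pos
    linarith
  have hdet : ∀ a b, St a = St b → St (a + 1) = St (b + 1) := by
    intro a b hab
    have h1 := hf (y + S.s (v a))
    have h2 := hf (y + S.s (v b))
    simp only [hSt] at hab ⊢
    rw [hy_succ, hy_succ]
    simp only [hSt]
    refine Subset.antisymm ?_ ?_
    · rw [← hab]
      exact S.cover_next_subset hNC (hgen a) (hgen b) hab h1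
    · rw [hab]
      exact S.cover_next_subset hNC (hgen b) (hgen a) hab.symm h2
  -- two of the states agree
  obtain ⟨a, b, hab, he⟩ : ∃ a b, a < b ∧ St a = St b := by
    have hfin : {C : Set Tile | C ⊆ {τ | S.Over 0 τ ∧ |S.s τ.2| ≤ S.bd + S.bd}}.Finite :=
      (S.finite_over 0 (S.bd + S.bd)).finite_subsets
    have hmaps : ∀ n, St (n + 1) ∈ {C : Set Tile | C ⊆ {τ | S.Over 0 τ ∧ |S.s τ.2| ≤ S.bd + S.bd}} :=
      fun n τ hτ => ⟨hτ.2, (S.abs_s_le_of_mem_fiber hτ.1).trans (by gcongr; exact hbd n)⟩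
    obtain ⟨a, b, hab, he⟩ := hfin.exists_lt_map_eq_of_forall_mem hmaps
    exact ⟨a + 1, b + 1, by omega, he⟩
  have hper : ∀ r, St (a + r) = St (b + r) ∧ v (b + r) - v (a + r) = v b - v a := by
    intro r
    induction r with
    | zero => exact ⟨he, rfl⟩
    | succ r ih =>
      refine ⟨hdet _ _ ih.1, ?_⟩
      have h1 := v_succ (b + r)
      have h2 := v_succ (a + r)
      have h3 : S.cover 0 (y + S.s (v (a + r))) = S.cover 0 (y + S.s (v (b + r))) := ih.1
      rw [← add_assoc, ← add_assoc, h1, h2, h3, ← ih.2]; abel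
  set D := v b - v a with hD
  have hq : ∀ q : ℕ, v (b + q * (b - a)) = v b + q • D := by
    intro q
    induction q with
    | zero => simp
    | succ q ih =>
      have h1 := (hper ((q + 1) * (b - a))).2
      have e : a + (q + 1) * (b - a) = b + q * (b - a) := by
        have : a + (b - a) = b := by omega
        rw [Nat.succ_mul]; omega
      rw [e, ih] at h1
      rw [eq_add_of_sub_eq h1, succ_nsmul]; abel
  have hD0 : 0 < |S.s D| := by
    rw [abs_pos]
    intro h0
    have h1 := S.s_inj _ h0
    have h2 := hmono hab
    rw [hD, sub_eq_zero] at h1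
    simp only [h1] at h2
    exact lt_irrefl _ h2
  obtain ⟨q, hq'⟩ := exists_nat_gt (2 * S.bd / |S.s D|)
  rw [div_lt_iff₀ hD0] at hq'
  have h1 := hbd (b - 1)
  have h2 := hbd (b - 1 + q * (b - a))
  rw [show b - 1 + q * (b - a) + 1 = b + q * (b - a) by omega, hq, map_add, map_nsmul] at h2
  rw [show b - 1 + 1 = b by omega] at h1
  have h3 : (q : ℝ) * |S.s D| = |(y + (S.s (v b) + q • S.s D)) - (y + S.s (v b))| := by
    rw [show (y + (S.s (v b) + q • S.s D)) - (y + S.s (v b)) = q • S.s D by ring, nsmul_eq_mul,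
      abs_mul, Nat.abs_cast]
  have h4 := abs_sub (y + (S.s (v b) + q • S.s D)) (y + S.s (v b))
  linarith

variable {S} in
/-- In a generic pattern at most one tile starts at a vertex. -/
lemma Generic.start_unique {y : ℝ} (h : S.Generic y) {v : ℤ × ℤ} {i j : Fin 2}
    (hi : (i, v) ∈ S.fiber y) (hj : (j, v) ∈ S.fiber y) : i = j := by
  by_contra hne
  have h1 := h.neverCoincide hi hj (by simpa using hne)
  have h2 : S.NeverCoincide (i, 0) (j, 0) := NeverCoincide.shift v (by simpa using h1)
  fin_cases i <;> fin_cases j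
  · exact hne rfl
  · exact S.exists_coincidence h2
  · exact S.exists_coincidence h2.symm
  · exact hne rfl

variable {S} in
lemma Generic.end_unique {y : ℝ} (h : S.Generic y) {v : ℤ × ℤ} {i j : Fin 2}
    (hi : (i, v - unitVec i) ∈ S.fiber y) (hj : (j, v - unitVec j) ∈ S.fiber y) : i = j := by
  classical
  have h1 := h.flip v
  by_contra hne
  have h3 : ∀ k, (k, v - unitVec k) ∈ S.fiber y := by
    intro k
    have : k = i ∨ k = j := by omega
    rcases this with rfl | rfl <;> assumption
  have h4 : ∃ k, (k, v) ∉ S.fiber y := by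
    by_contra hc
    push Not at hc
    exact hne (h.start_unique (hc i) (hc j))
  obtain ⟨k, hk⟩ := h4
  simp only [h3, if_true] at h1
  have h5 : ∑ l, (if (l, v) ∈ S.fiber y then 1 else 0) < ∑ l : Fin 2, 1 := by
    refine Finset.sum_lt_sum (fun l _ => by split_ifs <;> simp) ⟨k, Finset.mem_univ _, by simp [hk]⟩
  omega

end WindowSystem

namespace WindowSystem
open Filter Topology

variable (S : WindowSystem)

/-- The window. -/
def win : Set ℝ := S.W 0 ∪ S.W 1

lemma mem_win {y : ℝ} : y ∈ S.win ↔ ∃ i, y ∈ S.W i := by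
  simp [win, Fin.exists_fin_two]

lemma isCompact_win : IsCompact S.win := (S.compact 0).union (S.compact 1)

lemma abs_le_of_mem_win {y : ℝ} (h : y ∈ S.win) : |y| ≤ S.bd := by
  obtain ⟨i, hi⟩ := S.mem_win.1 h
  exact S.abs_le_bd hi

variable {S} in
lemma Generic.forward {y : ℝ} (h : S.Generic y) {i : Fin 2} (hi : y ∈ S.W i) :
    y + S.s (unitVec i) ∈ S.win := by
  obtain ⟨j, hj⟩ := (h.exists_start_iff (unitVec i)).2 ⟨i, by simpa [mem_fiber] using hi⟩
  exact S.mem_win.2 ⟨j, hj⟩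

variable {S} in
lemma Generic.backward {y : ℝ} (h : S.Generic y) (hi : y ∈ S.win) :
    ∃ i, y - S.s (unitVec i) ∈ S.W i := by
  obtain ⟨j, hj⟩ := S.mem_win.1 hi
  obtain ⟨i, hi⟩ := (h.exists_start_iff 0).1 ⟨j, by simpa [mem_fiber] using hj⟩
  exact ⟨i, by simpa [mem_fiber, sub_eq_add_neg] using hi⟩

variable {S} in
lemma Generic.letter_unique {y : ℝ} (h : S.Generic y) {i j : Fin 2} (hi : y ∈ S.W i)
    (hj : y ∈ S.W j) : i = j :=
  h.start_unique (v := 0) (by simpa [mem_fiber] using hi) (by simpa [mem_fiber] using hj)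

variable {S} in
lemma Generic.backward_unique {y : ℝ} (h : S.Generic y) {i j : Fin 2}
    (hi : y - S.s (unitVec i) ∈ S.W i) (hj : y - S.s (unitVec j) ∈ S.W j) : i = j :=
  h.end_unique (v := 0) (by simpa [mem_fiber, sub_eq_add_neg] using hi)
    (by simpa [mem_fiber, sub_eq_add_neg] using hj)

/-- The star image of the vector between neighbouring lattice points of the same level. -/
def dif : ℝ := S.s (unitVec 0) - S.s (unitVec 1)

lemma dif_ne : S.dif ≠ 0 := by
  unfold dif
  rw [← map_sub]
  intro h
  have := S.s_inj _ h
  simp at this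

/-- No vertex of the same level lies beyond the origin. -/
def Top (y : ℝ) : Prop := ∀ k : ℕ, y + (k + 1) * S.dif ∉ S.win

lemma s_unitVec_sub (i j : Fin 2) : ∃ k : ℤ, (k = -1 ∧ i ≠ j ∨ k = 0 ∨ k = 1) ∧
    S.s (unitVec i) - S.s (unitVec j) = k * S.dif := by
  fin_cases i <;> fin_cases j
  · exact ⟨0, by simp, by simp⟩
  · exact ⟨1, by simp, by simp [dif]⟩
  · exact ⟨-1, by simp, by simp [dif]⟩
  · exact ⟨0, by simp, by simp⟩

variable {S} in
lemma Generic.add_dif {y : ℝ} (h : S.Generic y) (k : ℤ) : S.Generic (y + k * S.dif) := by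
  have := h.add (k • (unitVec 0 - unitVec 1))
  rwa [map_zsmul, map_sub, zsmul_eq_mul] at this

lemma not_top {y : ℝ} {k : ℤ} (hk : 0 < k) (h : y + k * S.dif ∈ S.win) : ¬ S.Top y := by
  intro ht
  obtain ⟨n, rfl⟩ := Int.eq_ofNat_of_zero_le hk.le
  cases n with
  | zero => simp at hk
  | succ n => exact ht n (by exact_mod_cast h)

variable {S} in
lemma Generic.top_iff {y : ℝ} (h : S.Generic y) {i : Fin 2} (hi : y ∈ S.W i) :
    S.Top y ↔ S.Top (y + S.s (unitVec i)) := by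
  constructor
  · intro ht k hk
    have hg : S.Generic (y + S.s (unitVec i) + (k + 1) * S.dif) := by
      exact_mod_cast (h.add (unitVec i)).add_dif (k + 1)
    obtain ⟨j, hj⟩ := hg.backward hk
    obtain ⟨l, hl, e⟩ := S.s_unitVec_sub i j
    have e2 : y + S.s (unitVec i) + (k + 1) * S.dif - S.s (unitVec j) =
        y + ((k + 1 + l : ℤ) : ℝ) * S.dif := by
      push_cast; linear_combination e
    rw [e2] at hj
    rcases (show 0 < (k + 1 + l : ℤ) ∨ (k + 1 + l : ℤ) = 0 by omega) with h0 | h0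
    · exact S.not_top h0 (S.mem_win.2 ⟨j, hj⟩) ht
    · rw [h0] at hj
      have := h.letter_unique hi (by simpa using hj)
      omega
  · intro ht k hk
    obtain ⟨j, hj⟩ := S.mem_win.1 hk
    have hg : S.Generic (y + (k + 1) * S.dif) := by exact_mod_cast h.add_dif (k + 1)
    have h1 := hg.forward hj
    obtain ⟨l, hl, e⟩ := S.s_unitVec_sub j i
    have e2 : y + (k + 1) * S.dif + S.s (unitVec j) =
        y + S.s (unitVec i) + ((k + 1 + l : ℤ) : ℝ) * S.dif := by
      push_cast; linear_combination e
    rw [e2] at h1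
    rcases (show 0 < (k + 1 + l : ℤ) ∨ (k + 1 + l : ℤ) = 0 by omega) with h0 | h0
    · exact S.not_top h0 h1 ht
    · rw [h0] at e2
      have hg2 := h.add (unitVec i)
      have : i = j := hg2.backward_unique (by simpa using hi) (by
        rw [show y + S.s (unitVec i) = y + (k + 1) * S.dif + S.s (unitVec j) by
          rw [e2]; simp]
        simpa using hj)
      omega

/-- Invariance of a property along the paths of the patterns. -/
def Inv (Q : ℝ → Prop) : Prop :=
  ∀ i y, S.Generic y → y ∈ S.W i → (Q y ↔ Q (y + S.s (unitVec i)))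

variable {S} in
lemma Inv.path {Q : ℝ → Prop} (hQ : S.Inv Q) {y : ℝ} (hy : S.Generic y) (u : List (Fin 2))
    (h : ∀ q ∈ occ u, y + S.s q.2 ∈ S.W q.1) : Q y ↔ Q (y + S.s (abel u)) := by
  induction u generalizing y with
  | nil => simp
  | cons a u ih =>
    have h1 : y ∈ S.W a := by simpa using h (a, 0) (mem_occ_cons.2 (Or.inl rfl))
    rw [hQ a y hy h1, abel_cons, map_add, ← add_assoc]
    refine ih (hy.add _) fun q hq => ?_
    have := h (q.1, q.2 + unitVec a) (mem_occ_cons.2 (Or.inr (by simpa using hq)))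
    simp only [map_add] at this
    convert this using 1; ring

lemma occ_append_left (u v : List (Fin 2)) : occ u ⊆ occ (u ++ v) := by
  rintro q ⟨a, b, h1, h2⟩
  exact ⟨a, b ++ v, by simp [h1], h2⟩

lemma mem_kap_mul {y : ℝ} {i : Fin 2} (hy : y ∈ S.W i) {q : Fin 2 × (ℤ × ℤ)}
    (hq : q ∈ occ (S.word i)) : S.kap * y + S.s q.2 ∈ S.W q.1 :=
  (S.gifs _ _).2 ⟨i, q.2, hq, y, hy, rfl⟩

variable {S} in
lemma Inv.kap_mul_iff {Q : ℝ → Prop} (hQ : S.Inv Q) {y : ℝ} (hy : S.Generic y) {i : Fin 2}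
    (hi : y ∈ S.W i) {q : Fin 2 × (ℤ × ℤ)} (hq : q ∈ occ (S.word i)) :
    Q (S.kap * y) ↔ Q (S.kap * y + S.s q.2) := by
  obtain ⟨u, v, h1, h2⟩ := hq
  rw [h2]
  refine hQ.path hy.kap u fun q' hq' => S.mem_kap_mul hi ?_
  rw [h1]
  exact occ_append_left _ _ hq'

variable {S} in
lemma Inv.comp_kap {Q : ℝ → Prop} (hQ : S.Inv Q) : S.Inv fun y => Q (S.kap * y) := by
  intro i y hy hi
  have h := hQ.path hy.kap (S.word i) fun q hq => S.mem_kap_mul hi hq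
  rwa [← S.M_unitVec, S.s_M, ← mul_add] at h

variable {S} in
lemma Inv.comp_kap_pow {Q : ℝ → Prop} (hQ : S.Inv Q) (n : ℕ) :
    S.Inv fun y => Q (S.kap ^ n * y) := by
  induction n generalizing Q with
  | zero => simpa using hQ
  | succ n ih =>
    have := ih hQ.comp_kap
    simpa only [pow_succ', mul_assoc] using this

variable {S} in
lemma Inv.desc_iff {Q : ℝ → Prop} (hQ : S.Inv Q) {n : ℕ} {y : ℝ} (hy : S.Generic y) {π τ : Tile}
    (hπ : π ∈ S.fiber y) (h : S.Desc n π τ) :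
    Q (S.kap ^ n * y + S.s τ.2) ↔ Q (S.kap ^ n * (y + S.s π.2)) := by
  induction n generalizing Q τ with
  | zero => cases h; simp
  | succ n ih =>
    obtain ⟨μ, h1, h2⟩ := h
    have h3 : μ ∈ S.fiber (S.kap ^ n * y) := S.mem_fiber_kap_pow.2 ⟨π, hπ, h1⟩
    have h4 := ih hQ.comp_kap h1
    have h5 := hQ.kap_mul_iff ((hy.kap_pow n).add μ.2) h3 h2
    simp only [map_sub, S.s_M] at h5
    rw [pow_succ', mul_assoc, mul_assoc, ← h4, h5]
    refine iff_of_eq (congrArg Q ?_)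
    ring

variable {S} in
lemma Inv.of_letter {Q : ℝ → Prop} (hQ : S.Inv Q) {j : Fin 2}
    (hj : ∀ y, S.Generic y → y ∈ S.W j → Q y) {y : ℝ} (hy : S.Generic y) (hw : y ∈ S.win) : Q y := by
  by_contra hc
  obtain ⟨i, hij⟩ : ∃ i : Fin 2, i ≠ j := exists_ne j
  have key : ∀ n : ℕ, y + n * S.s (unitVec i) ∈ S.W i ∧ ¬ Q (y + n * S.s (unitVec i)) := by
    have h0 : ∀ z, S.Generic z → z ∈ S.win → ¬ Q z → z ∈ S.W i := by
      intro z hz hzw hQz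
      obtain ⟨k, hk⟩ := S.mem_win.1 hzw
      have : k ≠ j := by rintro rfl; exact hQz (hj z hz hk)
      have : k = i := by omega
      exact this ▸ hk
    have hg : ∀ n : ℕ, S.Generic (y + n * S.s (unitVec i)) := fun n => by
      have := hy.add (n • unitVec i)
      rwa [map_nsmul, nsmul_eq_mul] at this
    intro n
    induction n with
    | zero => simpa using ⟨h0 y hy hw hc, hc⟩
    | succ n ih =>
      have h1 := (hg n).forward ih.1
      have h2 := (hQ i _ (hg n) ih.1).not.1 ih.2
      have e : y + (n : ℝ) * S.s (unitVec i) + S.s (unitVec i) =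
        y + ((n + 1 : ℕ) : ℝ) * S.s (unitVec i) := by push_cast; ring
      rw [e] at h1 h2
      exact ⟨h0 _ (hg _) h1 h2, h2⟩
  have hpos : 0 < |S.s (unitVec i)| := by
    rw [abs_pos]; intro h
    have := S.p_pos i
    rw [S.s_inj _ h, map_zero] at this
    exact lt_irrefl _ this
  obtain ⟨n, hn⟩ := exists_nat_gt ((S.bd + |y|) / |S.s (unitVec i)|)
  rw [div_lt_iff₀ hpos] at hn
  have h1 := S.abs_le_bd (key n).1
  have h2 := abs_sub (y + n * S.s (unitVec i)) y
  rw [add_sub_cancel_left, abs_mul, Nat.abs_cast] at h2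
  linarith

lemma top_inv : S.Inv S.Top := fun _ _ hy hi => hy.top_iff hi

lemma exists_lt_mul_dif (y : ℝ) : ∃ N : ℕ, ∀ k : ℕ, N ≤ k → S.bd < |y + (k + 1) * S.dif| := by
  have hd := abs_pos.2 S.dif_ne
  obtain ⟨N, hN⟩ := exists_nat_gt ((S.bd + |y|) / |S.dif|)
  rw [div_lt_iff₀ hd] at hN
  refine ⟨N, fun k hk => ?_⟩
  have h2 := abs_sub (y + (k + 1) * S.dif) y
  rw [add_sub_cancel_left, abs_mul, abs_of_pos (show (0 : ℝ) < k + 1 by positivity)] at h2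
  have : (N : ℝ) ≤ k := by exact_mod_cast hk
  nlinarith

lemma exists_top : ∃ y, S.Generic y ∧ y ∈ S.win ∧ S.Top y := by
  obtain ⟨y, hy1, hy⟩ := S.exists_generic isOpen_interior (S.interior_nonempty 0)
  have hyW : y ∈ S.win := S.mem_win.2 ⟨0, interior_subset hy1⟩
  obtain ⟨N, hN⟩ := S.exists_lt_mul_dif y
  classical
  have hP : ∃ k ≤ N + 1, y + (k : ℕ) * S.dif ∈ S.win := ⟨0, by omega, by simpa using hyW⟩
  set K := Nat.findGreatest (fun k : ℕ => y + k * S.dif ∈ S.win) (N + 1) with hK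
  have hKm : y + K * S.dif ∈ S.win :=
    Nat.findGreatest_spec (P := fun k : ℕ => y + k * S.dif ∈ S.win) (m := 0) (by omega)
      (by simpa using hyW)
  refine ⟨y + K * S.dif, by exact_mod_cast hy.add_dif K, hKm, fun k hk => ?_⟩
  have e : y + K * S.dif + (k + 1) * S.dif = y + ((K + (k + 1) : ℕ) : ℝ) * S.dif := by
    push_cast; ring
  rw [e] at hk
  by_cases hle : K + (k + 1) ≤ N + 1
  · have := Nat.le_findGreatest (P := fun k : ℕ => y + k * S.dif ∈ S.win) hle hk
    omega
  · have h1 := hN (K + k) (by omega)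
    have h2 := S.abs_le_of_mem_win hk
    push_cast at h1 h2
    rw [← add_assoc] at h2
    linarith

lemma top_nhds {y : ℝ} (h : S.Top y) : ∃ ε > 0, ∀ y', |y' - y| < ε → S.Top y' := by
  obtain ⟨N, hN⟩ := S.exists_lt_mul_dif y
  have hd := abs_pos.2 S.dif_ne
  obtain ⟨N, hN⟩ := exists_nat_gt ((S.bd + (|y| + 1)) / |S.dif|)
  rw [div_lt_iff₀ hd] at hN
  have h1 : ∀ k ∈ Finset.range N, ∀ᶠ y' in 𝓝 y, y' + (k + 1) * S.dif ∉ S.win := by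
    intro k _
    have hcl : IsClosed ((fun y' => y' + (k + 1) * S.dif) ⁻¹' S.win) :=
      S.isCompact_win.isClosed.preimage (by fun_prop)
    exact hcl.isOpen_compl.mem_nhds (h k)
  have h2 := (Filter.eventually_all_finset _).2 h1
  obtain ⟨ε, hε, hsub⟩ := Metric.eventually_nhds_iff.1 h2
  refine ⟨min ε 1, by positivity, fun y' hy' k hk => ?_⟩
  by_cases hkN : k < N
  · exact hsub (by rw [Real.dist_eq]; exact hy'.trans_le (min_le_left _ _)) k
      (Finset.mem_range.2 hkN) hk
  · have h3 := S.abs_le_of_mem_win hk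
    have h4 := abs_sub (y' + (k + 1) * S.dif) y'
    rw [add_sub_cancel_left, abs_mul, abs_of_pos (show (0 : ℝ) < k + 1 by positivity)] at h4
    have : (N : ℝ) ≤ k := by exact_mod_cast not_lt.1 hkN
    have h5 := abs_sub_abs_le_abs_sub y' y
    have := min_le_right ε 1
    nlinarith

variable {S} in
lemma Generic.top {y : ℝ} (hy : S.Generic y) (hw : y ∈ S.win) : S.Top y := by
  obtain ⟨x, hx, hxw, hxt⟩ := S.exists_top
  obtain ⟨ε, hε, hnear⟩ := S.top_nhds hxt
  obtain ⟨i, hi⟩ := S.mem_win.1 hxw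
  obtain ⟨n, hn⟩ := (S.exists_pow_lt (2 * S.bd) hε).exists
  obtain ⟨π, hd, z, hz, e⟩ := S.exists_ancestor n hi
  have hinv := S.top_inv.comp_kap_pow n
  have h1 : ∀ y, S.Generic y → y ∈ S.W π.1 → S.Top (S.kap ^ n * y) := by
    intro u hu huW
    have hgu : S.Generic (u - S.s π.2) := by
      have := hu.add (- π.2); rwa [map_neg, ← sub_eq_add_neg] at this
    have h2 := S.top_inv.desc_iff (n := n) hgu (π := π) (by rw [mem_fiber]; simpa using huW) hd
    rw [sub_add_cancel] at h2
    rw [← h2]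
    refine hnear _ ?_
    rw [e, map_zero, add_zero, ← mul_sub, abs_mul, abs_pow]
    refine lt_of_le_of_lt ?_ hn
    refine mul_le_mul_of_nonneg_left ?_ (by positivity)
    rw [sub_sub_sub_cancel_right]
    exact S.dist_le huW hz
  have h2 : ∀ y, S.Generic y → y ∈ S.win → S.Top (S.kap ^ n * y) := fun y hy hw =>
    hinv.of_letter h1 hy hw
  obtain ⟨j, hj⟩ := S.mem_win.1 hw
  obtain ⟨π', hd', z', hz', e'⟩ := S.exists_ancestor n hj
  have hg' : S.Generic (z' - S.s π'.2) := by
    have := hy.zpow (-(n : ℤ))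
    rw [e', zpow_neg, zpow_natCast, inv_mul_cancel_left₀ (pow_ne_zero n S.kap_ne)] at this
    exact this
  have h3 := S.top_inv.desc_iff hg' (π := π') (by rw [mem_fiber]; simpa using hz') hd'
  rw [map_zero, add_zero, ← e', sub_add_cancel] at h3
  refine h3.2 (h2 z' ?_ (S.mem_win.2 ⟨_, hz'⟩))
  have := hg'.add π'.2
  rwa [sub_add_cancel] at this

variable {S} in
/-- A generic pattern has at most one vertex on every level. -/
lemma Generic.level_unique {y : ℝ} (hy : S.Generic y) {v v' : ℤ × ℤ} (hv : y + S.s v ∈ S.win)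
    (hv' : y + S.s v' ∈ S.win) (hl : v.1 + v.2 = v'.1 + v'.2) : v = v' := by
  have key : ∀ v v' : ℤ × ℤ, y + S.s v ∈ S.win → y + S.s v' ∈ S.win → v.1 + v.2 = v'.1 + v'.2 →
      v'.1 ≤ v.1 := by
    intro v v' hv hv' hl
    by_contra hc
    push Not at hc
    have e : v' = v + (v'.1 - v.1) • (unitVec 0 - unitVec 1) := by
      ext
      · simp
      · simp; omega
    rw [e, map_add, map_zsmul, map_sub, zsmul_eq_mul, ← add_assoc] at hv'
    exact S.not_top (k := v'.1 - v.1) (by omega) hv' ((hy.add v).top hv)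
  have h1 := key v v' hv hv' hl
  have h2 := key v' v hv' hv hl.symm
  ext
  · omega
  · omega

variable {S} in
lemma Generic.exists_forward {y : ℝ} (hy : S.Generic y) {i : Fin 2} {u : ℤ × ℤ}
    (h : (i, u) ∈ S.fiber y) (r : ℕ) : ∃ w : ℤ × ℤ, y + S.s w ∈ S.win ∧
      w.1 + w.2 = u.1 + u.2 + 1 + r ∧ u + unitVec i ≤ w := by
  have hu : ∀ i : Fin 2, (unitVec i).1 + (unitVec i).2 = 1 ∧ 0 ≤ unitVec i := by
    intro i; fin_cases i <;> simp [Prod.le_def]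
  have hf : ∀ (i : Fin 2) (u : ℤ × ℤ), (i, u) ∈ S.fiber y → y + S.s (u + unitVec i) ∈ S.win := by
    intro i u h
    have := (hy.add u).forward h
    rwa [add_assoc, ← map_add] at this
  induction r with
  | zero =>
    refine ⟨u + unitVec i, hf i u h, ?_, le_rfl⟩
    have := (hu i).1
    simp; omega
  | succ r ih =>
    obtain ⟨w, h1, h2, h3⟩ := ih
    obtain ⟨j, hj⟩ := S.mem_win.1 h1
    refine ⟨w + unitVec j, hf j w hj, ?_, h3.trans (le_add_of_nonneg_right (hu j).2)⟩
    have := (hu j).1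
    simp; omega

lemma p_nonneg {v : ℤ × ℤ} (h : 0 ≤ v) : 0 ≤ S.p v := by
  have e : v = v.1 • unitVec 0 + v.2 • unitVec 1 := by ext <;> simp
  rw [e, map_add, map_zsmul, map_zsmul, zsmul_eq_mul, zsmul_eq_mul]
  have h1 : (0 : ℝ) ≤ v.1 := by exact_mod_cast h.1
  have h2 : (0 : ℝ) ≤ v.2 := by exact_mod_cast h.2
  have := S.p_pos 0
  have := S.p_pos 1
  positivity

variable {S} in
/-- A generic pattern is a tiling. -/
lemma Generic.cover_unique {y : ℝ} (hy : S.Generic y) {t : ℝ} {τ τ' : Tile} (h : τ ∈ S.cover t y)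
    (h' : τ' ∈ S.cover t y) : τ = τ' := by
  have key : ∀ τ τ' : Tile, τ ∈ S.cover t y → τ' ∈ S.cover t y →
      τ.2.1 + τ.2.2 ≤ τ'.2.1 + τ'.2.2 → τ = τ' := by
    rintro ⟨i, u⟩ ⟨j, u'⟩ h h' hle
    have hu' : y + S.s u' ∈ S.win := S.mem_win.2 ⟨j, h'.1⟩
    rcases hle.eq_or_lt with he | hlt
    · have := hy.level_unique (S.mem_win.2 ⟨i, h.1⟩) hu' he
      simp only at this; subst this
      rw [hy.start_unique h.1 h'.1]
    · simp only at hlt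
      obtain ⟨w, h1, h2, h3⟩ := hy.exists_forward h.1 (u'.1 + u'.2 - (u.1 + u.2 + 1)).toNat
      have : w = u' := hy.level_unique h1 hu' (by omega)
      subst this
      have h4 := S.p_nonneg (sub_nonneg.2 h3)
      rw [map_sub, map_add] at h4
      have h5 := h.2.2
      have h6 := h'.2.1
      simp only at h5 h6
      linarith
  rcases le_total (τ.2.1 + τ.2.2) (τ'.2.1 + τ'.2.2) with hle | hle
  · exact key _ _ h h' hle
  · exact (key _ _ h' h hle).symm

end WindowSystem

namespace WindowSystem
open Filter Topology

variable (S : WindowSystem)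

lemma isClosed_preimage_add (i : Fin 2) (c : ℝ) : IsClosed {y | y + c ∈ S.W i} :=
  (S.isClosed_W i).preimage (by fun_prop : Continuous fun y => y + c)

lemma preimage_add_subset (i : Fin 2) (c : ℝ) :
    {y | y + c ∈ S.W i} ⊆ closure (interior {y | y + c ∈ S.W i}) := by
  change (Homeomorph.addRight c) ⁻¹' S.W i ⊆ closure (interior ((Homeomorph.addRight c) ⁻¹' S.W i))
  rw [← Homeomorph.preimage_interior, ← Homeomorph.preimage_closure]
  exact preimage_mono (S.subset_closure_interior i)

/-- The union of the sets `W 0 + k β`, where `β` is the star image of the tile length of `1`. -/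
def low : Set ℝ := {x | ∃ k : ℕ, x - k * S.s (unitVec 1) ∈ S.W 0}

lemma low_eq : S.low = ⋃ k : ℕ, {y | y + -(k * S.s (unitVec 1)) ∈ S.W 0} := by
  ext x; simp [low, sub_eq_add_neg]

lemma isClosed_low (hb : S.s (unitVec 1) < 0) : IsClosed S.low := by
  rw [low_eq]
  refine LocallyFinite.isClosed_iUnion ?_ fun k => S.isClosed_preimage_add _ _
  intro x
  refine ⟨Metric.ball x 1, Metric.ball_mem_nhds _ one_pos, ?_⟩
  obtain ⟨N, hN⟩ := exists_nat_gt ((S.bd + (|x| + 1)) / (- S.s (unitVec 1)))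
  rw [div_lt_iff₀ (neg_pos.2 hb)] at hN
  refine (Set.finite_lt_nat N).subset ?_
  rintro k ⟨y, hy, hyx⟩
  rw [Metric.mem_ball, Real.dist_eq, abs_lt] at hyx
  have h1 := (abs_le.1 (S.abs_le_bd hy)).2
  have h2 := neg_abs_le x
  have : (k : ℝ) * (-S.s (unitVec 1)) < N * (-S.s (unitVec 1)) := by linarith
  exact_mod_cast lt_of_mul_lt_mul_right this (neg_pos.2 hb).le

lemma low_subset : S.low ⊆ closure (interior S.low) := by
  conv_lhs => rw [low_eq]
  refine iUnion_subset fun k => (S.preimage_add_subset _ _).trans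
    (closure_mono (interior_mono ?_))
  rw [low_eq]
  exact subset_iUnion (fun k : ℕ => {y | y + -(k * S.s (unitVec 1)) ∈ S.W 0}) k

lemma low_le (hb : S.s (unitVec 1) < 0) {x : ℝ} (hx : x ∈ S.low) : x ≤ S.bd := by
  obtain ⟨k, hk⟩ := hx
  have h1 := (abs_le.1 (S.abs_le_bd hk)).2
  have : (k : ℝ) * S.s (unitVec 1) ≤ 0 := mul_nonpos_of_nonneg_of_nonpos (by positivity) hb.le
  linarith

lemma W_zero_subset_low : S.W 0 ⊆ S.low := fun x hx => ⟨0, by simpa using hx⟩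

lemma add_mem_low_iff {x : ℝ} :
    x + S.s (unitVec 1) ∈ S.low ↔ x ∈ S.low ∨ x + S.s (unitVec 1) ∈ S.W 0 := by
  constructor
  · rintro ⟨k, hk⟩
    cases k with
    | zero => right; simpa using hk
    | succ k =>
      left; refine ⟨k, ?_⟩
      convert hk using 1; push_cast; ring
  · rintro (⟨k, hk⟩ | h)
    · refine ⟨k + 1, ?_⟩
      convert hk using 1; push_cast; ring
    · exact S.W_zero_subset_low h

variable {S} in
lemma Generic.exists_column_iff {y : ℝ} (hy : S.Generic y) :
    (∃ k : ℕ, y - k * S.s (unitVec 1) ∈ S.win) ↔ y ∈ S.low ∨ y ∈ S.W 1 := by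
  constructor
  · rintro ⟨k, hk⟩
    induction k with
    | zero =>
      obtain ⟨i, hi⟩ := S.mem_win.1 hk
      fin_cases i
      · left; exact ⟨0, hi⟩
      · right; simpa using hi
    | succ k ih =>
      obtain ⟨i, hi⟩ := S.mem_win.1 hk
      fin_cases i
      · left; exact ⟨_, hi⟩
      · apply ih
        have hg : S.Generic (y - ((k + 1 : ℕ) : ℝ) * S.s (unitVec 1)) := by
          have := hy.add (-((k + 1 : ℕ) : ℤ) • unitVec 1)
          rw [map_zsmul, zsmul_eq_mul] at this
          convert this using 1; push_cast; ring
        have := hg.forward hi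
        convert this using 1
        simp only [Fin.mk_one]
        push_cast; ring
  · rintro (⟨k, hk⟩ | h)
    · exact ⟨k, S.mem_win.2 ⟨0, hk⟩⟩
    · exact ⟨0, S.mem_win.2 ⟨1, by simpa using h⟩⟩

variable {S} in
lemma Generic.exists_column_iff' (hb : S.s (unitVec 1) < 0) {y : ℝ} (hy : S.Generic y) :
    (∃ k : ℕ, y - k * S.s (unitVec 1) ∈ S.win) ↔ y - S.s (unitVec 0) ∈ S.low := by
  have hg : ∀ k : ℕ, S.Generic (y - k * S.s (unitVec 1)) := fun k => by
    have := hy.add (-(k : ℤ) • unitVec 1)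
    rw [map_zsmul, zsmul_eq_mul] at this
    convert this using 1; push_cast; ring
  constructor
  · rintro ⟨k, hk⟩
    by_contra hc
    have key : ∀ r : ℕ, y - ((k + r : ℕ) : ℝ) * S.s (unitVec 1) ∈ S.win := by
      intro r
      induction r with
      | zero => exact hk
      | succ r ih =>
        obtain ⟨i, hi⟩ := (hg _).backward ih
        fin_cases i
        · exfalso; apply hc
          refine ⟨k + r, ?_⟩
          change y - ((k + r : ℕ) : ℝ) * S.s (unitVec 1) - S.s (unitVec 0) ∈ S.W 0 at hi
          convert hi using 1
          ring
        · refine S.mem_win.2 ⟨1, ?_⟩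
          change y - ((k + r : ℕ) : ℝ) * S.s (unitVec 1) - S.s (unitVec 1) ∈ S.W 1 at hi
          convert hi using 1
          push_cast; ring
    obtain ⟨N, hN⟩ := exists_nat_gt ((S.bd - y) / (- S.s (unitVec 1)))
    rw [div_lt_iff₀ (neg_pos.2 hb)] at hN
    have h1 := (abs_le.1 (S.abs_le_of_mem_win (key N))).2
    have h2 : (0 : ℝ) ≤ k * (- S.s (unitVec 1)) := mul_nonneg (by positivity) (by linarith)
    push_cast at h1
    linarith
  · rintro ⟨k, hk⟩
    refine ⟨k, ?_⟩
    have e : y - S.s (unitVec 0) - k * S.s (unitVec 1) =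
        y - k * S.s (unitVec 1) - S.s (unitVec 0) := by ring
    rw [e] at hk
    have h1 := ((hg k).add (- unitVec 0))
    rw [map_neg, ← sub_eq_add_neg] at h1
    simpa using h1.forward hk

lemma sub_mem_low_iff (hb : S.s (unitVec 1) < 0) {x : ℝ} :
    x - S.s (unitVec 0) ∈ S.low ↔ x ∈ S.low ∨ x ∈ S.W 1 := by
  have hc := S.isClosed_low hb
  have hp : {y | y - S.s (unitVec 0) ∈ S.low} = Homeomorph.addRight (- S.s (unitVec 0)) ⁻¹' S.low :=
    rfl
  have h1 : {y | y - S.s (unitVec 0) ∈ S.low} ⊆ S.low ∪ S.W 1 := by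
    refine S.subset_of_generic ?_ (hc.union (S.isClosed_W 1)) fun y hy hg =>
      hg.exists_column_iff.1 ((hg.exists_column_iff' hb).2
        (show y ∈ {y | y - S.s (unitVec 0) ∈ S.low} from interior_subset hy))
    rw [hp, ← Homeomorph.preimage_interior, ← Homeomorph.preimage_closure]
    exact preimage_mono S.low_subset
  have h2 : S.low ∪ S.W 1 ⊆ {y | y - S.s (unitVec 0) ∈ S.low} := by
    refine S.subset_of_generic ?_ (hc.preimage (by fun_prop)) fun y hy hg =>
      (hg.exists_column_iff' hb).1 (hg.exists_column_iff.2
        (show y ∈ S.low ∪ S.W 1 from interior_subset hy))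
    exact union_subset
      (S.low_subset.trans (closure_mono (interior_mono subset_union_left)))
      ((S.subset_closure_interior 1).trans (closure_mono (interior_mono subset_union_right)))
  exact ⟨fun h => h1 h, fun h => h2 h⟩

variable {S} in
lemma Generic.low_forward {y : ℝ} (hy : S.Generic y) (hl : y ∈ S.low) {w : ℤ × ℤ}
    (hw : y + S.s w ∈ S.win) (h : 0 < w.1 + w.2 ∨ w.1 + w.2 = 0 ∧ y ∉ S.W 0) : 1 ≤ w.1 := by
  obtain ⟨k, hk⟩ := hl
  have h1 : ((0 : Fin 2), ((0 : ℤ), -(k : ℤ))) ∈ S.fiber y := by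
    rw [mem_fiber]
    have : ((0 : ℤ), -(k : ℤ)) = (-(k : ℤ)) • unitVec 1 := by simp
    have e : S.s ((0 : ℤ), -(k : ℤ)) = -(k * S.s (unitVec 1)) := by
      rw [this, map_zsmul, zsmul_eq_mul]; push_cast; ring
    simpa only [e, ← sub_eq_add_neg] using hk
  have hk0 : 0 < w.1 + w.2 + k := by
    rcases h with h | ⟨h, h'⟩
    · omega
    · have : k ≠ 0 := by rintro rfl; exact h' (by simpa using hk)
      omega
  obtain ⟨w', h2, h3, h4⟩ := hy.exists_forward h1 (w.1 + w.2 + k - 1).toNat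
  have : w' = w := hy.level_unique h2 hw (by simp at h3; omega)
  subst this
  simpa using h4.1

variable {S} in
lemma Generic.not_mem_low_of_W_one {y : ℝ} (hy : S.Generic y) (h1 : y ∈ S.W 1) : y ∉ S.low := by
  intro hl
  have := hy.low_forward hl (w := 0) (S.mem_win.2 ⟨1, by simpa using h1⟩)
    (Or.inr ⟨rfl, fun h0 => by simpa using hy.letter_unique h0 h1⟩)
  simp at this

variable {S} in
lemma Generic.not_mem_low_of_W_zero {y : ℝ} (hy : S.Generic y)
    (h0 : y + S.s (unitVec 1) ∈ S.W 0) : y ∉ S.low := by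
  intro hl
  have := hy.low_forward hl (w := unitVec 1) (S.mem_win.2 ⟨0, h0⟩) (Or.inl (by simp))
  simp at this

lemma dimH_frontier_of_low (hb : S.s (unitVec 1) < 0) {c : ℝ} (hc : S.low = Iic c) :
    dimH (frontier S.win) = 0 := by
  have ha : ∀ x, x ≤ c + S.s (unitVec 0) ↔ x ≤ c ∨ x ∈ S.W 1 := fun x => by
    have := S.sub_mem_low_iff hb (x := x)
    rw [hc, mem_Iic, mem_Iic] at this
    rw [← this, sub_le_iff_le_add]
  have hb' : ∀ x, x ≤ c - S.s (unitVec 1) ↔ x ≤ c ∨ x + S.s (unitVec 1) ∈ S.W 0 := fun x => by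
    have := S.add_mem_low_iff (x := x)
    rw [hc, mem_Iic, mem_Iic] at this
    rw [← this, le_sub_iff_add_le]
  have h1 : S.W 1 ⊆ Ici c := S.subset_of_generic (S.subset_closure_interior 1) isClosed_Ici
    fun y hy hg => by
      have := hg.not_mem_low_of_W_one (interior_subset hy)
      rw [hc, mem_Iic, not_le] at this
      exact this.le
  have h0 : {y | y + S.s (unitVec 1) ∈ S.W 0} ⊆ Ici c :=
    S.subset_of_generic (S.preimage_add_subset 0 _) isClosed_Ici fun y hy hg => by
      have := hg.not_mem_low_of_W_zero
        (show y ∈ {y | y + S.s (unitVec 1) ∈ S.W 0} from interior_subset hy)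
      rw [hc, mem_Iic, not_le] at this
      exact this.le
  have hcW : c ∈ S.W 0 ∨ c ∈ S.W 1 := by
    left
    have hcl := S.isClosed_preimage_add 0 (S.s (unitVec 1))
    have : c - S.s (unitVec 1) ∈ {y | y + S.s (unitVec 1) ∈ S.W 0} := by
      rcases (hb' (c - S.s (unitVec 1))).1 le_rfl with h | h
      · linarith
      · exact h
    simpa using this
  have hwin : S.win = Icc (c + S.s (unitVec 1)) (c + S.s (unitVec 0)) := by
    ext x
    constructor
    · rintro (h | h)
      · have h2 : x - S.s (unitVec 1) ∈ {y | y + S.s (unitVec 1) ∈ S.W 0} := by simpa using h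
        have h3 := h0 h2
        have h4 := (hb' _).2 (Or.inr h2)
        obtain ⟨z, hz⟩ := S.nonempty 1
        have h5 := h1 hz
        have h6 := (ha z).2 (Or.inr hz)
        simp only [mem_Ici] at h3 h5
        exact ⟨by linarith, by linarith⟩
      · have h3 := h1 h
        have h4 := (ha _).2 (Or.inr h)
        simp only [mem_Ici] at h3
        exact ⟨by linarith, by linarith⟩
    · rintro ⟨h2, h3⟩
      rcases lt_trichotomy x c with h | h | h
      · left
        rcases (hb' (x - S.s (unitVec 1))).1 (by linarith) with h' | h'
        · have : x = c + S.s (unitVec 1) := by linarith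
          have hcl := S.isClosed_preimage_add 0 (S.s (unitVec 1))
          have hsub : Ioc c (c - S.s (unitVec 1)) ⊆ {y | y + S.s (unitVec 1) ∈ S.W 0} := by
            rintro z ⟨hz1, hz2⟩
            exact ((hb' z).1 hz2).resolve_left (not_le.2 hz1)
          have h5 := closure_minimal hsub hcl
          rw [closure_Ioc (by linarith : c ≠ _)] at h5
          have h6 := h5 (left_mem_Icc.2 (by linarith))
          rw [this]; exact h6
        · simpa using h'
      · subst h; exact hcW
      · right
        exact ((ha x).1 h3).resolve_left (not_le.2 h)
  rw [hwin]
  have hfin : (frontier (Icc (c + S.s (unitVec 1)) (c + S.s (unitVec 0)))).Finite := by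
    by_cases hle : c + S.s (unitVec 1) ≤ c + S.s (unitVec 0)
    · rw [frontier_Icc hle]; simp
    · rw [Icc_eq_empty hle]; simp
  exact dimH_finite hfin

end WindowSystem

namespace WindowSystem
open Filter Topology

variable (S : WindowSystem)

/-- The vertex at which a staircase enters the tile. -/
def inn (τ : Tile) : ℤ × ℤ := if τ.1 = 0 then τ.2 - unitVec 1 else τ.2

/-- The vertex at which a staircase leaves the tile. -/
def out (τ : Tile) : ℤ × ℤ := if τ.1 = 0 then τ.2 else τ.2 - unitVec 0

lemma add_mem_low_out (hb : S.s (unitVec 1) < 0) {y : ℝ} (τ : Tile) :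
    y + S.s (out τ) ∈ S.low ↔ y + S.s (inn τ) ∈ S.low ∨ τ ∈ S.fiber y := by
  obtain ⟨i, z⟩ := τ
  rw [mem_fiber]
  fin_cases i
  · have := S.add_mem_low_iff (x := y + S.s z - S.s (unitVec 1))
    rw [sub_add_cancel] at this
    simpa [out, inn, ← add_sub_assoc] using this
  · have := S.sub_mem_low_iff hb (x := y + S.s z)
    simpa [out, inn, ← add_sub_assoc] using this

lemma low_mono (hb : S.s (unitVec 1) < 0) {y : ℝ} (l k : ℕ) (h : y ∈ S.low) :
    y + l * S.s (unitVec 1) - k * S.s (unitVec 0) ∈ S.low := by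
  have h1 : y + l * S.s (unitVec 1) ∈ S.low := by
    induction l with
    | zero => simpa using h
    | succ l ih =>
      have := S.add_mem_low_iff.2 (Or.inl ih)
      convert this using 1; push_cast; ring
  induction k with
  | zero => simpa using h1
  | succ k ih =>
    have := (S.sub_mem_low_iff hb).2 (Or.inl ih)
    convert this using 1; push_cast; ring

lemma exists_steps (ha : 0 < S.s (unitVec 0)) (hb : S.s (unitVec 1) < 0) {τ τ' : Tile}
    (h : S.Over 0 τ) (h' : S.Over 0 τ') (hne : τ ≠ τ') (hs : S.s (inn τ') ≤ S.s (inn τ)) :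
    ∃ l k : ℕ, inn τ' = out τ + l • unitVec 1 - k • unitVec 0 := by
  set a := (inn τ').1 - (inn τ).1 with hadef
  set b := (inn τ').2 - (inn τ).2 with hbdef
  have e : inn τ' = inn τ + (a • unitVec 0 + b • unitVec 1) := by
    ext <;> simp [hadef, hbdef]
  have hpa := S.p_pos 0
  have hpb := S.p_pos 1
  have hp : S.p (inn τ') = S.p (inn τ) + (a * S.p (unitVec 0) + b * S.p (unitVec 1)) := by
    rw [e, map_add, map_add, map_zsmul, map_zsmul, zsmul_eq_mul, zsmul_eq_mul]
  have hs' : a * S.s (unitVec 0) + b * S.s (unitVec 1) ≤ 0 := by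
    rw [e, map_add, map_add, map_zsmul, map_zsmul, zsmul_eq_mul, zsmul_eq_mul] at hs
    linarith
  have hinn : ∀ τ : Tile, S.Over 0 τ → -(S.p (unitVec 0) + S.p (unitVec 1)) < S.p (inn τ) ∧
      S.p (inn τ) ≤ 0 ∧ (τ.1 = 0 → S.p (inn τ) ≤ - S.p (unitVec 1)) ∧
      (τ.1 = 1 → - S.p (unitVec 1) < S.p (inn τ)) := by
    rintro ⟨i, z⟩ ⟨h1, h2⟩
    fin_cases i <;> simp [inn] at h1 h2 hpa hpb ⊢ <;> constructor <;> (try constructor) <;> linarith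
  obtain ⟨p1, p2, p3, p4⟩ := hinn τ h
  obtain ⟨q1, q2, q3, q4⟩ := hinn τ' h'
  have ha0 : a ≤ 0 := by
    by_contra hc
    push Not at hc
    have h1 : (1 : ℝ) ≤ a := by exact_mod_cast hc
    have h2 : 0 < b := by
      by_contra hc'
      push Not at hc'
      have h3 : (b : ℝ) ≤ 0 := by exact_mod_cast hc'
      nlinarith
    have h3 : (1 : ℝ) ≤ b := by exact_mod_cast h2
    nlinarith
  have hb0 : 0 ≤ b := by
    by_contra hc
    push Not at hc
    have h1 : (b : ℝ) ≤ -1 := by exact_mod_cast Int.le_sub_one_of_lt hc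
    have h2 : a < 0 := by
      by_contra hc'
      push Not at hc'
      have h3 : (0 : ℝ) ≤ a := by exact_mod_cast hc'
      nlinarith
    have h3 : (a : ℝ) ≤ -1 := by exact_mod_cast Int.le_sub_one_of_lt h2
    nlinarith
  have hb0' : (0 : ℝ) ≤ b := by exact_mod_cast hb0
  have ha0' : (a : ℝ) ≤ 0 := by exact_mod_cast ha0
  have hi : τ.1 = 0 ∨ τ.1 = 1 := by omega
  have hi' : τ'.1 = 0 ∨ τ'.1 = 1 := by omega
  rcases hi with hi | hi
  · have p3 := p3 hi
    have : 1 ≤ b := by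
      by_contra hc
      have hb1 : b = 0 := by omega
      rw [hb1, Int.cast_zero, zero_mul, add_zero] at hp
      rcases ha0.lt_or_eq with h1 | h1
      · have h3 : (a : ℝ) ≤ -1 := by exact_mod_cast Int.le_sub_one_of_lt h1
        nlinarith
      · rw [h1, Int.cast_zero, zero_mul, add_zero] at hp
        rcases hi' with hi' | hi'
        · apply hne
          rw [h1, hb1] at e
          simp only [inn, hi, hi', if_true] at e
          refine Prod.ext (hi.trans hi'.symm) ?_
          simpa using e.symm
        · have := q4 hi'; linarith
    refine ⟨(b - 1).toNat, (-a).toNat, ?_⟩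
    rw [e]
    simp only [inn, out, hi, if_true]
    ext
    · simp; omega
    · simp; omega
  · have p4 := p4 hi
    have : a ≤ -1 := by
      by_contra hc
      have ha1 : a = 0 := by omega
      rw [ha1, Int.cast_zero, zero_mul, zero_add] at hp
      rcases hb0.lt_or_eq with h1 | h1
      · have h3 : (1 : ℝ) ≤ b := by exact_mod_cast h1
        nlinarith
      · rw [← h1, Int.cast_zero, zero_mul, add_zero] at hp
        rcases hi' with hi' | hi'
        · have := q3 hi'; linarith
        · apply hne
          rw [ha1, ← h1] at e
          simp [inn, hi, hi'] at e
          exact Prod.ext (hi.trans hi'.symm) e.symm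
    refine ⟨b.toNat, (-a - 1).toNat, ?_⟩
    rw [e]
    simp only [inn, out, hi, one_ne_zero, if_false]
    ext
    · simp; omega
    · simp; omega

/-- If all tiles over the origin lie on one side of a point, then `low` is a half-line. -/
lemma exists_low_eq_Iic (ha : 0 < S.s (unitVec 0)) (hb : S.s (unitVec 1) < 0) {c : ℝ}
    (h : ∀ τ, S.Over 0 τ → (∀ y, τ ∈ S.fiber y → y ≤ c) ∨ (∀ y, τ ∈ S.fiber y → c ≤ y)) :
    ∃ c', S.low = Iic c' := by
  obtain ⟨τ₀, h0⟩ := S.cover_nonempty (c - 1)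
  have hinn : ∀ τ : Tile, S.s τ.2 ≤ S.s (inn τ) := by
    rintro ⟨i, z⟩
    fin_cases i <;> simp [inn] at hb ⊢; exact hb.le
  set L : Set Tile := {τ | (S.Over 0 τ ∧ ∃ y, τ ∈ S.fiber y ∧ y < c) ∧ S.s (inn τ) ≤ S.s (inn τ₀)}
    with hL
  have hfin : L.Finite := by
    refine (S.finite_over 0 (S.bd + |c| + |S.s (inn τ₀)|)).subset ?_
    rintro τ ⟨⟨h1, y, h2, h3⟩, h4⟩
    refine ⟨h1, abs_le.2 ⟨?_, ?_⟩⟩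
    · have := (abs_le.1 (S.abs_le_bd h2)).1
      have := le_abs_self c
      have := abs_nonneg (S.s (inn τ₀))
      linarith
    · have := hinn τ
      have := le_abs_self (S.s (inn τ₀))
      have := abs_nonneg c
      have := S.bd_pos
      linarith
  obtain ⟨τ₁, h1, h2⟩ := hfin.exists_minimalFor (fun τ => S.s (inn τ)) _
    ⟨τ₀, ⟨h0.2, _, h0.1, by linarith⟩, le_rfl⟩
  have hmin : ∀ τ, S.Over 0 τ → (∃ y, τ ∈ S.fiber y ∧ y < c) → S.s (inn τ₁) ≤ S.s (inn τ) := by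
    intro τ hτ hy
    by_contra hc
    push Not at hc
    have := h2 (show τ ∈ L from ⟨⟨hτ, hy⟩, hc.le.trans h1.2⟩) hc.le
    exact absurd this hc.not_ge
  have hle : ∀ y, τ₁ ∈ S.fiber y → y ≤ c := by
    rcases h τ₁ h1.1.1 with h3 | h3
    · exact h3
    · obtain ⟨y, h4, h5⟩ := h1.1.2
      exact absurd (h3 y h4) (not_le.2 h5)
  have hcl := S.isClosed_low hb
  have hlt : S.s (out τ₁) < S.s (inn τ₁) := by
    obtain ⟨i, z⟩ := τ₁
    fin_cases i <;> simp [inn, out] at ha hb ⊢ <;> linarith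
  have key : ∀ y, y + S.s (out τ₁) ∈ S.low ↔ y ≤ c := by
    intro y
    constructor
    · intro hy
      have hbdd : BddAbove S.low := ⟨S.bd, fun x hx => S.low_le hb hx⟩
      have hm := hcl.csSup_mem ⟨_, hy⟩ hbdd
      set m := sSup S.low
      have h3 : (m - S.s (out τ₁)) + S.s (out τ₁) ∈ S.low := by rwa [sub_add_cancel]
      rcases (S.add_mem_low_out hb _).1 h3 with h4 | h4
      · have := le_csSup hbdd h4
        linarith
      · have := hle _ h4
        have := le_csSup hbdd hy
        linarith
    · intro hy
      have hsub : Iio c ⊆ {y | y + S.s (out τ₁) ∈ S.low} := by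
        intro y hy
        obtain ⟨τ, h3⟩ := S.cover_nonempty y
        have h4 : y + S.s (out τ) ∈ S.low := (S.add_mem_low_out hb τ).2 (Or.inr h3.1)
        by_cases hne : τ = τ₁
        · rw [← hne]; exact h4
        · obtain ⟨l, k, e⟩ := S.exists_steps ha hb h3.2 h1.1.1 hne (hmin τ h3.2 ⟨y, h3.1, hy⟩)
          refine (S.add_mem_low_out hb τ₁).2 (Or.inl ?_)
          have h5 := S.low_mono hb l k h4
          rw [e, map_sub, map_add, map_nsmul, map_nsmul, nsmul_eq_mul, nsmul_eq_mul]
          convert h5 using 1; ring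
      have := closure_minimal hsub (hcl.preimage (by fun_prop))
      rw [closure_Iio] at this
      exact this hy
  refine ⟨c + S.s (out τ₁), ?_⟩
  ext x
  have := key (x - S.s (out τ₁))
  rw [sub_add_cancel] at this
  rw [this, mem_Iic, sub_le_iff_le_add]

lemma win_subset_closure_interior : S.win ⊆ closure (interior S.win) :=
  union_subset ((S.subset_closure_interior 0).trans (closure_mono (interior_mono subset_union_left)))
    ((S.subset_closure_interior 1).trans (closure_mono (interior_mono subset_union_right)))

lemma eq_zero_of_mem_cover {U : Set ℝ} (hU : IsOpen U) (hUW : U ⊆ S.win) {y : ℝ} (hyU : y ∈ U)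
    {τ : Tile} (hτ : τ ∈ S.cover 0 y) : τ.2 = 0 := by
  obtain ⟨i, z⟩ := τ
  obtain ⟨x, hx, hxU⟩ := mem_closure_iff.1 (S.preimage_add_subset i (S.s z) hτ.1) U hU hyU
  obtain ⟨g, ⟨h1, h2⟩, hg⟩ := S.exists_generic (hU.inter isOpen_interior) ⟨x, hx, hxU⟩
  obtain ⟨j, hj⟩ := S.mem_win.1 (hUW h1)
  have h3 : (j, (0 : ℤ × ℤ)) ∈ S.cover 0 g :=
    ⟨by simpa [mem_fiber] using hj, by simpa [Over] using S.p_pos j⟩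
  have h4 : (i, z) ∈ S.cover 0 g :=
    ⟨show g ∈ {y | y + S.s z ∈ S.W i} from interior_subset h2, hτ.2⟩
  have := hg.cover_unique h3 h4
  simp only [Prod.mk.injEq] at this
  exact this.2.symm

lemma tile_not_both {U U' : Set ℝ} (hU : IsOpen U) (hUW : U ⊆ S.win) (hU' : U' ⊆ S.winᶜ) {τ : Tile}
    (hτ : S.Over 0 τ) {y y' : ℝ} (hy : τ ∈ S.fiber y) (hyU : y ∈ U) (hy' : τ ∈ S.fiber y')
    (hyU' : y' ∈ U') : False := by
  have hz := S.eq_zero_of_mem_cover hU hUW hyU ⟨hy, hτ⟩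
  obtain ⟨i, z⟩ := τ
  subst hz
  exact hU' hyU' (S.mem_win.2 ⟨i, by simpa [mem_fiber] using hy'⟩)

/-- The boundary of the window consists of its points over which a second tile lies. -/
lemma mem_frontier_win_iff {y : ℝ} :
    y ∈ frontier S.win ↔ y ∈ S.win ∧ ∃ τ ∈ S.cover 0 y, τ.2 ≠ 0 := by
  constructor
  · intro hy
    refine ⟨S.isCompact_win.isClosed.frontier_subset hy, ?_⟩
    obtain ⟨ε, hε, hsub⟩ := S.exists_cover_subset y
    rw [frontier_eq_closure_inter_closure] at hy
    obtain ⟨y', hy', hlt⟩ := Metric.mem_closure_iff.1 hy.2 ε hε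
    obtain ⟨τ, hτ⟩ := S.cover_nonempty y'
    refine ⟨τ, hsub y' (by rwa [← Real.dist_eq, dist_comm]) hτ, fun hz => hy' ?_⟩
    have := S.mem_fiber.1 hτ.1
    rw [hz, map_zero, add_zero] at this
    exact S.mem_win.2 ⟨_, this⟩
  · rintro ⟨hy, τ, hτ, hz⟩
    exact ⟨subset_closure hy, fun hi =>
      hz (S.eq_zero_of_mem_cover isOpen_interior interior_subset hi hτ)⟩

lemma dimH_eq_zero_of_isolated (ha : 0 < S.s (unitVec 0)) (hb : S.s (unitVec 1) < 0) {x ε : ℝ}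
    (hx : x ∈ frontier S.win) (hε : 0 < ε)
    (hiso : ∀ x' ∈ frontier S.win, |x' - x| < ε → x' = x) : dimH (frontier S.win) = 0 := by
  have hcl := S.isCompact_win.isClosed
  have hxW : x ∈ S.win := hcl.frontier_subset hx
  have hside : ∀ I : Set ℝ, IsPreconnected I → I ⊆ Ioo (x - ε) (x + ε) → x ∉ I →
      I ⊆ S.win ∨ I ⊆ S.winᶜ := by
    intro I hI hsub hxI
    by_contra hc
    push Not at hc
    obtain ⟨h1, h2⟩ := hc
    obtain ⟨u, hu, hu'⟩ := not_subset.1 h1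
    obtain ⟨w, hw, hw'⟩ := not_subset.1 h2
    have hcov : ∀ z ∈ I, z ∈ S.win → z ∈ interior S.win := by
      intro z hz hzW
      by_contra hzi
      have := hsub hz
      have hzx := hiso z ⟨subset_closure hzW, hzi⟩
        (by rw [abs_lt]; constructor <;> linarith [this.1, this.2])
      exact hxI (hzx ▸ hz)
    obtain ⟨z, hz, hz1, hz2⟩ := hI (interior S.win) S.winᶜ isOpen_interior hcl.isOpen_compl
      (fun z hz => or_iff_not_imp_right.2 fun h => hcov z hz (not_not.1 h))
      ⟨w, hw, hcov w hw (not_not.1 hw')⟩ ⟨u, hu, hu'⟩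
    exact hz2 (interior_subset hz1)
  have hl := hside (Ioo (x - ε) x) isPreconnected_Ioo
    (Ioo_subset_Ioo_right (by linarith)) (by simp)
  have hr := hside (Ioo x (x + ε)) isPreconnected_Ioo
    (Ioo_subset_Ioo_left (by linarith)) (by simp)
  have hnot : ∀ τ, S.Over 0 τ → ∀ y y', τ ∈ S.fiber y → τ ∈ S.fiber y' → y ∈ Ioo (x - ε) x →
      y' ∈ Ioo x (x + ε) → False := by
    intro τ hτ y y' hy hy' hyI hyI'
    rcases hl with hl | hl <;> rcases hr with hr | hr
    · refine hx.2 (mem_interior.2 ⟨Ioo (x - ε) (x + ε), ?_, isOpen_Ioo, by simp [hε]⟩)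
      intro z hz
      rcases lt_trichotomy z x with h | h | h
      · exact hl ⟨hz.1, h⟩
      · exact h ▸ hxW
      · exact hr ⟨h, hz.2⟩
    · exact S.tile_not_both isOpen_Ioo hl hr hτ hy hyI hy' hyI'
    · exact S.tile_not_both isOpen_Ioo hr hl hτ hy' hyI' hy hyI
    · obtain ⟨z, hz, hzi⟩ := mem_closure_iff.1 (S.win_subset_closure_interior hxW)
        (Ioo (x - ε) (x + ε)) isOpen_Ioo (by simp [hε])
      obtain ⟨z, ⟨hz, hzi⟩, hzx⟩ := (dense_compl_singleton x).inter_open_nonempty _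
        (isOpen_Ioo.inter isOpen_interior) ⟨z, hz, hzi⟩
      have hzW := interior_subset hzi
      rcases lt_or_gt_of_ne hzx with h | h
      · exact hl ⟨hz.1, h⟩ hzW
      · exact hr ⟨h, hz.2⟩ hzW
  obtain ⟨n, hn⟩ := (S.exists_pow_lt (2 * S.bd) hε).exists
  have hk := pow_ne_zero n S.kap_ne
  obtain ⟨c, hc⟩ : ∃ c, x = S.kap ^ n * c := ⟨x / S.kap ^ n, (mul_div_cancel₀ _ hk).symm⟩
  obtain ⟨c', hc'⟩ := S.exists_low_eq_Iic ha hb (c := c) (by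
    intro τ hτ
    by_contra hcon
    push Not at hcon
    obtain ⟨⟨y, hy, hyc⟩, ⟨y', hy', hyc'⟩⟩ := hcon
    obtain ⟨μ, hd, hμ⟩ := S.exists_desc_over n hτ
    rw [mul_zero] at hμ
    have h1 : μ ∈ S.fiber (S.kap ^ n * y) := S.mem_fiber_kap_pow.2 ⟨τ, hy, hd⟩
    have h2 : μ ∈ S.fiber (S.kap ^ n * y') := S.mem_fiber_kap_pow.2 ⟨τ, hy', hd⟩
    have h3 : |S.kap ^ n * y - S.kap ^ n * y'| < ε := by
      rw [← mul_sub, abs_mul, abs_pow]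
      refine lt_of_le_of_lt (mul_le_mul_of_nonneg_left ?_ (by positivity)) hn
      have := S.dist_le hy hy'
      rwa [add_sub_add_right_eq_sub] at this
    rw [abs_lt] at h3
    rcases lt_or_gt_of_ne hk with hneg | hpos
    · have h4 := mul_lt_mul_of_neg_left hyc hneg
      have h5 := mul_lt_mul_of_neg_left hyc' hneg
      refine hnot μ hμ _ _ h1 h2 ⟨?_, ?_⟩ ⟨?_, ?_⟩ <;> rw [hc] <;> linarith
    · have h4 := mul_lt_mul_of_pos_left hyc hpos
      have h5 := mul_lt_mul_of_pos_left hyc' hpos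
      refine hnot μ hμ _ _ h2 h1 ⟨?_, ?_⟩ ⟨?_, ?_⟩ <;> rw [hc] <;> linarith)
  exact S.dimH_frontier_of_low hb hc'

/-- The system with a rescaled internal space. -/
def scale (c : ℝ) (hc : c ≠ 0) : WindowSystem where
  word := S.word
  M := S.M
  M_unitVec := S.M_unitVec
  p := S.p
  s := (AddMonoidHom.mulLeft c).comp S.s
  lam := S.lam
  kap := S.kap
  one_lt_lam := S.one_lt_lam
  abs_kap := S.abs_kap
  p_M := S.p_M
  s_M := fun v => by simp [S.s_M]; ring
  p_pos := S.p_pos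
  p_inj := S.p_inj
  s_inj := fun v h => S.s_inj v (by simpa [hc] using h)
  conn := S.conn
  W := fun i => (fun x => c * x) '' S.W i
  compact := fun i => (S.compact i).image (by fun_prop)
  nonempty := fun i => (S.nonempty i).image _
  gifs := fun i x => by
    constructor
    · rintro ⟨x, hx, rfl⟩
      obtain ⟨j, w, hw, y, hy, rfl⟩ := (S.gifs i x).1 hx
      exact ⟨j, w, hw, _, ⟨y, hy, rfl⟩, by simp; ring⟩
    · rintro ⟨j, w, hw, _, ⟨y, hy, rfl⟩, rfl⟩
      exact ⟨_, (S.gifs i _).2 ⟨j, w, hw, y, hy, rfl⟩, by simp; ring⟩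

@[simp] lemma scale_s (c : ℝ) (hc : c ≠ 0) (v : ℤ × ℤ) : (S.scale c hc).s v = c * S.s v := rfl

lemma frontier_win_scale (c : ℝ) (hc : c ≠ 0) :
    frontier (S.scale c hc).win = (Homeomorph.mulLeft₀ c hc) '' frontier S.win := by
  rw [Homeomorph.image_frontier]
  congr 1
  simp only [win, image_union]
  rfl

lemma dimH_frontier_scale (c : ℝ) (hc : c ≠ 0) :
    dimH (frontier (S.scale c hc).win) = dimH (frontier S.win) := by
  rw [frontier_win_scale]
  exact (ContinuousLinearEquiv.unitsEquivAut ℝ (Units.mk0 c hc)).dimH_image (frontier S.win) ▸ by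
    congr 1; ext x; simp [mul_comm]

lemma s_ne (i : Fin 2) : S.s (unitVec i) ≠ 0 := by
  intro h
  have := S.p_pos i
  rw [S.s_inj _ h, map_zero] at this
  exact lt_irrefl _ this

/-- The star images of the tile lengths do not have the same sign. -/
lemma not_both_pos : ¬ (0 < S.s (unitVec 0) ∧ 0 < S.s (unitVec 1)) := by
  rintro ⟨ha, hb⟩
  obtain ⟨y, hy, hg⟩ := S.exists_generic isOpen_interior (S.interior_nonempty 0)
  have hyW : ((0 : Fin 2), (0 : ℤ × ℤ)) ∈ S.fiber y := by
    simpa [mem_fiber] using interior_subset hy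
  set m := min (S.s (unitVec 0)) (S.s (unitVec 1)) with hm
  have hm0 : 0 < m := lt_min ha hb
  obtain ⟨r, hr⟩ := exists_nat_gt (2 * S.bd / m)
  rw [div_lt_iff₀ hm0] at hr
  obtain ⟨w, h1, h2, h3⟩ := hg.exists_forward hyW r
  simp at h2 h3
  have h4 : S.s w = w.1 * S.s (unitVec 0) + w.2 * S.s (unitVec 1) := by
    have e : w = w.1 • unitVec 0 + w.2 • unitVec 1 := by ext <;> simp
    conv_lhs => rw [e]
    rw [map_add, map_zsmul, map_zsmul, zsmul_eq_mul, zsmul_eq_mul]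
  have h5 : (1 : ℝ) ≤ w.1 := by exact_mod_cast h3.1
  have h6 : (0 : ℝ) ≤ w.2 := by exact_mod_cast h3.2
  have h7 : (w.1 : ℝ) + w.2 = 1 + r := by exact_mod_cast h2
  have h8 := mul_le_mul_of_nonneg_left (min_le_left (S.s (unitVec 0)) (S.s (unitVec 1)))
    (zero_le_one.trans h5)
  have h9 := mul_le_mul_of_nonneg_left (min_le_right (S.s (unitVec 0)) (S.s (unitVec 1))) h6
  rw [← hm] at h8 h9
  have h10 := (abs_le.1 (S.abs_le_of_mem_win h1)).2
  have h11 := (abs_le.1 (S.abs_le_bd (interior_subset hy))).1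
  have h12 : ((w.1 : ℝ) + w.2) * m = (1 + r) * m := by rw [h7]
  nlinarith

lemma exists_near_of_dimH_pos (hd : 0 < dimH (frontier S.win)) {x : ℝ} (hx : x ∈ frontier S.win)
    {ε : ℝ} (hε : 0 < ε) : ∃ x' ∈ frontier S.win, x' ≠ x ∧ |x' - x| < ε := by
  by_contra hc
  push Not at hc
  have hiso : ∀ x' ∈ frontier S.win, |x' - x| < ε → x' = x := fun x' h1 h2 => by
    by_contra hne
    exact absurd h2 (hc x' h1 hne).not_gt
  have h0 := S.s_ne 0
  have h1 := S.s_ne 1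
  have hnb := S.not_both_pos
  set S' := S.scale (-1) (by norm_num) with hS'
  have hnb' := S'.not_both_pos
  simp only [hS', scale_s] at hnb'
  rcases lt_or_gt_of_ne h0 with h0 | h0 <;> rcases lt_or_gt_of_ne h1 with h1 | h1
  · exact hnb' ⟨by linarith, by linarith⟩
  · have := S'.dimH_eq_zero_of_isolated (x := -x) (ε := ε) (by simp only [hS', scale_s]; linarith)
      (by simp only [hS', scale_s]; linarith) (by
        rw [hS', frontier_win_scale]; exact ⟨x, hx, by simp⟩) hε (by
        rw [hS', frontier_win_scale]
        rintro _ ⟨x', hx', rfl⟩ hlt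
        have := hiso x' hx' (by
          rw [← abs_neg]; convert hlt using 2; simp; ring)
        simp [this])
    rw [hS', dimH_frontier_scale] at this
    exact hd.ne' this
  · exact hd.ne' (S.dimH_eq_zero_of_isolated h0 h1 hx hε hiso)
  · exact hnb ⟨h0, h1⟩

end WindowSystem

lemma isMCantorval_of_frontier {W : Set ℝ} (hc : IsCompact W) (hr : W ⊆ closure (interior W))
    (hne : (frontier W).Nonempty)
    (hp : ∀ x ∈ frontier W, ∀ ε > 0, ∃ x' ∈ frontier W, x' ≠ x ∧ |x' - x| < ε) :
    IsMCantorval W := by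
  have hcl := hc.isClosed
  refine ⟨⟨hc, hr, ?_⟩, hne, hc.of_isClosed_subset isClosed_frontier hcl.frontier_subset,
    ⟨isClosed_frontier, ?_⟩, ?_⟩
  · rintro x hx ⟨U, hU, hUW⟩
    set C := connectedComponentIn W x with hC
    have hCW : C ⊆ W := connectedComponentIn_subset W x
    have hCcl : IsClosed C := by
      refine isClosed_of_closure_subset ?_
      refine IsPreconnected.subset_connectedComponentIn (isPreconnected_connectedComponentIn.closure)
        (subset_closure (mem_connectedComponentIn hx)) (closure_minimal hCW hcl)
    have hbdd : BddBelow C := hc.bddBelow.mono hCW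
    have hpC := hCcl.csInf_mem ⟨x, mem_connectedComponentIn hx⟩ hbdd
    set p := sInf C with hpdef
    obtain ⟨δ, hδ, hball⟩ := Metric.isOpen_iff.1 hU p (hUW ▸ hpC : p ∈ U ∩ W).1
    have hnear : ∀ z ∈ W, |z - p| < δ → z ∈ C := fun z hz hzp =>
      hUW ▸ ⟨hball (by rwa [Metric.mem_ball, Real.dist_eq]), hz⟩
    have hpf : p ∈ frontier W := by
      refine ⟨subset_closure (hCW hpC), fun hi => ?_⟩
      obtain ⟨η, hη, hsub⟩ := Metric.isOpen_iff.1 isOpen_interior p hi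
      have h0 : 0 < min η δ / 2 := by positivity
      have h1 := min_le_left η δ
      have h2 := min_le_right η δ
      have h3 : |p - min η δ / 2 - p| = min η δ / 2 := by
        rw [show p - min η δ / 2 - p = -(min η δ / 2) by ring, abs_neg, abs_of_pos h0]
      have h4 := hnear (p - min η δ / 2)
        (interior_subset (hsub (by rw [Metric.mem_ball, Real.dist_eq, h3]; linarith)))
        (by rw [h3]; linarith)
      have := csInf_le hbdd h4
      linarith
    obtain ⟨x₁, h1, h2, h3⟩ := hp p hpf δ hδ
    have h4 := hnear x₁ (hcl.frontier_subset h1) h3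
    have h5 : p < x₁ := lt_of_le_of_ne (csInf_le hbdd h4) h2.symm
    obtain ⟨x₂, k1, k2, k3⟩ := hp p hpf (min δ (x₁ - p)) (lt_min hδ (by linarith))
    have k4 := hnear x₂ (hcl.frontier_subset k1) (k3.trans_le (min_le_left _ _))
    have k5 : p < x₂ := lt_of_le_of_ne (csInf_le hbdd k4) k2.symm
    have k6 := (abs_lt.1 (k3.trans_le (min_le_right _ _))).2
    have hsub : Icc p x₁ ⊆ W :=
      (isPreconnected_connectedComponentIn.Icc_subset hpC h4).trans hCW
    exact k1.2 (mem_interior.2 ⟨Ioo p x₁, Ioo_subset_Icc_self.trans hsub, isOpen_Ioo,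
      k5, by linarith⟩)
  · rw [preperfect_iff_nhds]
    intro x hx U hU
    obtain ⟨ε, hε, hsub⟩ := Metric.mem_nhds_iff.1 hU
    obtain ⟨x', h1, h2, h3⟩ := hp x hx ε hε
    exact ⟨x', ⟨hsub (by rwa [Metric.mem_ball, Real.dist_eq]), h1⟩, h2⟩
  · have hint : interior (frontier W) = ∅ := interior_frontier hcl
    intro t ht htc a ha b hb
    have key : ∀ a b, a ∈ t → b ∈ t → ¬ a < b := by
      intro a b ha hb hab
      have h1 : Ioo a b ⊆ interior (frontier W) := interior_maximal
        (Ioo_subset_Icc_self.trans ((htc.Icc_subset ha hb).trans ht)) isOpen_Ioo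
      rw [hint] at h1
      obtain ⟨z, hz⟩ := nonempty_Ioo.2 hab
      exact h1 hz
    exact le_antisymm (not_lt.1 (key b a hb ha)) (not_lt.1 (key a b ha hb))

theorem WindowSystem.isMCantorval (S : WindowSystem) (hd : 0 < dimH (frontier S.win)) :
    IsMCantorval S.win := by
  refine isMCantorval_of_frontier S.isCompact_win S.win_subset_closure_interior ?_
    fun x hx ε hε => S.exists_near_of_dimH_pos hd hx hε
  by_contra hne
  rw [not_nonempty_iff_eq_empty] at hne
  rw [hne, dimH_empty] at hd
  exact lt_irrefl _ hd

/-- The automorphism of `ℤ × ℤ` that belongs to an invertible integer matrix. -/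
def matEquiv (a b c d e : ℤ) (h : e * (a * d - b * c) = 1) : (ℤ × ℤ) ≃+ (ℤ × ℤ) where
  toFun v := (a * v.1 + b * v.2, c * v.1 + d * v.2)
  invFun v := (e * (d * v.1 - b * v.2), e * (a * v.2 - c * v.1))
  left_inv v := by
    ext
    · linear_combination v.1 * h
    · linear_combination v.2 * h
  right_inv v := by
    ext
    · linear_combination v.1 * h
    · linear_combination v.2 * h
  map_add' v w := by ext <;> simp <;> ring

lemma abel_eq_count (w : List (Fin 2)) : abel w = ((w.count 0 : ℤ), (w.count 1 : ℤ)) := by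
  induction w with
  | nil => rfl
  | cons a w ih =>
    rw [abel_cons, ih]
    fin_cases a <;> simp [add_comm]

namespace BinarySubstitution

variable (ρ : BinarySubstitution)

lemma reflTransGen_of_pow (k : ℕ) (i j : Fin 2) (h : (ρ.substMatrix ^ k) i j ≠ 0) :
    Relation.ReflTransGen (fun k l => l ∈ ρ k) j i := by
  induction k generalizing j with
  | zero =>
    have : i = j := by
      by_contra hne
      simp [Matrix.one_apply_ne hne] at h
    rw [this]
  | succ k ih =>
    rw [pow_succ, Matrix.mul_apply] at h
    obtain ⟨l, -, hl⟩ := Finset.exists_ne_zero_of_sum_ne_zero h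
    have h1 := left_ne_zero_of_mul hl
    have h2 := right_ne_zero_of_mul hl
    refine Relation.ReflTransGen.head ?_ (ih l h1)
    by_contra hc
    exact h2 (by simp [substMatrix, List.count_eq_zero.2 hc])

lemma substMatrix_apply (i j : Fin 2) : ρ.substMatrix i j = ((ρ j).count i : ℤ) := rfl

variable {ρ}

lemma star_inflationFactor_ne {star : ρ.inflationField ≃ₐ[ℚ] ρ.inflationField}
    (h : star ≠ AlgEquiv.refl) : star ρ.inflationFactor ≠ ρ.inflationFactor := by
  intro he
  apply h
  have h1 : (star : ρ.inflationField →ₐ[ℚ] ρ.inflationField) = AlgHom.id ℚ _ := by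
    refine IntermediateField.adjoin_algHom_ext ℚ fun x hx => ?_
    rw [mem_singleton_iff] at hx
    subst hx
    exact he
  ext x
  have := DFunLike.congr_fun h1 x
  exact congrArg Subtype.val this

/-- The homomorphism from `ℤ × ℤ` that assigns their lengths to abelianized words. -/
def lengthHom (len : Fin 2 → ρ.inflationField) : ℤ × ℤ →+ ρ.inflationField :=
  (zmultiplesHom _ (len 0)).coprod (zmultiplesHom _ (len 1))

lemma lengthHom_apply (len : Fin 2 → ρ.inflationField) (v : ℤ × ℤ) :
    lengthHom len v = v.1 * len 0 + v.2 * len 1 := by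
  simp [lengthHom]

lemma lengthHom_unitVec (len : Fin 2 → ρ.inflationField) (i : Fin 2) :
    lengthHom len (unitVec i) = len i := by
  rw [lengthHom_apply]; fin_cases i <;> simp

lemma lengthHom_abel (len : Fin 2 → ρ.inflationField) (w : List (Fin 2)) :
    lengthHom len (abel w) = (w.map len).sum := by
  induction w with
  | nil => simp
  | cons a w ih => rw [abel_cons, map_add, lengthHom_unitVec, ih]; simp

/-- The window system of a primitive unimodular substitution. -/
lemma exists_windowSystem (hprim : ρ.IsPrimitive) (huni : ρ.IsUnimodular)
    (hone : 1 < ρ.pfEigenvalue) {W : Set ℝ} (hW : ρ.IsWindow W) :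
    ∃ S : WindowSystem, S.win = W ∧ S.word = ρ := by
  obtain ⟨len, star, V, ⟨hpos, hlen⟩, hstar, ⟨hcomp, hnon, hattr⟩, rfl⟩ := hW
  have hne := star_inflationFactor_ne hstar
  set μ := ρ.inflationFactor with hμ
  have hμval : (μ : ℝ) = ρ.pfEigenvalue := rfl
  set a : ℤ := ((ρ 0).count 0 : ℤ) with hadef
  set b : ℤ := ((ρ 1).count 0 : ℤ) with hbdef
  set c : ℤ := ((ρ 0).count 1 : ℤ) with hcdef
  set d : ℤ := ((ρ 1).count 1 : ℤ) with hddef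
  have hdet : a * d - b * c = 1 ∨ a * d - b * c = -1 := by
    have := huni
    rwa [IsUnimodular, Matrix.det_fin_two] at this
  have hdd : (a * d - b * c) * (a * d - b * c) = 1 := by
    rcases hdet with h | h <;> rw [h] <;> norm_num
  have e0 : (a : ρ.inflationField) * len 0 + c * len 1 = μ * len 0 := by
    have := hlen 0
    simp only [Fin.sum_univ_two, substMatrix_apply] at this
    rwa [mul_comm (len 0), mul_comm (len 1)] at this
  have e1 : (b : ρ.inflationField) * len 0 + d * len 1 = μ * len 1 := by
    have := hlen 1
    simp only [Fin.sum_univ_two, substMatrix_apply] at this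
    rwa [mul_comm (len 0), mul_comm (len 1)] at this
  have l0 : len 0 ≠ 0 := fun h => by have := hpos 0; rw [h] at this; simp at this
  have hchar : (μ - a) * (μ - d) = b * c := by
    have : len 0 * ((μ - a) * (μ - d)) = len 0 * (b * c) := by
      linear_combination (-(μ - d)) * e0 - c * e1
    exact mul_left_cancel₀ l0 this
  have hchar' : (star μ - a) * (star μ - d) = b * c := by
    have := congrArg star hchar
    simpa using this
  have hprod : μ * star μ = a * d - b * c := by
    have h1 : (μ - star μ) * (μ + star μ - (a + d)) = 0 := by
      linear_combination hchar - hchar'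
    have h2 := (mul_eq_zero.1 h1).resolve_left (sub_ne_zero.2 hne.symm)
    linear_combination μ * h2 - hchar
  have hprodR : (μ : ℝ) * (star μ : ℝ) = ((a * d - b * c : ℤ) : ℝ) := by
    have := congrArg (fun x : ρ.inflationField => (x : ℝ)) hprod
    push_cast at this ⊢
    simpa using this
  set M := matEquiv a b c d (a * d - b * c) hdd with hM
  have hMunit : ∀ j, M (unitVec j) = abel (ρ j) := by
    intro j
    rw [abel_eq_count]
    fin_cases j <;> simp [hM, matEquiv, hadef, hbdef, hcdef, hddef]
  have hφM : ∀ v, lengthHom len (M v) = μ * lengthHom len v := by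
    intro v
    rw [lengthHom_apply, lengthHom_apply]
    simp only [hM, matEquiv, AddEquiv.coe_mk, Equiv.coe_fn_mk]
    push_cast
    linear_combination (v.1 : ρ.inflationField) * e0 + (v.2 : ρ.inflationField) * e1
  have hφ : ∀ v, lengthHom len v = 0 → v = 0 := by
    intro v hv
    rw [lengthHom_apply] at hv
    by_cases h2 : v.2 = 0
    · rw [h2, Int.cast_zero, zero_mul, add_zero] at hv
      have := (mul_eq_zero.1 hv).resolve_right l0
      exact Prod.ext (by exact_mod_cast this) h2
    · exfalso
      have h2' : (v.2 : ρ.inflationField) ≠ 0 := by exact_mod_cast h2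
      have h3 : μ = a - c * v.1 / v.2 := by
        have h4 : len 0 * (μ * v.2) = len 0 * (a * v.2 - c * v.1) := by
          linear_combination (-(v.2 : ρ.inflationField)) * e0 + c * hv
        have h5 := mul_left_cancel₀ l0 h4
        field_simp
        linear_combination h5
      apply hne
      rw [h3]; simp
  refine ⟨{
    word := ρ
    M := M
    M_unitVec := hMunit
    p := (algebraMap ρ.inflationField ℝ).toAddMonoidHom.comp (lengthHom len)
    s := (algebraMap ρ.inflationField ℝ).toAddMonoidHom.comp
      ((star : ρ.inflationField →+* ρ.inflationField).toAddMonoidHom.comp (lengthHom len))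
    lam := μ
    kap := star μ
    one_lt_lam := hone
    abs_kap := ?_
    p_M := fun v => ?_
    s_M := fun v => ?_
    p_pos := fun i => ?_
    p_inj := fun v h => ?_
    s_inj := fun v h => ?_
    conn := fun i j => ?_
    W := V
    compact := hcomp
    nonempty := hnon
    gifs := fun i x => ?_ }, rfl, rfl⟩
  · have h1 : |(μ : ℝ)| * |(star μ : ℝ)| = 1 := by
      rw [← abs_mul, hprodR]
      rcases hdet with h | h <;> rw [h] <;> norm_num
    rw [abs_of_pos (show (0 : ℝ) < μ from one_pos.trans hone)] at h1
    exact eq_inv_of_mul_eq_one_right h1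
  · simp [hφM]
  · simp [hφM]
  · have := hpos i
    simpa [lengthHom_unitVec] using this
  · exact hφ v (by simpa using h)
  · exact hφ v (by simpa using h)
  · obtain ⟨k, -, hk⟩ := hprim.exists_pos_pow
    exact ρ.reflTransGen_of_pow k i j (hk i j).ne'
  · rw [hattr i]
    simp only [mem_iUnion, mem_image, exists_prop]
    constructor
    · rintro ⟨j, t, ⟨u, v, h1, rfl⟩, y, hy, rfl⟩
      refine ⟨j, abel u, ⟨u, v, h1, rfl⟩, y, hy, ?_⟩
      simp [lengthHom_abel]
    · rintro ⟨j, w, ⟨u, v, h1, rfl⟩, y, hy, rfl⟩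
      refine ⟨j, _, ⟨u, v, h1, rfl⟩, y, hy, ?_⟩
      simp [lengthHom_abel]

theorem isMCantorval_of_dimH_pos (hprim : ρ.IsPrimitive) (huni : ρ.IsUnimodular)
    (hpis : ρ.IsPisot) {W : Set ℝ} (hW : ρ.IsWindow W) (hd : 0 < dimH (frontier W)) :
    IsMCantorval W := by
  obtain ⟨S, rfl, -⟩ := exists_windowSystem hprim huni hpis.2.1 hW
  exact S.isMCantorval hd

end BinarySubstitution

namespace ScrambledFibonacci
open Filter Topology

/-- The golden ratio. -/
abbrev τ : ℝ := Real.goldenRatio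

/-- The conjugate inflation factor. -/
def κ : ℝ := 2 - τ

/-- The growth rate of the boundary graph. -/
def θ : ℝ := 1 + √2

lemma τ_sq : τ * τ = τ + 1 := by
  have := Real.goldenRatio_sq; rw [sq] at this; exact this

lemma lt_τ : (1.618 : ℝ) < τ := by
  have h := τ_sq
  have := Real.goldenRatio_pos
  nlinarith

lemma τ_lt : τ < (1.619 : ℝ) := by
  have h := τ_sq
  nlinarith [Real.goldenRatio_pos]

lemma κ_pos : 0 < κ := by unfold κ; linarith [τ_lt]

lemma κ_lt : κ < 0.382 := by unfold κ; linarith [lt_τ]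

lemma κ_mul_τ : κ * τ = τ - 1 := by unfold κ; linear_combination -τ_sq

lemma sqrt_two_sq : √2 * √2 = (2 : ℝ) := Real.mul_self_sqrt (by norm_num)

lemma lt_sqrt_two : (1.414 : ℝ) < √2 := Real.lt_sqrt_of_sq_lt (by norm_num)

lemma sqrt_two_lt : √2 < (1.415 : ℝ) := (Real.sqrt_lt' (by norm_num)).2 (by norm_num)

lemma θ_pos : 0 < θ := by unfold θ; positivity

lemma two_lt_θ : 2 < θ := by unfold θ; linarith [lt_sqrt_two]

/-- The vertices of the boundary graph. -/
inductive Node where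
  | P : Node
  | Q : Node
  | R : Node
  | S : Node

/-- The eigenvector of the boundary graph. -/
def wt : Node → ℝ
  | .P => 1
  | .Q => 1
  | .R => √2
  | .S => √2 - 1

/-- Left endpoints of intervals that carry the boundary pieces. -/
def lo : Node → ℝ
  | .P => -1
  | .Q => -τ
  | .R => -1
  | .S => τ - 1

/-- Right endpoints of intervals that carry the boundary pieces. -/
def hi : Node → ℝ
  | .P => 0
  | .Q => -1
  | .R => 0
  | .S => 1

/-- The refinement operator of the distribution functions. -/
def step (F : Node → ℝ → ℝ) : Node → ℝ → ℝ
  | .P, x => if x ≤ 1 - τ then θ⁻¹ * F .S ((x - (2 - 2 * τ)) / κ) else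
      if x ≤ τ - 2 then θ⁻¹ * (√2 - 1 + F .Q (x / κ)) else θ⁻¹ * (√2 + F .P (x / κ))
  | .Q, x => if x ≤ 2 - 2 * τ then θ⁻¹ * F .R ((x - (2 - 2 * τ)) / κ) else
      θ⁻¹ * (√2 + F .Q ((x - (1 - τ)) / κ))
  | .R, x => if x ≤ 1 - τ then θ⁻¹ * F .R ((x - (1 - τ)) / κ) else
      if x ≤ τ - 2 then θ⁻¹ * (√2 + F .Q (x / κ)) else θ⁻¹ * (√2 + 1 + F .P (x / κ))
  | .S, x => θ⁻¹ * F .P ((x - 1) / κ)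

/-- Functions that increase from `0` to the weight on the intervals `[lo X, hi X]`. -/
def Adm (F : Node → ℝ → ℝ) : Prop :=
  ∀ X x, (x ≤ lo X → F X x = 0) ∧ (hi X ≤ x → F X x = wt X) ∧ 0 ≤ F X x ∧ F X x ≤ wt X

lemma θ_inv_mul (a : ℝ) : θ⁻¹ * a = (√2 - 1) * a := by
  have : θ⁻¹ = √2 - 1 := by
    rw [inv_eq_iff_eq_inv]
    refine eq_inv_of_mul_eq_one_left ?_
    unfold θ; linear_combination sqrt_two_sq
  rw [this]

lemma step_P_left {F : Node → ℝ → ℝ} {x : ℝ} (hx : x ≤ 1 - τ) :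
    step F .P x = θ⁻¹ * F .S ((x - (2 - 2 * τ)) / κ) := by
  simp [step, hx]

lemma step_P_mid {F : Node → ℝ → ℝ} (hF : Adm F) {x : ℝ} (hx : 1 - τ ≤ x) (hx' : x ≤ τ - 2) :
    step F .P x = θ⁻¹ * (√2 - 1 + F .Q (x / κ)) := by
  rcases hx.eq_or_lt with rfl | h
  · have h1 : F .S ((1 - τ - (2 - 2 * τ)) / κ) = √2 - 1 := (hF .S _).2.1 (by
      rw [hi, le_div_iff₀ κ_pos]; unfold κ; linarith [lt_τ])
    have h2 : F .Q ((1 - τ) / κ) = 0 := (hF .Q _).1 (by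
      rw [lo, div_le_iff₀ κ_pos]; linarith [κ_mul_τ])
    simp [step, h1, h2]
  · simp [step, h.not_ge, hx']

lemma step_P_right {F : Node → ℝ → ℝ} (hF : Adm F) {x : ℝ} (hx : τ - 2 ≤ x) :
    step F .P x = θ⁻¹ * (√2 + F .P (x / κ)) := by
  have h0 : 1 - τ < x := by linarith [lt_τ]
  rcases hx.eq_or_lt with rfl | h
  · have h1 : F .Q ((τ - 2) / κ) = 1 := (hF .Q _).2.1 (by
      rw [hi, le_div_iff₀ κ_pos]; unfold κ; linarith)
    have h2 : F .P ((τ - 2) / κ) = 0 := (hF .P _).1 (by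
      rw [lo, div_le_iff₀ κ_pos]; unfold κ; linarith)
    simp [step, h1, h2, h0.not_ge]
  · simp [step, h.not_ge, h0.not_ge]

lemma step_Q_left {F : Node → ℝ → ℝ} {x : ℝ} (hx : x ≤ 2 - 2 * τ) :
    step F .Q x = θ⁻¹ * F .R ((x - (2 - 2 * τ)) / κ) := by
  simp [step, hx]

lemma step_Q_right {F : Node → ℝ → ℝ} (hF : Adm F) {x : ℝ} (hx : 2 - 2 * τ ≤ x) :
    step F .Q x = θ⁻¹ * (√2 + F .Q ((x - (1 - τ)) / κ)) := by
  rcases hx.eq_or_lt with rfl | h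
  · have h1 : F .R 0 = √2 := (hF .R _).2.1 (by simp [hi])
    have h2 : F .Q ((2 - 2 * τ - (1 - τ)) / κ) = 0 := (hF .Q _).1 (by
      rw [lo, div_le_iff₀ κ_pos]; linarith [κ_mul_τ])
    simp [step, h1, h2]
  · simp [step, h.not_ge]

lemma step_R_left {F : Node → ℝ → ℝ} {x : ℝ} (hx : x ≤ 1 - τ) :
    step F .R x = θ⁻¹ * F .R ((x - (1 - τ)) / κ) := by
  simp [step, hx]

lemma step_R_mid {F : Node → ℝ → ℝ} (hF : Adm F) {x : ℝ} (hx : 1 - τ ≤ x) (hx' : x ≤ τ - 2) :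
    step F .R x = θ⁻¹ * (√2 + F .Q (x / κ)) := by
  rcases hx.eq_or_lt with rfl | h
  · have h1 : F .R 0 = √2 := (hF .R _).2.1 (by simp [hi])
    have h2 : F .Q ((1 - τ) / κ) = 0 := (hF .Q _).1 (by
      rw [lo, div_le_iff₀ κ_pos]; linarith [κ_mul_τ])
    simp [step, h1, h2]
  · simp [step, h.not_ge, hx']

lemma step_R_right {F : Node → ℝ → ℝ} (hF : Adm F) {x : ℝ} (hx : τ - 2 ≤ x) :
    step F .R x = θ⁻¹ * (√2 + 1 + F .P (x / κ)) := by
  have h0 : 1 - τ < x := by linarith [lt_τ]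
  rcases hx.eq_or_lt with rfl | h
  · have h1 : F .Q ((τ - 2) / κ) = 1 := (hF .Q _).2.1 (by
      rw [hi, le_div_iff₀ κ_pos]; unfold κ; linarith)
    have h2 : F .P ((τ - 2) / κ) = 0 := (hF .P _).1 (by
      rw [lo, div_le_iff₀ κ_pos]; unfold κ; linarith)
    simp [step, h1, h2, h0.not_ge]
  · simp [step, h.not_ge, h0.not_ge]

lemma step_S {F : Node → ℝ → ℝ} (x : ℝ) : step F .S x = θ⁻¹ * F .P ((x - 1) / κ) := rfl

lemma step_adm {F : Node → ℝ → ℝ} (hF : Adm F) : Adm (step F) := by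
  have hs := sqrt_two_sq
  have hs1 := lt_sqrt_two
  have hs2 := sqrt_two_lt
  have ht := lt_τ
  have ht' := τ_lt
  have hκ := κ_pos
  have hκτ := κ_mul_τ
  have hκd : κ = 2 - τ := rfl
  have b : ∀ X x, 0 ≤ F X x ∧ F X x ≤ wt X := fun X x => (hF X x).2.2
  rintro (_ | _ | _ | _) x
  · refine ⟨fun h => ?_, fun h => ?_, ?_⟩
    · simp only [lo] at h
      rw [step_P_left (by linarith), (hF .S _).1, mul_zero]
      rw [lo, div_le_iff₀ hκ]; linarith
    · simp only [hi] at h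
      rw [step_P_right hF (by linarith), (hF .P _).2.1, θ_inv_mul, wt]
      · linarith
      · rw [hi]; positivity
    · rcases le_total x (1 - τ) with h | h
      · have := b .S ((x - (2 - 2 * τ)) / κ)
        rw [step_P_left h, θ_inv_mul]; simp only [wt] at this ⊢
        constructor <;> nlinarith
      · rcases le_total x (τ - 2) with h' | h'
        · have := b .Q (x / κ)
          rw [step_P_mid hF h h', θ_inv_mul]; simp only [wt] at this ⊢
          constructor <;> nlinarith
        · have := b .P (x / κ)
          rw [step_P_right hF h', θ_inv_mul]; simp only [wt] at this ⊢
          constructor <;> nlinarith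
  · refine ⟨fun h => ?_, fun h => ?_, ?_⟩
    · simp only [lo] at h
      rw [step_Q_left (by linarith), (hF .R _).1, mul_zero]
      rw [lo, div_le_iff₀ hκ]; linarith
    · simp only [hi] at h
      rw [step_Q_right hF (by linarith), (hF .Q _).2.1, θ_inv_mul, wt]
      · linarith
      · rw [hi, le_div_iff₀ hκ]; linarith
    · rcases le_total x (2 - 2 * τ) with h | h
      · have := b .R ((x - (2 - 2 * τ)) / κ)
        rw [step_Q_left h, θ_inv_mul]; simp only [wt] at this ⊢
        constructor <;> nlinarith
      · have := b .Q ((x - (1 - τ)) / κ)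
        rw [step_Q_right hF h, θ_inv_mul]; simp only [wt] at this ⊢
        constructor <;> nlinarith
  · refine ⟨fun h => ?_, fun h => ?_, ?_⟩
    · simp only [lo] at h
      rw [step_R_left (by linarith), (hF .R _).1, mul_zero]
      rw [lo, div_le_iff₀ hκ]; linarith
    · simp only [hi] at h
      rw [step_R_right hF (by linarith), (hF .P _).2.1, θ_inv_mul, wt]
      · simp only [wt]; linarith
      · rw [hi]; positivity
    · rcases le_total x (1 - τ) with h | h
      · have := b .R ((x - (1 - τ)) / κ)
        rw [step_R_left h, θ_inv_mul]; simp only [wt] at this ⊢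
        constructor <;> nlinarith
      · rcases le_total x (τ - 2) with h' | h'
        · have := b .Q (x / κ)
          rw [step_R_mid hF h h', θ_inv_mul]; simp only [wt] at this ⊢
          constructor <;> nlinarith
        · have := b .P (x / κ)
          rw [step_R_right hF h', θ_inv_mul]; simp only [wt] at this ⊢
          constructor <;> nlinarith
  · refine ⟨fun h => ?_, fun h => ?_, ?_⟩
    · simp only [lo] at h
      rw [step_S, (hF .P _).1, mul_zero]
      rw [lo, div_le_iff₀ hκ]; linarith
    · simp only [hi] at h
      rw [step_S, (hF .P _).2.1, θ_inv_mul, wt]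
      · simp only [wt]; linarith
      · rw [hi]; exact div_nonneg (by linarith) hκ.le
    · have := b .P ((x - 1) / κ)
      rw [step_S, θ_inv_mul]; simp only [wt] at this ⊢
      constructor <;> nlinarith

lemma lip_glue {f : ℝ → ℝ} {K : ℝ} (m : ℝ) (h1 : ∀ x y, x ≤ y → y ≤ m → |f y - f x| ≤ K * (y - x))
    (h2 : ∀ x y, x ≤ y → m ≤ x → |f y - f x| ≤ K * (y - x)) :
    ∀ x y, x ≤ y → |f y - f x| ≤ K * (y - x) := by
  intro x y hxy
  rcases le_total y m with h | h
  · exact h1 x y hxy h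
  rcases le_total m x with h' | h'
  · exact h2 x y hxy h'
  have e : f y - f x = (f y - f m) + (f m - f x) := by ring
  rw [e]
  refine (abs_add_le _ _).trans ?_
  linarith [h1 x m h' le_rfl, h2 m y h le_rfl]

/-- A uniform Lipschitz bound. -/
def Lip (L : ℝ) (F : Node → ℝ → ℝ) : Prop :=
  ∀ X x y, x ≤ y → |F X y - F X x| ≤ L * (y - x)

lemma lip_branch {F : Node → ℝ → ℝ} {L : ℝ} (hL : Lip L F) (X : Node) (u c : ℝ) {x y : ℝ}
    (h : x ≤ y) : |θ⁻¹ * (c + F X ((y - u) / κ)) - θ⁻¹ * (c + F X ((x - u) / κ))| ≤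
      L / (θ * κ) * (y - x) := by
  have h1 := hL X ((x - u) / κ) ((y - u) / κ) (by
    have := κ_pos; gcongr)
  have e : θ⁻¹ * (c + F X ((y - u) / κ)) - θ⁻¹ * (c + F X ((x - u) / κ)) =
    θ⁻¹ * (F X ((y - u) / κ) - F X ((x - u) / κ)) := by ring
  rw [e, abs_mul, abs_of_pos (inv_pos.2 θ_pos)]
  refine (mul_le_mul_of_nonneg_left h1 (inv_pos.2 θ_pos).le).trans (le_of_eq ?_)
  have := κ_pos.ne'
  have := θ_pos.ne'
  field_simp
  ring

lemma step_lip {F : Node → ℝ → ℝ} (hF : Adm F) {L : ℝ} (hL : Lip L F) :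
    Lip (L / (θ * κ)) (step F) := by
  have b := fun (X : Node) (u c : ℝ) {x y : ℝ} (h : x ≤ y) => lip_branch hL X u c h
  rintro (_ | _ | _ | _)
  · refine lip_glue (1 - τ) (fun x y h h' => ?_) (fun x y h h' => ?_)
    · rw [step_P_left h', step_P_left (h.trans h')]
      simpa using b .S (2 - 2 * τ) 0 h
    · rcases le_total y (τ - 2) with h2 | h2
      · rw [step_P_mid hF (h'.trans h) h2, step_P_mid hF h' (h.trans h2)]
        simpa using b .Q 0 (√2 - 1) h
      rcases le_total (τ - 2) x with h3 | h3
      · rw [step_P_right hF (h3.trans h), step_P_right hF h3]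
        simpa using b .P 0 √2 h
      have e : step F .P y - step F .P x = (step F .P y - step F .P (τ - 2)) +
        (step F .P (τ - 2) - step F .P x) := by ring
      rw [e]
      refine (abs_add_le _ _).trans ?_
      have k1 := b .P 0 √2 h2
      have k2 := b .Q 0 (√2 - 1) h3
      simp only [sub_zero] at k1 k2
      rw [← step_P_right hF h2, ← step_P_right hF le_rfl] at k1
      rw [← step_P_mid hF h' h3, ← step_P_mid hF (h'.trans h3) le_rfl] at k2
      linarith
  · refine lip_glue (2 - 2 * τ) (fun x y h h' => ?_) (fun x y h h' => ?_)
    · rw [step_Q_left h', step_Q_left (h.trans h')]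
      simpa using b .R (2 - 2 * τ) 0 h
    · rw [step_Q_right hF h', step_Q_right hF (h'.trans h)]
      exact b .Q (1 - τ) √2 h
  · refine lip_glue (1 - τ) (fun x y h h' => ?_) (fun x y h h' => ?_)
    · rw [step_R_left h', step_R_left (h.trans h')]
      simpa using b .R (1 - τ) 0 h
    · rcases le_total y (τ - 2) with h2 | h2
      · rw [step_R_mid hF (h'.trans h) h2, step_R_mid hF h' (h.trans h2)]
        simpa using b .Q 0 √2 h
      rcases le_total (τ - 2) x with h3 | h3
      · rw [step_R_right hF (h3.trans h), step_R_right hF h3]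
        simpa using b .P 0 (√2 + 1) h
      have e : step F .R y - step F .R x = (step F .R y - step F .R (τ - 2)) +
        (step F .R (τ - 2) - step F .R x) := by ring
      rw [e]
      refine (abs_add_le _ _).trans ?_
      have k1 := b .P 0 (√2 + 1) h2
      have k2 := b .Q 0 √2 h3
      simp only [sub_zero] at k1 k2
      rw [← step_R_right hF h2, ← step_R_right hF le_rfl] at k1
      rw [← step_R_mid hF h' h3, ← step_R_mid hF (h'.trans h3) le_rfl] at k2
      linarith
  · intro x y h
    simpa [step_S] using b .P 1 0 h

lemma step_sub_le {F G : Node → ℝ → ℝ} {C : ℝ} (h : ∀ X x, |F X x - G X x| ≤ C) (X : Node) (x : ℝ) :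
    |step F X x - step G X x| ≤ θ⁻¹ * C := by
  have key : ∀ (Y : Node) (c z : ℝ), |θ⁻¹ * (c + F Y z) - θ⁻¹ * (c + G Y z)| ≤ θ⁻¹ * C := by
    intro Y c z
    have e : θ⁻¹ * (c + F Y z) - θ⁻¹ * (c + G Y z) = θ⁻¹ * (F Y z - G Y z) := by ring
    rw [e, abs_mul, abs_of_pos (inv_pos.2 θ_pos)]
    exact mul_le_mul_of_nonneg_left (h Y z) (inv_pos.2 θ_pos).le
  have key0 : ∀ (Y : Node) (z : ℝ), |θ⁻¹ * F Y z - θ⁻¹ * G Y z| ≤ θ⁻¹ * C := by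
    intro Y z; simpa using key Y 0 z
  cases X <;> simp only [step]
  · split_ifs
    · exact key0 _ _
    · exact key _ _ _
    · exact key _ _ _
  · split_ifs
    · exact key0 _ _
    · exact key _ _ _
  · split_ifs
    · exact key0 _ _
    · exact key _ _ _
    · exact key _ _ _
  · exact key0 _ _

/-- The linear approximation of the distribution functions. -/
def ramp (X : Node) (x : ℝ) : ℝ := wt X * max 0 (min 1 ((x - lo X) / (hi X - lo X)))

lemma lo_lt_hi (X : Node) : lo X < hi X := by
  have := lt_τ
  have := τ_lt
  cases X <;> simp only [lo, hi] <;> linarith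

lemma wt_pos (X : Node) : 0 < wt X := by
  have := lt_sqrt_two
  cases X <;> simp only [wt] <;> linarith

lemma wt_le (X : Node) : wt X ≤ 2 := by
  have := sqrt_two_lt
  cases X <;> simp only [wt] <;> linarith

lemma ramp_adm : Adm ramp := by
  intro X x
  have h := sub_pos.2 (lo_lt_hi X)
  have hw := wt_pos X
  refine ⟨fun hx => ?_, fun hx => ?_, ?_, ?_⟩
  · have : (x - lo X) / (hi X - lo X) ≤ 0 := div_nonpos_of_nonpos_of_nonneg (by linarith) h.le
    rw [ramp, max_eq_left ((min_le_right _ _).trans this), mul_zero]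
  · have : 1 ≤ (x - lo X) / (hi X - lo X) := by rw [le_div_iff₀ h]; linarith
    rw [ramp, min_eq_left this, max_eq_right zero_le_one, mul_one]
  · exact mul_nonneg hw.le (le_max_left _ _)
  · refine mul_le_of_le_one_right hw.le (max_le zero_le_one (min_le_left _ _))

lemma ramp_lip : Lip 2 ramp := by
  intro X x y hxy
  have h := sub_pos.2 (lo_lt_hi X)
  have hw := wt_pos X
  have hslope : wt X / (hi X - lo X) ≤ 2 := by
    rw [div_le_iff₀ h]
    have := lt_sqrt_two
    have := sqrt_two_lt
    have := lt_τ
    have := τ_lt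
    cases X <;> simp only [wt, lo, hi] <;> linarith
  have h1 : |max 0 (min 1 ((y - lo X) / (hi X - lo X))) -
      max 0 (min 1 ((x - lo X) / (hi X - lo X)))| ≤ (y - x) / (hi X - lo X) := by
    have h2 := abs_max_sub_max_le_max 0 (min 1 ((y - lo X) / (hi X - lo X))) 0
      (min 1 ((x - lo X) / (hi X - lo X)))
    have h3 := abs_min_sub_min_le_max 1 ((y - lo X) / (hi X - lo X)) 1 ((x - lo X) / (hi X - lo X))
    rw [sub_self, abs_zero] at h2 h3
    replace h2 := h2.trans (max_le (abs_nonneg _) le_rfl)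
    replace h3 := h3.trans (max_le (abs_nonneg _) le_rfl)
    have e : (y - lo X) / (hi X - lo X) - (x - lo X) / (hi X - lo X) = (y - x) / (hi X - lo X) := by
      rw [← sub_div]; congr 1; ring
    rw [e, abs_of_nonneg (div_nonneg (by linarith) h.le)] at h3
    exact h2.trans h3
  rw [ramp, ramp, ← mul_sub, abs_mul, abs_of_pos hw]
  calc wt X * _ ≤ wt X * ((y - x) / (hi X - lo X)) := mul_le_mul_of_nonneg_left h1 hw.le
    _ = wt X / (hi X - lo X) * (y - x) := by ring
    _ ≤ 2 * (y - x) := mul_le_mul_of_nonneg_right hslope (by linarith)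

/-- Approximations of the distribution functions. -/
def approx (n : ℕ) : Node → ℝ → ℝ := step^[n] ramp

lemma approx_succ (n : ℕ) : approx (n + 1) = step (approx n) := Function.iterate_succ_apply' _ _ _

lemma approx_adm (n : ℕ) : Adm (approx n) := by
  induction n with
  | zero => exact ramp_adm
  | succ n ih => rw [approx_succ]; exact step_adm ih

lemma approx_lip (n : ℕ) : Lip (2 / (θ * κ) ^ n) (approx n) := by
  induction n with
  | zero => simpa [approx] using ramp_lip
  | succ n ih =>
    rw [approx_succ, pow_succ, ← div_div]
    exact step_lip (approx_adm n) ih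

lemma approx_sub_le (n : ℕ) (X : Node) (x : ℝ) :
    |approx (n + 1) X x - approx n X x| ≤ 2 * θ⁻¹ ^ n := by
  induction n generalizing X x with
  | zero =>
    have h1 := (approx_adm 1 X x).2.2
    have h0 := (approx_adm 0 X x).2.2
    have := wt_le X
    rw [pow_zero, mul_one, abs_le]
    constructor <;> linarith
  | succ n ih =>
    rw [approx_succ (n + 1), approx_succ n]
    refine (step_sub_le (C := 2 * θ⁻¹ ^ n) ?_ X x).trans (le_of_eq (by ring))
    intro X x
    rw [← approx_succ]
    exact ih X x

lemma θ_inv_lt : θ⁻¹ < 1 := inv_lt_one_of_one_lt₀ (by linarith [two_lt_θ])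

lemma exists_tendsto (X : Node) (x : ℝ) : ∃ a, Tendsto (fun n => approx n X x) atTop (𝓝 a) :=
  cauchySeq_tendsto_of_complete (cauchySeq_of_le_geometric θ⁻¹ 2 θ_inv_lt fun n => by
    rw [dist_comm, Real.dist_eq]; exact approx_sub_le n X x)

/-- The distribution functions of the boundary pieces. -/
def dist' (X : Node) (x : ℝ) : ℝ := (exists_tendsto X x).choose

lemma tendsto_dist' (X : Node) (x : ℝ) : Tendsto (fun n => approx n X x) atTop (𝓝 (dist' X x)) :=
  (exists_tendsto X x).choose_spec

lemma approx_sub_dist'_le (n : ℕ) (X : Node) (x : ℝ) :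
    |approx n X x - dist' X x| ≤ 4 * θ⁻¹ ^ n := by
  have h := dist_le_of_le_geometric_of_tendsto θ⁻¹ 2 θ_inv_lt
    (fun n => by rw [dist_comm, Real.dist_eq]; exact approx_sub_le n X x) (tendsto_dist' X x) n
  rw [Real.dist_eq] at h
  refine h.trans ?_
  have h1 : θ⁻¹ ≤ 1 / 2 := by
    rw [inv_eq_one_div]; exact one_div_le_one_div_of_le (by norm_num) two_lt_θ.le
  have h2 : 0 < θ⁻¹ ^ n := pow_pos (inv_pos.2 θ_pos) n
  rw [div_le_iff₀ (by linarith)]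
  nlinarith

lemma dist'_adm : Adm dist' := by
  intro X x
  refine ⟨fun h => ?_, fun h => ?_, ?_, ?_⟩
  · refine tendsto_nhds_unique (tendsto_dist' X x) ?_
    simp_rw [fun n => (approx_adm n X x).1 h]
    exact tendsto_const_nhds
  · refine tendsto_nhds_unique (tendsto_dist' X x) ?_
    simp_rw [fun n => (approx_adm n X x).2.1 h]
    exact tendsto_const_nhds
  · exact ge_of_tendsto' (tendsto_dist' X x) fun n => (approx_adm n X x).2.2.1
  · exact le_of_tendsto' (tendsto_dist' X x) fun n => (approx_adm n X x).2.2.2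

lemma step_dist' : step dist' = dist' := by
  funext X x
  refine tendsto_nhds_unique ?_ ((tendsto_dist' X x).comp (tendsto_add_atTop_nat 1))
  have h : ∀ n, |step (approx n) X x - step dist' X x| ≤ θ⁻¹ * (4 * θ⁻¹ ^ n) := fun n =>
    step_sub_le (fun X x => approx_sub_dist'_le n X x) X x
  have h0 : Tendsto (fun n : ℕ => θ⁻¹ * (4 * θ⁻¹ ^ n)) atTop (𝓝 (θ⁻¹ * (4 * 0))) :=
    ((tendsto_pow_atTop_nhds_zero_of_lt_one (inv_pos.2 θ_pos).le θ_inv_lt).const_mul 4).const_mul _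
  rw [mul_zero, mul_zero] at h0
  have h1 := squeeze_zero (fun n => abs_nonneg _) h h0
  have h2 := (tendsto_zero_iff_abs_tendsto_zero _).2 h1
  have h3 := h2.add_const (step dist' X x)
  simp only [sub_add_cancel, zero_add] at h3
  refine h3.congr fun n => ?_
  simp only [Function.comp]
  rw [approx_succ]

lemma dist'_sub_le (n : ℕ) (X : Node) {x y : ℝ} (h : |y - x| ≤ κ ^ n) :
    |dist' X y - dist' X x| ≤ 10 * θ⁻¹ ^ n := by
  have h1 := approx_sub_dist'_le n X x
  have h2 := approx_sub_dist'_le n X y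
  have h3 : |approx n X y - approx n X x| ≤ 2 / (θ * κ) ^ n * |y - x| := by
    rcases le_total x y with hxy | hxy
    · rw [abs_of_nonneg (sub_nonneg.2 hxy)]; exact approx_lip n X x y hxy
    · rw [abs_sub_comm, abs_sub_comm y, abs_of_nonneg (sub_nonneg.2 hxy)]
      exact approx_lip n X y x hxy
  have h4 : 2 / (θ * κ) ^ n * |y - x| ≤ 2 * θ⁻¹ ^ n := by
    have hκ := pow_pos κ_pos n
    have hθ := pow_pos θ_pos n
    refine (mul_le_mul_of_nonneg_left h (div_nonneg zero_le_two
      (pow_pos (mul_pos θ_pos κ_pos) n).le)).trans (le_of_eq ?_)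
    rw [mul_pow, inv_pow]
    field_simp
  rw [abs_le] at *
  constructor <;> linarith [h1.1, h1.2, h2.1, h2.2, h3.1, h3.2]

end ScrambledFibonacci

namespace ScrambledFibonacci
open Filter Topology MeasureTheory
open scoped ENNReal NNReal

/-- The boundary pieces: intersections of translates of the two windows. -/
def nodeSet (A B : Set ℝ) : Node → Set ℝ
  | .P => {x | x ∈ B ∧ x ∈ A}
  | .Q => {x | x ∈ B ∧ x + τ ∈ A}
  | .R => {x | x ∈ A ∧ x + 1 ∈ A}
  | .S => {x | x ∈ A ∧ x - τ ∈ A}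

/-- The attractors of the internal space system of the scrambled Fibonacci substitution. -/
structure IsPair (A B : Set ℝ) : Prop where
  compact_left : IsCompact A
  compact_right : IsCompact B
  nonempty_left : A.Nonempty
  nonempty_right : B.Nonempty
  mem_left : ∀ x, x ∈ A ↔ (∃ y ∈ A, x = κ * y) ∨ (∃ y ∈ A, x = κ * y + (1 - τ)) ∨
    ∃ y ∈ B, x = κ * y + 1
  mem_right : ∀ x, x ∈ B ↔ (∃ y ∈ A, x = κ * y + (2 - 2 * τ)) ∨ ∃ y ∈ B, x = κ * y

variable {A B : Set ℝ}

lemma IsPair.le (h : IsPair A B) : (∀ x ∈ A, x ≤ 1) ∧ ∀ x ∈ B, x ≤ 0 := by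
  obtain ⟨a, ha, hA⟩ := h.compact_left.exists_isGreatest h.nonempty_left
  obtain ⟨b, hb, hB⟩ := h.compact_right.exists_isGreatest h.nonempty_right
  have hκ := κ_pos
  have hκ' := κ_lt
  have ht := lt_τ
  suffices h : a ≤ 1 ∧ b ≤ 0 from ⟨fun x hx => (hA hx).trans h.1, fun x hx => (hB hx).trans h.2⟩
  have hb' : b ≤ κ * a + (2 - 2 * τ) ∨ b ≤ κ * b := by
    rcases (h.mem_right b).1 hb with ⟨y, hy, e⟩ | ⟨y, hy, e⟩
    · left; rw [e]; gcongr; exact hA hy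
    · right; nth_rewrite 1 [e]; gcongr; exact hB hy
  have ha' : a ≤ κ * a ∨ a ≤ κ * a + (1 - τ) ∨ a ≤ κ * b + 1 := by
    rcases (h.mem_left a).1 ha with ⟨y, hy, e⟩ | ⟨y, hy, e⟩ | ⟨y, hy, e⟩
    · left; nth_rewrite 1 [e]; gcongr; exact hA hy
    · right; left; nth_rewrite 1 [e]; gcongr; exact hA hy
    · right; right; rw [e]; gcongr; exact hB hy
  have hb0 : b ≤ 0 := by
    rcases hb' with h1 | h1
    · rcases ha' with h2 | h2 | h2
      · have : a ≤ 0 := by nlinarith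
        nlinarith
      · have : a ≤ 0 := by nlinarith
        nlinarith
      · by_contra hc
        push Not at hc
        have h3 : κ * a ≤ κ * (κ * b + 1) := mul_le_mul_of_nonneg_left h2 hκ.le
        have h4 : κ * (κ * b) ≤ κ * b := by
          have : κ * b ≤ b := by nlinarith
          exact mul_le_mul_of_nonneg_left this hκ.le
        nlinarith
    · nlinarith
  refine ⟨?_, hb0⟩
  have : κ * b ≤ 0 := mul_nonpos_of_nonneg_of_nonpos hκ.le hb0
  rcases ha' with h2 | h2 | h2 <;> nlinarith

lemma IsPair.ge (h : IsPair A B) : (∀ x ∈ A, -1 ≤ x) ∧ ∀ x ∈ B, -τ ≤ x := by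
  obtain ⟨a, ha, hA⟩ := h.compact_left.exists_isLeast h.nonempty_left
  obtain ⟨b, hb, hB⟩ := h.compact_right.exists_isLeast h.nonempty_right
  have hκ := κ_pos
  have hκ' := κ_lt
  have ht := lt_τ
  have ht' := τ_lt
  have hκd : κ = 2 - τ := rfl
  suffices h : -1 ≤ a ∧ -τ ≤ b from ⟨fun x hx => h.1.trans (hA hx), fun x hx => h.2.trans (hB hx)⟩
  have hb' : κ * a + (2 - 2 * τ) ≤ b ∨ κ * b ≤ b := by
    rcases (h.mem_right b).1 hb with ⟨y, hy, e⟩ | ⟨y, hy, e⟩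
    · left; rw [e]; gcongr; exact hA hy
    · right; nth_rewrite 2 [e]; gcongr; exact hB hy
  have ha' : κ * a ≤ a ∨ κ * a + (1 - τ) ≤ a ∨ κ * b + 1 ≤ a := by
    rcases (h.mem_left a).1 ha with ⟨y, hy, e⟩ | ⟨y, hy, e⟩ | ⟨y, hy, e⟩
    · left; nth_rewrite 2 [e]; gcongr; exact hA hy
    · right; left; nth_rewrite 2 [e]; gcongr; exact hA hy
    · right; right; rw [e]; gcongr; exact hB hy
  have ha0 : -1 ≤ a := by
    rcases ha' with h2 | h2 | h2
    · nlinarith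
    · by_contra hc
      push Not at hc
      nlinarith
    · rcases hb' with h1 | h1
      · by_contra hc
        push Not at hc
        have h3 : κ * (κ * a + (2 - 2 * τ)) ≤ κ * b := mul_le_mul_of_nonneg_left h1 hκ.le
        have h4 : κ * κ * a ≥ a := by
          have : κ * κ ≤ 1 := by nlinarith
          nlinarith
        nlinarith
      · have : 0 ≤ b := by nlinarith
        nlinarith
  refine ⟨ha0, ?_⟩
  rcases hb' with h1 | h1
  · nlinarith
  · have : 0 ≤ b := by nlinarith
    linarith

lemma IsPair.zero_mem_right (h : IsPair A B) : (0 : ℝ) ∈ B := by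
  obtain ⟨b, hb⟩ := h.nonempty_right
  have h1 : ∀ n : ℕ, κ ^ n * b ∈ B := by
    intro n
    induction n with
    | zero => simpa using hb
    | succ n ih => exact (h.mem_right _).2 (Or.inr ⟨_, ih, by ring⟩)
  have h2 : Tendsto (fun n : ℕ => κ ^ n * b) atTop (𝓝 (0 * b)) :=
    (tendsto_pow_atTop_nhds_zero_of_lt_one κ_pos.le (by linarith [κ_lt])).mul_const b
  rw [zero_mul] at h2
  exact h.compact_right.isClosed.mem_of_tendsto h2 (Eventually.of_forall h1)

lemma IsPair.zero_mem_left (h : IsPair A B) : (0 : ℝ) ∈ A := by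
  obtain ⟨b, hb⟩ := h.nonempty_left
  have h1 : ∀ n : ℕ, κ ^ n * b ∈ A := by
    intro n
    induction n with
    | zero => simpa using hb
    | succ n ih => exact (h.mem_left _).2 (Or.inl ⟨_, ih, by ring⟩)
  have h2 : Tendsto (fun n : ℕ => κ ^ n * b) atTop (𝓝 (0 * b)) :=
    (tendsto_pow_atTop_nhds_zero_of_lt_one κ_pos.le (by linarith [κ_lt])).mul_const b
  rw [zero_mul] at h2
  exact h.compact_left.isClosed.mem_of_tendsto h2 (Eventually.of_forall h1)

lemma IsPair.one_mem_left (h : IsPair A B) : (1 : ℝ) ∈ A :=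
  (h.mem_left 1).2 (Or.inr (Or.inr ⟨0, h.zero_mem_right, by simp⟩))

/-! ### The boundary graph -/

lemma IsPair.bounds_left (h : IsPair A B) {y : ℝ} (hy : y ∈ A) : -κ ≤ κ * y ∧ κ * y ≤ κ := by
  have h1 := h.ge.1 y hy
  have h2 := h.le.1 y hy
  have := κ_pos
  constructor <;> nlinarith

lemma IsPair.bounds_right (h : IsPair A B) {y : ℝ} (hy : y ∈ B) : 1 - τ ≤ κ * y ∧ κ * y ≤ 0 := by
  have h1 := h.ge.2 y hy
  have h2 := h.le.2 y hy
  have := κ_pos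
  have := κ_mul_τ
  constructor <;> nlinarith

lemma eq_of_κ_mul_eq {x y : ℝ} (h : κ * x = κ * y) : x = y := mul_left_cancel₀ κ_pos.ne' h

lemma IsPair.of_mem_P (h : IsPair A B) {x : ℝ} (hx : x ∈ nodeSet A B .P) :
    (∃ y ∈ nodeSet A B .S, x = κ * y + (2 - 2 * τ)) ∨ (∃ y ∈ nodeSet A B .Q, x = κ * y + 0) ∨
      ∃ y ∈ nodeSet A B .P, x = κ * y + 0 := by
  obtain ⟨hB, hA⟩ := hx
  have ht := lt_τ
  have ht' := τ_lt
  have hκd : κ = 2 - τ := rfl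
  have hκτ := κ_mul_τ
  rcases (h.mem_right x).1 hB with ⟨y, hy, rfl⟩ | ⟨y, hy, rfl⟩
  · have b := h.bounds_left hy
    rcases (h.mem_left _).1 hA with ⟨z, hz, e⟩ | ⟨z, hz, e⟩ | ⟨z, hz, e⟩
    · have := h.bounds_left hz
      exfalso; linarith
    · left
      have : z = y - τ := eq_of_κ_mul_eq (by linarith)
      exact ⟨y, ⟨hy, this ▸ hz⟩, rfl⟩
    · have := h.bounds_right hz
      exfalso; linarith
  · have b := h.bounds_right hy
    rcases (h.mem_left _).1 hA with ⟨z, hz, e⟩ | ⟨z, hz, e⟩ | ⟨z, hz, e⟩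
    · right; right
      have : z = y := eq_of_κ_mul_eq e.symm
      exact ⟨y, ⟨hy, this ▸ hz⟩, by simp⟩
    · right; left
      have : z = y + τ := eq_of_κ_mul_eq (by linarith)
      exact ⟨y, ⟨hy, this ▸ hz⟩, by simp⟩
    · have := h.bounds_right hz
      exfalso; linarith

lemma IsPair.of_mem_Q (h : IsPair A B) {x : ℝ} (hx : x ∈ nodeSet A B .Q) :
    (∃ y ∈ nodeSet A B .R, x = κ * y + (2 - 2 * τ)) ∨
      (∃ y ∈ nodeSet A B .Q, x = κ * y + (1 - τ)) ∨ x = 1 - τ := by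
  obtain ⟨hB, hA⟩ := hx
  have ht := lt_τ
  have ht' := τ_lt
  have hκd : κ = 2 - τ := rfl
  have hκτ := κ_mul_τ
  rcases (h.mem_right x).1 hB with ⟨y, hy, rfl⟩ | ⟨y, hy, rfl⟩
  · have b := h.bounds_left hy
    rcases (h.mem_left _).1 hA with ⟨z, hz, e⟩ | ⟨z, hz, e⟩ | ⟨z, hz, e⟩
    · left
      have : z = y + 1 := eq_of_κ_mul_eq (by linarith)
      exact ⟨y, ⟨hy, this ▸ hz⟩, rfl⟩
    · have := h.bounds_left hz
      exfalso; linarith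
    · right; left
      have : y = z + τ := eq_of_κ_mul_eq (by linarith)
      exact ⟨z, ⟨hz, this ▸ hy⟩, by rw [this]; linarith⟩
  · have b := h.bounds_right hy
    rcases (h.mem_left _).1 hA with ⟨z, hz, e⟩ | ⟨z, hz, e⟩ | ⟨z, hz, e⟩
    · have := h.bounds_left hz
      exfalso; linarith
    · have := h.bounds_left hz
      exfalso; linarith
    · have := h.bounds_right hz
      right; right; linarith

lemma IsPair.of_mem_R (h : IsPair A B) {x : ℝ} (hx : x ∈ nodeSet A B .R) :
    (∃ y ∈ nodeSet A B .R, x = κ * y + (1 - τ)) ∨ (∃ y ∈ nodeSet A B .Q, x = κ * y + 0) ∨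
      ∃ y ∈ nodeSet A B .P, x = κ * y + 0 := by
  obtain ⟨hB, hA⟩ := hx
  have ht := lt_τ
  have ht' := τ_lt
  have hκd : κ = 2 - τ := rfl
  have hκτ := κ_mul_τ
  rcases (h.mem_left x).1 hB with ⟨y, hy, rfl⟩ | ⟨y, hy, rfl⟩ | ⟨y, hy, rfl⟩
  · have b := h.bounds_left hy
    rcases (h.mem_left _).1 hA with ⟨z, hz, e⟩ | ⟨z, hz, e⟩ | ⟨z, hz, e⟩
    · have := h.bounds_left hz
      exfalso; linarith
    · have := h.bounds_left hz
      exfalso; linarith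
    · right; right
      have : z = y := eq_of_κ_mul_eq (by linarith)
      exact ⟨z, ⟨hz, this ▸ hy⟩, by rw [this]; simp⟩
  · have b := h.bounds_left hy
    rcases (h.mem_left _).1 hA with ⟨z, hz, e⟩ | ⟨z, hz, e⟩ | ⟨z, hz, e⟩
    · left
      have : z = y + 1 := eq_of_κ_mul_eq (by linarith)
      exact ⟨y, ⟨hy, this ▸ hz⟩, rfl⟩
    · have := h.bounds_left hz
      exfalso; linarith
    · right; left
      have : y = z + τ := eq_of_κ_mul_eq (by linarith)
      exact ⟨z, ⟨hz, this ▸ hy⟩, by rw [this]; linarith⟩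
  · have b := h.bounds_right hy
    rcases (h.mem_left _).1 hA with ⟨z, hz, e⟩ | ⟨z, hz, e⟩ | ⟨z, hz, e⟩
    · have := h.bounds_left hz
      exfalso; linarith
    · have := h.bounds_left hz
      exfalso; linarith
    · have := h.bounds_right hz
      exfalso; linarith

lemma IsPair.of_mem_S (h : IsPair A B) {x : ℝ} (hx : x ∈ nodeSet A B .S) :
    ∃ y ∈ nodeSet A B .P, x = κ * y + 1 := by
  obtain ⟨hB, hA⟩ := hx
  have ht := lt_τ
  have ht' := τ_lt
  have hκd : κ = 2 - τ := rfl
  have hκτ := κ_mul_τ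
  rcases (h.mem_left x).1 hB with ⟨y, hy, rfl⟩ | ⟨y, hy, rfl⟩ | ⟨y, hy, rfl⟩
  · have b := h.bounds_left hy
    have := h.ge.1 _ hA
    exfalso; linarith
  · have b := h.bounds_left hy
    have := h.ge.1 _ hA
    exfalso; linarith
  · have b := h.bounds_right hy
    rcases (h.mem_left _).1 hA with ⟨z, hz, e⟩ | ⟨z, hz, e⟩ | ⟨z, hz, e⟩
    · have := h.bounds_left hz
      exfalso; linarith
    · have : z = y := eq_of_κ_mul_eq (by linarith)
      exact ⟨y, ⟨hy, this ▸ hz⟩, rfl⟩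
    · have := h.bounds_right hz
      exfalso; linarith

lemma IsPair.P_of_S (h : IsPair A B) {y : ℝ} (hy : y ∈ nodeSet A B .S) :
    κ * y + (2 - 2 * τ) ∈ nodeSet A B .P :=
  ⟨(h.mem_right _).2 (Or.inl ⟨y, hy.1, rfl⟩),
    (h.mem_left _).2 (Or.inr (Or.inl ⟨_, hy.2, by rw [mul_sub, κ_mul_τ]; ring⟩))⟩

lemma IsPair.P_of_Q (h : IsPair A B) {y : ℝ} (hy : y ∈ nodeSet A B .Q) :
    κ * y ∈ nodeSet A B .P :=
  ⟨(h.mem_right _).2 (Or.inr ⟨y, hy.1, rfl⟩),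
    (h.mem_left _).2 (Or.inr (Or.inl ⟨_, hy.2, by rw [mul_add, κ_mul_τ]; ring⟩))⟩

lemma IsPair.P_of_P (h : IsPair A B) {y : ℝ} (hy : y ∈ nodeSet A B .P) :
    κ * y ∈ nodeSet A B .P :=
  ⟨(h.mem_right _).2 (Or.inr ⟨y, hy.1, rfl⟩), (h.mem_left _).2 (Or.inl ⟨_, hy.2, rfl⟩)⟩

lemma IsPair.Q_of_R (h : IsPair A B) {y : ℝ} (hy : y ∈ nodeSet A B .R) :
    κ * y + (2 - 2 * τ) ∈ nodeSet A B .Q :=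
  ⟨(h.mem_right _).2 (Or.inl ⟨y, hy.1, rfl⟩),
    (h.mem_left _).2 (Or.inl ⟨_, hy.2, by unfold κ; ring⟩)⟩

lemma IsPair.Q_of_Q (h : IsPair A B) {y : ℝ} (hy : y ∈ nodeSet A B .Q) :
    κ * y + (1 - τ) ∈ nodeSet A B .Q :=
  ⟨(h.mem_right _).2 (Or.inl ⟨_, hy.2, by rw [mul_add, κ_mul_τ]; ring⟩),
    (h.mem_left _).2 (Or.inr (Or.inr ⟨_, hy.1, by ring⟩))⟩

lemma IsPair.R_of_R (h : IsPair A B) {y : ℝ} (hy : y ∈ nodeSet A B .R) :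
    κ * y + (1 - τ) ∈ nodeSet A B .R :=
  ⟨(h.mem_left _).2 (Or.inr (Or.inl ⟨y, hy.1, rfl⟩)),
    (h.mem_left _).2 (Or.inl ⟨_, hy.2, by unfold κ; ring⟩)⟩

lemma IsPair.R_of_Q (h : IsPair A B) {y : ℝ} (hy : y ∈ nodeSet A B .Q) :
    κ * y ∈ nodeSet A B .R :=
  ⟨(h.mem_left _).2 (Or.inr (Or.inl ⟨_, hy.2, by rw [mul_add, κ_mul_τ]; ring⟩)),
    (h.mem_left _).2 (Or.inr (Or.inr ⟨_, hy.1, rfl⟩))⟩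

lemma IsPair.R_of_P (h : IsPair A B) {y : ℝ} (hy : y ∈ nodeSet A B .P) :
    κ * y ∈ nodeSet A B .R :=
  ⟨(h.mem_left _).2 (Or.inl ⟨_, hy.2, rfl⟩), (h.mem_left _).2 (Or.inr (Or.inr ⟨_, hy.1, rfl⟩))⟩

lemma IsPair.S_of_P (h : IsPair A B) {y : ℝ} (hy : y ∈ nodeSet A B .P) :
    κ * y + 1 ∈ nodeSet A B .S :=
  ⟨(h.mem_left _).2 (Or.inr (Or.inr ⟨_, hy.1, rfl⟩)),
    (h.mem_left _).2 (Or.inr (Or.inl ⟨_, hy.2, by ring⟩))⟩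

/-! ### The dimension -/

/-- The Hausdorff dimension of the boundary. -/
def bdim : ℝ := Real.log (1 + √2) / (2 * Real.log Real.goldenRatio)

lemma log_τ_pos : 0 < Real.log τ := Real.log_pos (by linarith [lt_τ])

lemma bdim_pos : 0 < bdim := by
  have : 0 < Real.log θ := Real.log_pos (by linarith [two_lt_θ])
  exact div_pos this (mul_pos two_pos log_τ_pos)

lemma κ_rpow_bdim : κ ^ bdim = θ⁻¹ := by
  have h1 : κ = τ ^ (-2 : ℝ) := by
    rw [Real.rpow_neg Real.goldenRatio_pos.le, eq_comm, inv_eq_iff_eq_inv]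
    refine eq_inv_of_mul_eq_one_left ?_
    rw [show (2 : ℝ) = ((2 : ℕ) : ℝ) by norm_num, Real.rpow_natCast]
    unfold κ; linear_combination (1 - τ) * τ_sq
  have h2 := log_τ_pos
  rw [h1, ← Real.rpow_mul Real.goldenRatio_pos.le, Real.rpow_def_of_pos Real.goldenRatio_pos]
  have : Real.log Real.goldenRatio * (-2 * bdim) = - Real.log θ := by
    unfold bdim θ
    have : Real.log Real.goldenRatio ≠ 0 := h2.ne'
    field_simp
  rw [this, Real.exp_neg, Real.exp_log θ_pos]

lemma κ_pow_rpow_bdim (n : ℕ) : (κ ^ n) ^ bdim = θ⁻¹ ^ n := by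
  rw [← Real.rpow_natCast, ← Real.rpow_mul κ_pos.le, mul_comm, Real.rpow_mul κ_pos.le,
    κ_rpow_bdim, Real.rpow_natCast]

lemma IsPair.subset_ball (h : IsPair A B) (X : Node) : nodeSet A B X ⊆ Metric.closedBall 0 2 := by
  intro x hx
  have ht := τ_lt
  rw [Metric.mem_closedBall, Real.dist_eq, sub_zero, abs_le]
  have h1 : x ∈ A ∨ x ∈ B := by
    cases X
    · exact Or.inl hx.2
    · exact Or.inr hx.1
    · exact Or.inl hx.1
    · exact Or.inl hx.1
  rcases h1 with h1 | h1
  · have := h.ge.1 x h1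
    have := h.le.1 x h1
    constructor <;> linarith
  · have := h.ge.2 x h1
    have := h.le.2 x h1
    constructor <;> linarith

lemma mem_ball_branch {n : ℕ} {y c u : ℝ} (h : y ∈ Metric.closedBall c (2 * κ ^ n)) :
    κ * y + u ∈ Metric.closedBall (κ * c + u) (2 * κ ^ (n + 1)) := by
  rw [Metric.mem_closedBall, Real.dist_eq] at *
  rw [show κ * y + u - (κ * c + u) = κ * (y - c) by ring, abs_mul, abs_of_pos κ_pos]
  calc κ * |y - c| ≤ κ * (2 * κ ^ n) := mul_le_mul_of_nonneg_left h κ_pos.le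
    _ = _ := by ring

lemma IsPair.exists_cover (h : IsPair A B) (n : ℕ) (X : Node) : ∃ C : Finset ℝ,
    (C.card : ℝ) ≤ 5 * θ ^ n * wt X - 1 ∧
      ∀ x ∈ nodeSet A B X, ∃ c ∈ C, x ∈ Metric.closedBall c (2 * κ ^ n) := by
  classical
  induction n generalizing X with
  | zero =>
    refine ⟨{0}, ?_, fun x hx => ⟨0, by simp, by simpa using h.subset_ball X hx⟩⟩
    have := lt_sqrt_two
    cases X <;> simp [wt] <;> linarith
  | succ n ih =>
    choose C hC hcov using ih
    have hs := sqrt_two_sq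
    have hθ : θ = 1 + √2 := rfl
    have hcard : ∀ (X : Node) (u : ℝ), (((C X).image fun c => κ * c + u).card : ℝ) ≤
        5 * θ ^ n * wt X - 1 := fun X u =>
      le_trans (by exact_mod_cast Finset.card_image_le) (hC X)
    have hc2 : ∀ s t : Finset ℝ, ((s ∪ t).card : ℝ) ≤ s.card + t.card := fun s t => by
      exact_mod_cast Finset.card_union_le s t
    have hmem : ∀ (X : Node) (u y : ℝ), y ∈ nodeSet A B X →
        ∃ c ∈ (C X).image fun c => κ * c + u, κ * y + u ∈ Metric.closedBall c (2 * κ ^ (n + 1)) := by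
      intro X u y hy
      obtain ⟨c, hc, hyc⟩ := hcov X y hy
      exact ⟨_, Finset.mem_image_of_mem _ hc, mem_ball_branch hyc⟩
    have hθn := pow_pos θ_pos n
    cases X
    · refine ⟨((C .S).image fun c => κ * c + (2 - 2 * τ)) ∪ (((C .Q).image fun c => κ * c + 0) ∪
        ((C .P).image fun c => κ * c + 0)), ?_, fun x hx => ?_⟩
      · refine (hc2 _ _).trans ((add_le_add_right (hc2 _ _) _).trans ?_)
        have h1 := hcard .S (2 - 2 * τ)
        have h2 := hcard .Q 0
        have h3 := hcard .P 0
        simp only [wt] at *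
        have : 5 * θ ^ (n + 1) * 1 = 5 * θ ^ n * (√2 - 1) + 5 * θ ^ n * 1 + 5 * θ ^ n * 1 := by
          rw [pow_succ, hθ]; ring
        linarith
      · rcases h.of_mem_P hx with ⟨y, hy, rfl⟩ | ⟨y, hy, rfl⟩ | ⟨y, hy, rfl⟩
        · obtain ⟨c, hc, h1⟩ := hmem .S (2 - 2 * τ) y hy
          exact ⟨c, Finset.mem_union_left _ hc, h1⟩
        · obtain ⟨c, hc, h1⟩ := hmem .Q 0 y hy
          exact ⟨c, Finset.mem_union_right _ (Finset.mem_union_left _ hc), h1⟩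
        · obtain ⟨c, hc, h1⟩ := hmem .P 0 y hy
          exact ⟨c, Finset.mem_union_right _ (Finset.mem_union_right _ hc), h1⟩
    · refine ⟨((C .R).image fun c => κ * c + (2 - 2 * τ)) ∪
        (((C .Q).image fun c => κ * c + (1 - τ)) ∪ {1 - τ}), ?_, fun x hx => ?_⟩
      · refine (hc2 _ _).trans ((add_le_add_right (hc2 _ _) _).trans ?_)
        have h1 := hcard .R (2 - 2 * τ)
        have h2 := hcard .Q (1 - τ)
        simp only [wt, Finset.card_singleton, Nat.cast_one] at *
        have : 5 * θ ^ (n + 1) * 1 = 5 * θ ^ n * √2 + 5 * θ ^ n * 1 := by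
          rw [pow_succ, hθ]; ring
        linarith
      · rcases h.of_mem_Q hx with ⟨y, hy, rfl⟩ | ⟨y, hy, rfl⟩ | rfl
        · obtain ⟨c, hc, h1⟩ := hmem .R (2 - 2 * τ) y hy
          exact ⟨c, Finset.mem_union_left _ hc, h1⟩
        · obtain ⟨c, hc, h1⟩ := hmem .Q (1 - τ) y hy
          exact ⟨c, Finset.mem_union_right _ (Finset.mem_union_left _ hc), h1⟩
        · refine ⟨1 - τ, by simp, Metric.mem_closedBall_self ?_⟩
          have := κ_pos
          positivity
    · refine ⟨((C .R).image fun c => κ * c + (1 - τ)) ∪ (((C .Q).image fun c => κ * c + 0) ∪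
        ((C .P).image fun c => κ * c + 0)), ?_, fun x hx => ?_⟩
      · refine (hc2 _ _).trans ((add_le_add_right (hc2 _ _) _).trans ?_)
        have h1 := hcard .R (1 - τ)
        have h2 := hcard .Q 0
        have h3 := hcard .P 0
        simp only [wt] at *
        have : 5 * θ ^ (n + 1) * √2 = 5 * θ ^ n * √2 + 5 * θ ^ n * 1 + 5 * θ ^ n * 1 := by
          rw [pow_succ, hθ]; linear_combination 5 * (1 + √2) ^ n * hs
        linarith
      · rcases h.of_mem_R hx with ⟨y, hy, rfl⟩ | ⟨y, hy, rfl⟩ | ⟨y, hy, rfl⟩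
        · obtain ⟨c, hc, h1⟩ := hmem .R (1 - τ) y hy
          exact ⟨c, Finset.mem_union_left _ hc, h1⟩
        · obtain ⟨c, hc, h1⟩ := hmem .Q 0 y hy
          exact ⟨c, Finset.mem_union_right _ (Finset.mem_union_left _ hc), h1⟩
        · obtain ⟨c, hc, h1⟩ := hmem .P 0 y hy
          exact ⟨c, Finset.mem_union_right _ (Finset.mem_union_right _ hc), h1⟩
    · refine ⟨(C .P).image fun c => κ * c + 1, ?_, fun x hx => ?_⟩
      · have h1 := hcard .P 1
        simp only [wt] at *
        have : 5 * θ ^ (n + 1) * (√2 - 1) = 5 * θ ^ n * 1 := by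
          rw [pow_succ, hθ]; linear_combination 5 * (1 + √2) ^ n * hs
        linarith
      · obtain ⟨y, hy, rfl⟩ := h.of_mem_S hx
        exact hmem .P 1 y hy

lemma IsPair.dimH_le (h : IsPair A B) (X : Node) :
    dimH (nodeSet A B X) ≤ ENNReal.ofReal bdim := by
  choose C hC hcov using fun n => h.exists_cover n X
  set d : ℝ≥0 := bdim.toNNReal with hd
  have hdc : (d : ℝ) = bdim := Real.coe_toNNReal _ bdim_pos.le
  change _ ≤ ((d : ℝ≥0) : ℝ≥0∞)
  apply dimH_le_of_hausdorffMeasure_ne_top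
  rw [hdc]
  have hκ := κ_pos
  have hr : Tendsto (fun n : ℕ => ENNReal.ofReal (4 * κ ^ n)) atTop (𝓝 0) := by
    rw [← ENNReal.ofReal_zero]
    refine ENNReal.tendsto_ofReal ?_
    simpa using (tendsto_pow_atTop_nhds_zero_of_lt_one hκ.le (by linarith [κ_lt])).const_mul 4
  have hdiam : ∀ (n : ℕ) (c : ℝ), Metric.ediam (Metric.closedBall c (2 * κ ^ n)) ≤
      ENNReal.ofReal (4 * κ ^ n) := by
    intro n c
    refine Metric.ediam_le fun x hx y hy => ?_
    rw [edist_dist]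
    refine ENNReal.ofReal_le_ofReal ?_
    have := dist_triangle_right x y c
    rw [Metric.mem_closedBall] at hx hy
    linarith
  have hle := Measure.hausdorffMeasure_le_liminf_sum bdim (nodeSet A B X) _ hr
    (fun (n : ℕ) (c : C n) => Metric.closedBall (c : ℝ) (2 * κ ^ n))
    (Eventually.of_forall fun n c => hdiam n c)
    (Eventually.of_forall fun n x hx => by
      obtain ⟨c, hc, hxc⟩ := hcov n x hx
      exact mem_iUnion.2 ⟨⟨c, hc⟩, hxc⟩)
  refine ne_top_of_le_ne_top (b := ENNReal.ofReal (10 * 4 ^ bdim)) ENNReal.ofReal_ne_top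
    (hle.trans (liminf_le_of_frequently_le' (Frequently.of_forall fun n => ?_)))
  calc ∑ c : C n, Metric.ediam (Metric.closedBall (c : ℝ) (2 * κ ^ n)) ^ bdim
      ≤ ∑ c : C n, ENNReal.ofReal (4 * κ ^ n) ^ bdim :=
        Finset.sum_le_sum fun c _ => ENNReal.rpow_le_rpow (hdiam n c) bdim_pos.le
    _ = ENNReal.ofReal ((C n).card * (4 * κ ^ n) ^ bdim) := by
        rw [Finset.sum_const, Finset.card_univ, Fintype.card_coe, nsmul_eq_mul,
          ENNReal.ofReal_rpow_of_pos (by positivity), ENNReal.ofReal_mul (by positivity),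
          ENNReal.ofReal_natCast]
    _ ≤ ENNReal.ofReal (10 * 4 ^ bdim) := by
        refine ENNReal.ofReal_le_ofReal ?_
        rw [Real.mul_rpow (by norm_num) (by positivity), κ_pow_rpow_bdim]
        have h1 := hC n
        have h2 := wt_le X
        have h3 := pow_pos θ_pos n
        have h4 : ((C n).card : ℝ) ≤ 10 * θ ^ n := by nlinarith
        have h5 : 0 ≤ (4 : ℝ) ^ bdim * θ⁻¹ ^ n := by
          have := θ_pos; positivity
        refine (mul_le_mul_of_nonneg_right h4 h5).trans (le_of_eq ?_)
        rw [inv_pow]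
        field_simp

/-! ### The lower bound -/

lemma θ_mul_sub {v c a e : ℝ} (h : |a - (θ * v - c)| ≤ e) : |θ⁻¹ * (c + a) - v| ≤ θ⁻¹ * e := by
  have : θ⁻¹ * (c + a) - v = θ⁻¹ * (a - (θ * v - c)) := by
    have := θ_pos.ne'; field_simp; ring
  rw [this, abs_mul, abs_of_pos (inv_pos.2 θ_pos)]
  exact mul_le_mul_of_nonneg_left h (inv_pos.2 θ_pos).le

lemma IsPair.nonempty_inter (h : IsPair A B) (X : Node) :
    ∃ x ∈ nodeSet A B X, lo X ≤ x ∧ x ≤ hi X := by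
  have ht := lt_τ
  have ht' := τ_lt
  have h0 : (0 : ℝ) ∈ nodeSet A B .P := ⟨h.zero_mem_right, h.zero_mem_left⟩
  have h1 : (0 : ℝ) ∈ nodeSet A B .R := ⟨h.zero_mem_left, by simpa using h.one_mem_left⟩
  cases X
  · exact ⟨0, h0, by simp [lo], by simp [hi]⟩
  · refine ⟨_, h.Q_of_R h1, ?_, ?_⟩ <;> simp only [lo, hi] <;> linarith
  · exact ⟨0, h1, by simp [lo], by simp [hi]⟩
  · refine ⟨_, h.S_of_P h0, ?_, ?_⟩ <;> simp only [lo, hi] <;> linarith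

lemma IsPair.exists_near (h : IsPair A B) (n : ℕ) (X : Node) (v : ℝ) (hv : 0 ≤ v)
    (hv' : v ≤ wt X) : ∃ x ∈ nodeSet A B X, (lo X ≤ x ∧ x ≤ hi X) ∧
      |dist' X x - v| ≤ θ⁻¹ ^ n * 2 := by
  induction n generalizing X v with
  | zero =>
    obtain ⟨x, hx, hl⟩ := h.nonempty_inter X
    refine ⟨x, hx, hl, ?_⟩
    have h1 := (dist'_adm X x).2.2
    have h2 := wt_le X
    rw [pow_zero, one_mul, abs_le]
    constructor <;> linarith
  | succ n ih =>
    have ht := lt_τ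
    have ht' := τ_lt
    have hκ := κ_pos
    have hκd : κ = 2 - τ := rfl
    have hκτ := κ_mul_τ
    have hs := sqrt_two_sq
    have hs1 := lt_sqrt_two
    have hθ : θ = 1 + √2 := rfl
    have hθ0 := θ_pos
    have hadm := dist'_adm
    have hθv : 0 ≤ θ * v := by positivity
    have hdiv : ∀ y u : ℝ, (κ * y + u - u) / κ = y := fun y u => by field_simp; ring
    have hdiv0 : ∀ y : ℝ, κ * y / κ = y := fun y => by field_simp
    simp only [pow_succ', mul_assoc]
    cases X
    · simp only [wt, lo, hi] at *
      have hv2 : θ * v ≤ θ := by nlinarith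
      rcases le_total (θ * v) (√2 - 1) with c1 | c1
      · obtain ⟨y, hy, ⟨h1, h2⟩, h3⟩ := ih .S (θ * v) hθv c1
        refine ⟨_, h.P_of_S hy, ⟨?_, ?_⟩, ?_⟩
        · simp only at h1; nlinarith
        · simp only at h2; nlinarith
        · simp only at h2
          rw [← step_dist', step_P_left (by nlinarith), hdiv]
          simpa using θ_mul_sub (c := 0) (by simpa using h3)
      rcases le_total (θ * v) √2 with c2 | c2
      · obtain ⟨y, hy, ⟨h1, h2⟩, h3⟩ := ih .Q (θ * v - (√2 - 1)) (by linarith)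
          (by simp only; linarith)
        simp only at h1 h2
        refine ⟨_, h.P_of_Q hy, ⟨?_, ?_⟩, ?_⟩
        · nlinarith
        · nlinarith
        · rw [← step_dist', step_P_mid hadm (by nlinarith) (by nlinarith), hdiv0]
          exact θ_mul_sub h3
      · obtain ⟨y, hy, ⟨h1, h2⟩, h3⟩ := ih .P (θ * v - √2) (by linarith)
          (by simp only; linarith)
        simp only at h1 h2
        refine ⟨_, h.P_of_P hy, ⟨?_, ?_⟩, ?_⟩
        · nlinarith
        · nlinarith
        · rw [← step_dist', step_P_right hadm (by nlinarith), hdiv0]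
          exact θ_mul_sub h3
    · simp only [wt, lo, hi] at *
      have hv2 : θ * v ≤ θ := by nlinarith
      rcases le_total (θ * v) √2 with c1 | c1
      · obtain ⟨y, hy, ⟨h1, h2⟩, h3⟩ := ih .R (θ * v) hθv c1
        simp only at h1 h2
        refine ⟨_, h.Q_of_R hy, ⟨?_, ?_⟩, ?_⟩
        · nlinarith
        · nlinarith
        · rw [← step_dist', step_Q_left (by nlinarith), hdiv]
          simpa using θ_mul_sub (c := 0) (by simpa using h3)
      · obtain ⟨y, hy, ⟨h1, h2⟩, h3⟩ := ih .Q (θ * v - √2) (by linarith)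
          (by simp only; linarith)
        simp only at h1 h2
        refine ⟨_, h.Q_of_Q hy, ⟨?_, ?_⟩, ?_⟩
        · nlinarith
        · nlinarith
        · rw [← step_dist', step_Q_right hadm (by nlinarith), hdiv]
          exact θ_mul_sub h3
    · simp only [wt, lo, hi] at *
      have hv2 : θ * v ≤ √2 + 2 := by nlinarith
      rcases le_total (θ * v) √2 with c1 | c1
      · obtain ⟨y, hy, ⟨h1, h2⟩, h3⟩ := ih .R (θ * v) hθv c1
        simp only at h1 h2
        refine ⟨_, h.R_of_R hy, ⟨?_, ?_⟩, ?_⟩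
        · nlinarith
        · nlinarith
        · rw [← step_dist', step_R_left (by nlinarith), hdiv]
          simpa using θ_mul_sub (c := 0) (by simpa using h3)
      rcases le_total (θ * v) (√2 + 1) with c2 | c2
      · obtain ⟨y, hy, ⟨h1, h2⟩, h3⟩ := ih .Q (θ * v - √2) (by linarith)
          (by simp only; linarith)
        simp only at h1 h2
        refine ⟨_, h.R_of_Q hy, ⟨?_, ?_⟩, ?_⟩
        · nlinarith
        · nlinarith
        · rw [← step_dist', step_R_mid hadm (by nlinarith) (by nlinarith), hdiv0]
          exact θ_mul_sub h3
      · obtain ⟨y, hy, ⟨h1, h2⟩, h3⟩ := ih .P (θ * v - (√2 + 1)) (by linarith)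
          (by simp only; linarith)
        simp only at h1 h2
        refine ⟨_, h.R_of_P hy, ⟨?_, ?_⟩, ?_⟩
        · nlinarith
        · nlinarith
        · rw [← step_dist', step_R_right hadm (by nlinarith), hdiv0]
          exact θ_mul_sub h3
    · simp only [wt, lo, hi] at *
      have hv2 : θ * v ≤ 1 := by nlinarith
      obtain ⟨y, hy, ⟨h1, h2⟩, h3⟩ := ih .P (θ * v) hθv hv2
      simp only at h1 h2
      refine ⟨_, h.S_of_P hy, ⟨?_, ?_⟩, ?_⟩
      · nlinarith
      · nlinarith
      · rw [← step_dist', step_S, hdiv]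
        simpa using θ_mul_sub (c := 0) (by simpa using h3)

lemma dist'_holder {X : Node} {x y : ℝ} (h : |y - x| ≤ 1) :
    |dist' X y - dist' X x| ≤ 10 * θ * |y - x| ^ bdim := by
  by_cases h0 : |y - x| = 0
  · have : y = x := by rwa [abs_eq_zero, sub_eq_zero] at h0
    rw [this]; simp [Real.zero_rpow bdim_pos.ne']
  have hpos : 0 < |y - x| := lt_of_le_of_ne (abs_nonneg _) (Ne.symm h0)
  obtain ⟨n, h1, h2⟩ := exists_nat_pow_near_of_lt_one hpos h κ_pos (by linarith [κ_lt])
  refine (dist'_sub_le n X h2).trans ?_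
  have h3 := Real.rpow_le_rpow (pow_pos κ_pos (n + 1)).le h1.le bdim_pos.le
  rw [κ_pow_rpow_bdim] at h3
  have h4 : 10 * θ⁻¹ ^ n = 10 * θ * θ⁻¹ ^ (n + 1) := by
    have := θ_pos.ne'
    rw [pow_succ]; field_simp
  rw [h4]
  exact mul_le_mul_of_nonneg_left h3 (by have := θ_pos; positivity)

lemma IsPair.isClosed_Q (h : IsPair A B) : IsClosed (nodeSet A B .Q) :=
  h.compact_right.isClosed.inter
    (h.compact_left.isClosed.preimage (by fun_prop : Continuous fun x : ℝ => x + τ))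

lemma IsPair.le_dimH (h : IsPair A B) : ENNReal.ofReal bdim ≤ dimH (nodeSet A B .Q) := by
  set K := nodeSet A B .Q ∩ Icc (lo .Q) (hi .Q) with hK
  have hKc : IsCompact K := isCompact_Icc.inter_left h.isClosed_Q
  have hdist : ∀ x ∈ K, ∀ y ∈ K, |y - x| ≤ 1 := by
    rintro x ⟨-, hx⟩ y ⟨-, hy⟩
    simp only [lo, hi, mem_Icc] at hx hy
    have := τ_lt
    rw [abs_le]; constructor <;> linarith
  set d : ℝ≥0 := bdim.toNNReal with hd
  have hdc : (d : ℝ) = bdim := Real.coe_toNNReal _ bdim_pos.le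
  have hd0 : 0 < d := Real.toNNReal_pos.2 bdim_pos
  have hhol : HolderOnWith (10 * θ).toNNReal d (dist' .Q) K := by
    intro x hx y hy
    rw [edist_dist, edist_dist, hdc, ENNReal.ofReal_rpow_of_nonneg dist_nonneg bdim_pos.le]
    change _ ≤ ENNReal.ofReal (10 * θ) * _
    rw [← ENNReal.ofReal_mul (by have := θ_pos; positivity)]
    refine ENNReal.ofReal_le_ofReal ?_
    rw [Real.dist_eq, Real.dist_eq]
    exact dist'_holder (hdist y hy x hx)
  have hsub : Icc (0 : ℝ) 1 ⊆ dist' .Q '' K := by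
    have hcl : IsClosed (dist' .Q '' K) :=
      (hKc.image_of_continuousOn (hhol.continuousOn hd0)).isClosed
    intro v hv
    rw [← hcl.closure_eq, Metric.mem_closure_iff]
    intro ε hε
    have ht : Tendsto (fun n : ℕ => θ⁻¹ ^ n * 2) atTop (𝓝 (0 * 2)) :=
      (tendsto_pow_atTop_nhds_zero_of_lt_one (inv_pos.2 θ_pos).le θ_inv_lt).mul_const 2
    rw [zero_mul] at ht
    obtain ⟨n, hn⟩ := (ht.eventually_lt_const hε).exists
    obtain ⟨x, hx, hl, hxv⟩ := h.exists_near n .Q v hv.1 hv.2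
    refine ⟨_, ⟨x, ⟨hx, hl⟩, rfl⟩, ?_⟩
    rw [dist_comm, Real.dist_eq]
    exact hxv.trans_lt hn
  have h1 : (1 : ℝ≥0∞) ≤ dimH (dist' .Q '' K) := by
    refine le_trans ?_ (dimH_mono hsub)
    have : (interior (Icc (0 : ℝ) 1)).Nonempty := by simp
    rw [Real.dimH_of_nonempty_interior this]
    simp
  have h2 := h1.trans (hhol.dimH_image_le hd0)
  have h3 := h2.trans (ENNReal.div_le_div_right (dimH_mono (inter_subset_left : K ⊆ _)) _)
  rw [ENNReal.le_div_iff_mul_le (Or.inl (by exact_mod_cast hd0.ne')) (Or.inl ENNReal.coe_ne_top),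
    one_mul] at h3
  exact h3

end ScrambledFibonacci

namespace ScrambledFibonacci
open scoped ENNReal NNReal
open BinarySubstitution

lemma isPrimitive : scrambledFibonacci.IsPrimitive := by
  refine ⟨fun i j => ?_, 1, one_pos, fun i j => ?_⟩ <;> fin_cases i <;> fin_cases j <;>
    simp [substMatrix, scrambledFibonacci]

lemma isUnimodular : scrambledFibonacci.IsUnimodular := by
  left
  simp [Matrix.det_fin_two, substMatrix, scrambledFibonacci]

lemma one_lt_pfEigenvalue {W : Set ℝ} (hW : scrambledFibonacci.IsWindow W) :
    1 < scrambledFibonacci.pfEigenvalue := by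
  obtain ⟨len, -, -, ⟨hpos, hlen⟩, -⟩ := hW
  have h := congrArg Subtype.val (hlen 0)
  rw [Fin.sum_univ_two, show scrambledFibonacci.substMatrix 0 0 = 2 from rfl,
    show scrambledFibonacci.substMatrix 1 0 = 1 from rfl, Int.cast_one, mul_one] at h
  have h0 := hpos 0
  have h1 := hpos 1
  change (len 0 : ℝ) * 2 + len 1 = scrambledFibonacci.pfEigenvalue * len 0 at h
  nlinarith

/-- The scrambled Fibonacci system, with the star image of the shorter tile length scaled to `1`. -/
structure IsNormalized (S : WindowSystem) : Prop where
  word_eq : S.word = scrambledFibonacci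
  s_one : S.s (unitVec 1) = 1

variable {S : WindowSystem}

lemma eq_zsmul_add (v : ℤ × ℤ) : v = v.1 • unitVec 0 + v.2 • unitVec 1 := by
  ext <;> simp

lemma IsNormalized.M_zero (h : IsNormalized S) : S.M (unitVec 0) = 2 • unitVec 0 + unitVec 1 := by
  rw [S.M_unitVec, h.word_eq]; rfl

lemma IsNormalized.M_one (h : IsNormalized S) : S.M (unitVec 1) = unitVec 0 + unitVec 1 := by
  rw [S.M_unitVec, h.word_eq]; rfl

lemma IsNormalized.kap_eq (h : IsNormalized S) : S.kap = κ ∧ S.s (unitVec 0) = 1 - τ := by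
  have h0 := S.s_M (unitVec 0)
  have h1 := S.s_M (unitVec 1)
  rw [h.M_zero, map_add, map_nsmul, h.s_one] at h0
  rw [h.M_one, map_add, h.s_one] at h1
  simp only [nsmul_eq_mul, Nat.cast_ofNat] at h0
  have ha := abs_lt.1 S.abs_kap_lt
  have hs : S.s (unitVec 0) = S.kap - 1 := by linarith
  have hq : (S.kap - (2 - τ)) * (S.kap - (1 + τ)) = 0 := by
    rw [hs] at h0
    linear_combination -h0 - τ_sq
  have := (mul_eq_zero.1 hq).resolve_right (by linarith [lt_τ])
  have hk : S.kap = κ := by rw [κ]; linarith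
  exact ⟨hk, by rw [hs, hk, κ]; ring⟩

lemma IsNormalized.p_zero (h : IsNormalized S) : S.p (unitVec 0) = τ * S.p (unitVec 1) := by
  have h0 := S.p_M (unitVec 0)
  have h1 := S.p_M (unitVec 1)
  rw [h.M_zero, map_add, map_nsmul] at h0
  rw [h.M_one, map_add] at h1
  simp only [nsmul_eq_mul, Nat.cast_ofNat] at h0
  have hp := S.p_pos 0
  have hq := S.p_pos 1
  have e : (S.p (unitVec 0) - τ * S.p (unitVec 1)) *
      (S.p (unitVec 0) + (τ - 1) * S.p (unitVec 1)) = 0 := by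
    linear_combination S.p (unitVec 0) * h1 - S.p (unitVec 1) * h0 -
      S.p (unitVec 1) * S.p (unitVec 1) * τ_sq
  have hne : S.p (unitVec 0) + (τ - 1) * S.p (unitVec 1) ≠ 0 := by
    have := lt_τ
    have : 0 < (τ - 1) * S.p (unitVec 1) := mul_pos (by linarith) hq
    linarith
  linarith [(mul_eq_zero.1 e).resolve_right hne]

lemma IsNormalized.s_apply (h : IsNormalized S) (v : ℤ × ℤ) : S.s v = v.1 * (1 - τ) + v.2 := by
  conv_lhs => rw [eq_zsmul_add v]
  rw [map_add, map_zsmul, map_zsmul, h.s_one, h.kap_eq.2]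
  simp

lemma IsNormalized.p_apply (h : IsNormalized S) (v : ℤ × ℤ) :
    S.p v = (v.1 * τ + v.2) * S.p (unitVec 1) := by
  conv_lhs => rw [eq_zsmul_add v]
  rw [map_add, map_zsmul, map_zsmul, h.p_zero]
  simp only [zsmul_eq_mul]
  ring

lemma IsNormalized.isPair (h : IsNormalized S) : IsPair (S.W 0) (S.W 1) where
  compact_left := S.compact 0
  compact_right := S.compact 1
  nonempty_left := S.nonempty 0
  nonempty_right := S.nonempty 1
  mem_left x := by
    rw [S.gifs, h.kap_eq.1, h.word_eq]
    simp only [scrambledFibonacci, Fin.exists_fin_two, Matrix.cons_val_zero, Matrix.cons_val_one,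
      mem_occ_cons, occ_nil, h.s_apply]
    simp [sub_eq_zero, sub_sub, or_assoc]
  mem_right x := by
    rw [S.gifs, h.kap_eq.1, h.word_eq]
    simp only [scrambledFibonacci, Fin.exists_fin_two, Matrix.cons_val_zero, Matrix.cons_val_one,
      mem_occ_cons, occ_nil, h.s_apply]
    simp [sub_eq_zero, sub_sub, mul_sub]

lemma IsNormalized.over_iff (h : IsNormalized S) {i : Fin 2} {m n : ℤ} :
    S.Over 0 (i, (m, n)) ↔ m * τ + n ≤ 0 ∧ 0 < m * τ + n + (if i = 0 then τ else 1) := by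
  have hq := S.p_pos 1
  have e : S.p (m, n) + S.p (unitVec i) =
      (m * τ + n + (if i = 0 then τ else 1)) * S.p (unitVec 1) := by
    rw [h.p_apply, add_mul (_ + _) _ (S.p (unitVec 1)), add_right_inj]
    rcases Fin.exists_fin_two.1 ⟨i, rfl⟩ with rfl | rfl
    · exact h.p_zero
    · simp
  rw [WindowSystem.Over, e, h.p_apply, mul_pos_iff_of_pos_right hq]
  refine and_congr_left fun _ => ?_
  constructor
  · intro h; by_contra hc; push Not at hc; exact absurd h (not_le.2 (mul_pos hc hq))
  · intro h; exact mul_nonpos_of_nonpos_of_nonneg h hq.le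

lemma IsNormalized.nodeSet_subset_frontier (h : IsNormalized S) :
    nodeSet (S.W 0) (S.W 1) .Q ⊆ frontier S.win := by
  rintro y ⟨h1, h2⟩
  refine S.mem_frontier_win_iff.2 ⟨Or.inr h1, (0, (-1, 1)), ⟨?_, ?_⟩, by simp⟩
  · rw [S.mem_fiber, h.s_apply]
    convert h2 using 1
    push_cast; ring
  · rw [h.over_iff]
    have := lt_τ
    constructor <;> push_cast <;> simp <;> linarith

lemma IsNormalized.frontier_subset (h : IsNormalized S) :
    frontier S.win ⊆ nodeSet (S.W 0) (S.W 1) .Q ∪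
      ((fun x => x + 1) '' nodeSet (S.W 0) (S.W 1) .R ∪
      ((fun x => x - τ) '' nodeSet (S.W 0) (S.W 1) .S ∪ {0, -τ, 1})) := by
  intro y hy
  obtain ⟨hy, ⟨j, m, n⟩, ⟨hf, hov⟩, hz⟩ := S.mem_frontier_win_iff.1 hy
  rw [h.over_iff] at hov
  rw [S.mem_fiber, h.s_apply] at hf
  have lt := lt_τ
  have tl := τ_lt
  have hl := h.isPair.le
  have hg := h.isPair.ge
  have hle : (if j = 0 then τ else 1) ≤ τ := by split_ifs <;> linarith
  have hw : ∀ i, ∀ x ∈ S.W i, -τ ≤ x ∧ x ≤ 1 := by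
    intro i x hx
    fin_cases i
    · exact ⟨by linarith [hg.1 x hx], hl.1 x hx⟩
    · exact ⟨hg.2 x hx, by linarith [hl.2 x hx]⟩
  have hyb : -τ ≤ y ∧ y ≤ 1 := by
    obtain ⟨i, hi⟩ := S.mem_win.1 hy
    exact hw i y hi
  have hfb := hw _ _ hf
  simp only at hf hfb hz
  have hm1 : m < 2 := by
    by_contra hc
    have : (2 : ℝ) ≤ m := by exact_mod_cast not_lt.1 hc
    nlinarith
  have hm2 : -2 < m := by
    by_contra hc
    have : (m : ℝ) ≤ -2 := by exact_mod_cast not_lt.1 hc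
    nlinarith
  have hn1 : n < 2 := by
    by_contra hc
    have h1 : (2 : ℝ) ≤ n := by exact_mod_cast not_lt.1 hc
    have h2 : (-1 : ℝ) ≤ m := by exact_mod_cast hm2
    nlinarith
  have hn2 : -4 < n := by
    by_contra hc
    have h1 : (n : ℝ) ≤ -4 := by exact_mod_cast not_lt.1 hc
    have h2 : (m : ℝ) ≤ 1 := by exact_mod_cast Int.lt_add_one_iff.1 hm1
    nlinarith
  have hcase : (m = 0 ∧ n = -1) ∨ (m = -1 ∧ n = 1) ∨ (m = 1 ∧ n = -2) := by
    interval_cases m <;> interval_cases n <;> simp at hz ⊢ <;> push_cast at hov hfb <;> linarith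
  rcases hcase with ⟨rfl, rfl⟩ | ⟨rfl, rfl⟩ | ⟨rfl, rfl⟩
  · have e : y + (((0 : ℤ) : ℝ) * (1 - τ) + ((-1 : ℤ) : ℝ)) = y - 1 := by push_cast; ring
    rw [e] at hf
    fin_cases j
    · have hf' : y - 1 ∈ S.W 0 := hf
      rcases hy with hy | hy
      · exact Or.inr (Or.inl ⟨y - 1, ⟨hf', by simpa using hy⟩, by simp⟩)
      · have : y = 0 := le_antisymm (hl.2 y hy) (by linarith [hg.1 _ hf'])
        simp [this]
    · norm_num at hov
  · have e : y + (((-1 : ℤ) : ℝ) * (1 - τ) + ((1 : ℤ) : ℝ)) = y + τ := by push_cast; ring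
    rw [e] at hf
    fin_cases j
    · have hf' : y + τ ∈ S.W 0 := hf
      rcases hy with hy | hy
      · exact Or.inr (Or.inr (Or.inl ⟨y + τ, ⟨hf', by simpa using hy⟩, by simp⟩))
      · exact Or.inl ⟨hy, hf'⟩
    · have hf' : y + τ ∈ S.W 1 := hf
      have : y = -τ := le_antisymm (by linarith [hl.2 _ hf']) hyb.1
      simp [this]
  · have : y = 1 := le_antisymm hyb.2 (by push_cast at hfb; linarith)
    simp [this]

lemma IsNormalized.dimH_frontier (h : IsNormalized S) :
    dimH (frontier S.win) = ENNReal.ofReal bdim := by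
  refine le_antisymm ?_ (h.isPair.le_dimH.trans (dimH_mono h.nodeSet_subset_frontier))
  refine (dimH_mono h.frontier_subset).trans ?_
  simp only [dimH_union, sup_le_iff]
  refine ⟨h.isPair.dimH_le _, ?_, ?_, ?_⟩
  · exact ((isometry_add_right (1 : ℝ)).dimH_image _).trans_le (h.isPair.dimH_le _)
  · exact ((IsometryEquiv.subRight (τ : ℝ)).isometry.dimH_image _).trans_le (h.isPair.dimH_le _)
  · rw [(Set.toFinite _).dimH_zero]
    exact zero_le

/-- The window of the scrambled Fibonacci substitution. -/
theorem dimH_frontier_and_isMCantorval {W : Set ℝ} (hW : scrambledFibonacci.IsWindow W) :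
    dimH (frontier W) = ENNReal.ofReal bdim ∧ IsMCantorval W := by
  obtain ⟨S, rfl, hS⟩ := exists_windowSystem isPrimitive isUnimodular (one_lt_pfEigenvalue hW) hW
  have hc := inv_ne_zero (S.s_ne 1)
  have hN : IsNormalized (S.scale _ hc) := ⟨hS, inv_mul_cancel₀ (S.s_ne 1)⟩
  have hd : dimH (frontier S.win) = ENNReal.ofReal bdim := by
    rw [← S.dimH_frontier_scale _ hc, hN.dimH_frontier]
  refine ⟨hd, S.isMCantorval ?_⟩
  rw [hd, ENNReal.ofReal_pos]
  exact bdim_pos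

end ScrambledFibonacci

end

theorem mainTheorem1 :
    (∀ ρ : BinarySubstitution, ρ.IsPrimitive → ρ.IsUnimodular → ρ.IsPisot →
      ∀ W : Set ℝ, ρ.IsWindow W → 0 < dimH (frontier W) → IsMCantorval W) ∧
    (∀ W : Set ℝ, BinarySubstitution.scrambledFibonacci.IsWindow W →
      dimH (frontier W) =
          ENNReal.ofReal (Real.log (1 + Real.sqrt 2) / (2 * Real.log Real.goldenRatio)) ∧
        IsMCantorval W) := by
  exact ⟨fun ρ hprim huni hpis W hW hd =>
      BinarySubstitution.isMCantorval_of_dimH_pos hprim huni hpis hW hd,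
    fun W hW => ScrambledFibonacci.dimH_frontier_and_isMCantorval hW⟩
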